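/- All modules are right modules. Let $\Gamma$ and $\Lambda$ be right Noetherian rings, and let $(\mathsf{Mod}\,\Gamma,\mathsf{Mod}\,\Lambda,\mathsf i,\mathsf e,\mathsf l)$ be a cleft extension of module categories, that is, additive functors $\mathsf i\colon\mathsf{Mod}\,\Gamma\to\mathsf{Mod}\,\Lambda$, $\mathsf e\colon\mathsf{Mod}\,\Lambda\to\mathsf{Mod}\,\Gamma$, $\mathsf l\colon\mathsf{Mod}\,\Gamma\to\mathsf{Mod}\,\Lambda$ such that $\mathsf e$ is faithful and exact, $\mathsf l$ is left adjoint to $\mathsf e$, and $\mathsf e\mathsf i\simeq\mathrm{Id}$. Let $\mathsf G(X)=\ker(\mathsf l\mathsf e(X)\to X)$ be the kernel of the counit and $\mathsf F=\mathsf e\mathsf G\mathsf i\colon\mathsf{Mod}\,\Gamma\to\mathsf{Mod}\,\Gamma$. Assume that $\mathsf F$ is nilpotent ($\mathsf F^m=0$ for some $m$) and perfect, i.e. * $\mathbb L_i\mathsf F^j(\mathsf F(P))=0$ for all $i,j\ge 1$ and every projective $P$; * there is $n\ge 0$ with $\mathbb L_p\mathsf F^q=0$ for all $p,q\ge 1$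 with $p+q\ge n+1$; * $\mathsf F(P)$ has finite projective dimension for every projective $P$. For a right Noetherian ring $R$ let $\mathsf{mod}\,R$ be the category of finitely generated right $R$-modules, $\mathsf D_{\mathsf{sg}}(R)=\mathsf D^{\mathsf b}(\mathsf{mod}\,R)/\mathsf K^{\mathsf b}(\mathsf{proj}\,R)$, and $\underline{\mathsf{Gproj}}\,R$ the stable category of the Gorenstein projective objects of $\mathsf{mod}\,R$ (morphisms modulo those which factor through a projective), with its canonical functor $\iota_R\colon\underline{\mathsf{Gproj}}\,R\to\mathsf D_{\mathsf{sg}}(R)$, $X\mapsto X[0]$. A functor $s\colon\underline{\mathsf{Gproj}}\,R\to\underline{\mathsf{Gproj}}\,R'$ is said to be induced by a functor $S\colon\mathsf D_{\mathsf{sg}}(R)\to\mathsf D_{\mathsf{sg}}(R')$ if $\iota_{R'}s\simeq S\iota_R$. Then $\mathsf e$ and $\mathsf F$ preserve finitely generated modules; $\mathsf e$ induces a functor $\mathsf e\colon\mathsf D_{\mathsf{sg}}(\Lambda)\to\mathsf D_{\mathsf{sg}}(\Gamma)$, and the left derived functor of $\mathsf F$ restricts to $\mathsf D^{\mathsf b}(\mathsf{mod}\,\Gamma)$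 and induces a functor $\mathbb L_{\mathsf{sg}}\mathsf F\colon\mathsf D_{\mathsf{sg}}(\Gamma)\to\mathsf D_{\mathsf{sg}}(\Gamma)$. Suppose moreover that a functor $\underline{\mathsf e}\colon\underline{\mathsf{Gproj}}\,\Lambda\to\underline{\mathsf{Gproj}}\,\Gamma$ is induced by $\mathsf e\colon\mathsf D_{\mathsf{sg}}(\Lambda)\to\mathsf D_{\mathsf{sg}}(\Gamma)$. Then $\mathbb L_{\mathsf{sg}}\mathsf F$ induces a functor $\underline{\mathsf F}\colon\underline{\mathsf{Gproj}}\,\Gamma\to\underline{\mathsf{Gproj}}\,\Gamma$, and for every functor $\underline{\mathsf F}$ so induced the following are equivalent: 1. $\underline{\mathsf e}$ is an equivalence; 2. $\underline{\mathsf F}\simeq 0$. -/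

import Mathlib

open CategoryTheory CategoryTheory.Limits

universe w w₁ w₂ v v₁ v₂ u u₁ u₂

namespace CleftGP

noncomputable section

/-! ### Cleft extensions of abelian categories -/

/-- A cleft extension of an abelian category `B` by an abelian category `A`: functors
`i : B ⥤ A`, `e : A ⥤ B`, `l : B ⥤ A` with `e` faithful exact, `l` left adjoint to `e`,
and a natural isomorphism `e i ≅ 𝟭`.  As usual, functors are additive (for the left adjoint `l`
this is automatic). -/
structure CleftExtension (B : Type u₁) [Category.{v₁} B] [Abelian B]
    (A : Type u₂) [Category.{v₂} A] [Abelian A] where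
  i : B ⥤ A
  e : A ⥤ B
  l : B ⥤ A
  [i_additive : i.Additive]
  [e_additive : e.Additive]
  [e_faithful : e.Faithful]
  [e_preservesFiniteLimits : PreservesFiniteLimits e]
  [e_preservesFiniteColimits : PreservesFiniteColimits e]
  adj : l ⊣ e
  iso : i ⋙ e ≅ 𝟭 B

attribute [instance] CleftExtension.i_additive CleftExtension.e_additive
  CleftExtension.e_faithful CleftExtension.e_preservesFiniteLimits
  CleftExtension.e_preservesFiniteColimits

namespace CleftExtension

variable {B : Type u₁} [Category.{v₁} B] [Abelian B] {A : Type u₂} [Category.{v₂} A] [Abelian A]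
  (C : CleftExtension B A)

instance l_additive : C.l.Additive := C.adj.left_adjoint_additive

/-- The endofunctor `G` of `A`: the kernel of the counit `l e ⟶ 𝟭`. -/
def G : A ⥤ A where
  obj X := kernel (C.adj.counit.app X)
  map {X Y} f := kernel.map _ _ (C.l.map (C.e.map f)) f (C.adj.counit.naturality f).symm
  map_id X := by
    rw [← cancel_mono (kernel.ι _)]
    simp
  map_comp f g := by
    rw [← cancel_mono (kernel.ι _)]
    simp

/-- The inclusion `G ⟶ l e`. -/
def Gι : C.G ⟶ C.e ⋙ C.l where
  app X := kernel.ι (C.adj.counit.app X)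
  naturality _ _ _ := kernel.lift_ι _ _ _

instance (X : A) : Mono (C.Gι.app X) :=
  inferInstanceAs (Mono (kernel.ι (C.adj.counit.app X)))

instance : C.G.Additive where
  map_add {X Y f g} := by
    rw [← cancel_mono (C.Gι.app Y), Preadditive.add_comp]
    simp only [C.Gι.naturality, Functor.map_add, Preadditive.comp_add]

/-- The endofunctor `F = e G i` of `B`. -/
def F : B ⥤ B := C.i ⋙ C.G ⋙ C.e

instance : C.F.Additive := by
  unfold F
  infer_instance

end CleftExtension

/-! ### Perfect and nilpotent endofunctors -/

section Perfect

variable {B : Type u} [Category.{v} B]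

/-- The iterates `F ^ n` of an endofunctor. -/
def iter (F : B ⥤ B) : ℕ → (B ⥤ B)
  | 0 => 𝟭 B
  | n + 1 => iter F n ⋙ F

/-- An endofunctor is nilpotent if one of its iterates is zero. -/
def IsNilpotentFunctor (F : B ⥤ B) : Prop := ∃ n : ℕ, IsZero (iter F n)

variable [Abelian B]

instance iter_additive (F : B ⥤ B) [F.Additive] : ∀ n : ℕ, (iter F n).Additive
  | 0 => inferInstanceAs (𝟭 B).Additive
  | n + 1 =>
    have := iter_additive F n
    inferInstanceAs (iter F n ⋙ F).Additive

/-- A right exact endofunctor `F` is perfect if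
* `L_i F^j (F P) = 0` for all `i, j ≥ 1` and all projective `P`;
* there is `n` such that `L_p F^q = 0` for all `p, q ≥ 1` with `p + q ≥ n + 1`;
* `F P` has finite projective dimension for every projective `P`. -/
structure IsPerfect [EnoughProjectives B] (F : B ⥤ B) [F.Additive] : Prop where
  rightExact : PreservesFiniteColimits F
  condR : ∀ i j : ℕ, 1 ≤ i → 1 ≤ j → ∀ P : B, Projective P →
    IsZero (((iter F j).leftDerived i).obj (F.obj P))
  vanishing : ∃ n : ℕ, ∀ p q : ℕ, 1 ≤ p → 1 ≤ q → n + 1 ≤ p + q →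
    ∀ X : B, IsZero (((iter F q).leftDerived p).obj X)
  finiteProjDim : ∀ P : B, Projective P → ∃ d : ℕ, HasProjectiveDimensionLE (F.obj P) d

end Perfect

/-! ### Gorenstein projective objects and their stable category -/

section Gorenstein

variable (A : Type u) [Category.{v} A] [Abelian A]

/-- A totally acyclic complex of projectives: an acyclic complex `P` of projective objects such that
`Hom(P, Q)` is acyclic for every projective object `Q`. -/
structure IsTotallyAcyclic {A : Type u} [Category.{v} A] [Abelian A]
    (P : CochainComplex A ℤ) : Prop where
  projective : ∀ n : ℤ, Projective (P.X n)
  acyclic : P.Acyclic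
  coacyclic : ∀ Q : A, Projective Q → ∀ (n : ℤ) (f : P.X n ⟶ Q), P.d (n - 1) n ≫ f = 0 →
    ∃ g : P.X (n + 1) ⟶ Q, P.d n (n + 1) ≫ g = f

/-- `X` is Gorenstein projective if it is `Im (P⁻¹ ⟶ P⁰)` for a totally acyclic complex `P`
of projectives. -/
def isGorensteinProjective : ObjectProperty A := fun X =>
  ∃ P : CochainComplex A ℤ, IsTotallyAcyclic P ∧ Nonempty (X ≅ image (P.d (-1) 0))

/-- The full subcategory of Gorenstein projective objects. -/
abbrev GProj := (isGorensteinProjective A).FullSubcategory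

/-- Two parallel morphisms are identified in the stable category when their difference factors
through a projective object. -/
def stableRel : HomRel (GProj A) := fun X Y f g =>
  ∃ (P : A) (_ : Projective P) (a : X.obj ⟶ P) (b : P ⟶ Y.obj), f.hom - g.hom = a ≫ b

/-- The stable category of Gorenstein projective objects. -/
abbrev StableGProj := CategoryTheory.Quotient (stableRel A)

end Gorenstein

/-! ### The singularity category -/

section Singularity

variable (A : Type u) [Category.{v} A] [Abelian A] [HasDerivedCategory.{w} A]

/-- The objects of `K^b(Proj A)` inside the bounded derived category: those isomorphic to a bounded
complex of projective objects. -/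
def perfectComplexes : ObjectProperty (DerivedCategory.Bounded A) := fun X =>
  ∃ (K : CochainComplex A ℤ) (a b : ℤ), K.IsStrictlyGE a ∧ K.IsStrictlyLE b ∧
    (∀ n : ℤ, Projective (K.X n)) ∧ Nonempty (DerivedCategory.Q.obj K ≅ X.obj)

/-- The singularity category, i.e. the Verdier quotient `D^b(A) / K^b(Proj A)`: the localization of
`D^b(A)` at the morphisms whose cone lies in `K^b(Proj A)`. -/
abbrev SingularityCategory := (perfectComplexes A).trW.Localization

/-- The quotient functor `D^b(A) ⥤ D_sg(A)`. -/
abbrev Qsg : DerivedCategory.Bounded A ⥤ SingularityCategory A := (perfectComplexes A).trW.Q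

/-- The functor `A ⥤ D^b(A)`, `X ↦ X[0]`. -/
def single : A ⥤ DerivedCategory.Bounded A :=
  (DerivedCategory.TStructure.t (C := A)).bounded.lift (DerivedCategory.singleFunctor A 0)
    (fun _ => ⟨⟨0, inferInstance⟩, ⟨0, inferInstance⟩⟩)

variable {A} in
lemma perfectComplexes_of_iso_shift {Z : DerivedCategory.Bounded A} {P : A} (hP : Projective P)
    (e : Nonempty (Z.obj ≅ ((DerivedCategory.singleFunctor A 0).obj P)⟦(1 : ℤ)⟧)) :
    perfectComplexes A Z := by
  obtain ⟨e⟩ := e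
  let K := (CochainComplex.singleFunctor A (-1)).obj P
  have hK (n : ℤ) (hn : n ≠ -1) : IsZero (K.X n) :=
    HomologicalComplex.isZero_single_obj_X (ComplexShape.up ℤ) (-1) P n hn
  refine ⟨K, -1, -1, ?_, ?_, fun n => ?_, ⟨?_⟩⟩
  · rw [CochainComplex.isStrictlyGE_iff]
    exact fun i hi => hK i (by lia)
  · rw [CochainComplex.isStrictlyLE_iff]
    exact fun i hi => hK i (by lia)
  · by_cases hn : n = -1
    · subst hn
      exact Projective.of_iso
        (HomologicalComplex.singleObjXSelf (ComplexShape.up ℤ) (-1) P).symm hP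
    · exact (hK n hn).projective
  · exact (((DerivedCategory.singleFunctors A).shiftIso 1 (-1) 0 (by lia)).app P ≪≫
      (DerivedCategory.singleFunctorIsoCompQ A (-1)).app P).symm ≪≫ e.symm

variable {A} in
lemma isIso_Qsg_map_fst (X P : A) (hP : Projective P) :
    IsIso ((Qsg A).map ((single A).map (biprod.fst : X ⊞ P ⟶ X))) := by
  apply Localization.inverts (Qsg A) (perfectComplexes A).trW
  obtain ⟨Z, g, h, hT⟩ :=
    Pretriangulated.distinguished_cocone_triangle ((single A).map (biprod.fst : X ⊞ P ⟶ X))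
  refine ⟨Z, g, h, hT, perfectComplexes_of_iso_shift hP ?_⟩
  let S : ShortComplex A :=
    ShortComplex.mk (biprod.inr : P ⟶ X ⊞ P) (biprod.fst : X ⊞ P ⟶ X) (by simp)
  have hS : S.ShortExact :=
    ShortComplex.Splitting.shortExact
      { r := biprod.snd
        s := biprod.inl
        f_r := by simp [S]
        s_g := by simp [S]
        id := by simp [S, add_comm] }
  have h₁ := DerivedCategory.Bounded.ι.map_distinguished _ hT
  have h₂ := Pretriangulated.rot_of_distTriang _ hS.singleTriangle_distinguished
  obtain ⟨e, -, -⟩ := Pretriangulated.exists_iso_of_arrow_iso _ _ h₁ h₂ (Iso.refl _)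
  exact ⟨Pretriangulated.Triangle.π₃.mapIso e⟩

variable {A} in
lemma Qsg_map_eq_of_sub_factors {X Y P : A} (hP : Projective P) (f g : X ⟶ Y)
    (a : X ⟶ P) (b : P ⟶ Y) (h : f - g = a ≫ b) :
    (Qsg A).map ((single A).map f) = (Qsg A).map ((single A).map g) := by
  have := isIso_Qsg_map_fst X P hP
  let T : A ⥤ SingularityCategory A := single A ⋙ Qsg A
  have hT : IsIso (T.map (biprod.fst : X ⊞ P ⟶ X)) := this
  have h₁ : T.map (biprod.lift (𝟙 X) a) = T.map (biprod.inl : X ⟶ X ⊞ P) := by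
    rw [← cancel_mono (T.map (biprod.fst : X ⊞ P ⟶ X)), ← T.map_comp, ← T.map_comp]
    simp
  have hf : f = biprod.lift (𝟙 X) a ≫ biprod.desc g b := by
    rw [biprod.lift_desc, ← h]
    simp
  have hg : g = biprod.inl ≫ biprod.desc g b := by simp
  change T.map f = T.map g
  calc T.map f = T.map (biprod.lift (𝟙 X) a) ≫ T.map (biprod.desc g b) := by
        rw [← T.map_comp, ← hf]
    _ = T.map g := by rw [h₁, ← T.map_comp, ← hg]

/-- The canonical functor from the stable category of Gorenstein projective objects to the
singularity category, `X ↦ X[0]`. -/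
def stableToSg : StableGProj A ⥤ SingularityCategory A :=
  CategoryTheory.Quotient.lift (stableRel A)
    ((isGorensteinProjective A).ι ⋙ single A ⋙ Qsg A)
    (fun _ _ f g ⟨_, hP, a, b, h⟩ => Qsg_map_eq_of_sub_factors hP f.hom g.hom a b h)

end Singularity

/-! ### Functors induced on singularity categories and on stable categories -/

section Induced

variable {A : Type u₁} [Category.{v₁} A] [Abelian A] [HasDerivedCategory.{w₁} A]
  {B : Type u₂} [Category.{v₂} B] [Abelian B] [HasDerivedCategory.{w₂} B]

/-- The functor `D^b(A) ⥤ D^b(B)` given by applying an exact functor `T : A ⥤ B` degreewise. -/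
def exactMapDb (T : A ⥤ B) [T.Additive] [PreservesFiniteLimits T] [PreservesFiniteColimits T] :
    DerivedCategory.Bounded A ⥤ DerivedCategory.Bounded B :=
  (DerivedCategory.TStructure.t (C := B)).bounded.lift
    (DerivedCategory.Bounded.ι ⋙ T.mapDerivedCategory) (by
      rintro ⟨X, ⟨a, ha⟩, ⟨b, hb⟩⟩
      obtain ⟨K, hK, ⟨e⟩⟩ := DerivedCategory.exists_iso_Q_obj_of_isGE X a (hX := ha)
      obtain ⟨L, hL, ⟨f⟩⟩ := DerivedCategory.exists_iso_Q_obj_of_isLE X b (hX := hb)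
      refine ⟨⟨a, ⟨_, T.mapDerivedCategory.mapIso e ≪≫ T.mapDerivedCategoryFactors.app K,
        inferInstance⟩⟩, ⟨b, ⟨_, T.mapDerivedCategory.mapIso f ≪≫
          T.mapDerivedCategoryFactors.app L, inferInstance⟩⟩⟩)

/-- `S : D_sg(A) ⥤ D_sg(B)` is the functor induced by the exact functor `T : A ⥤ B`, i.e. by
`T : D^b(A) ⥤ D^b(B)`. (By the universal property of the quotient functor `D^b(A) ⥤ D_sg(A)`, this
determines `S` up to isomorphism.) -/
def IsSgInduced (T : A ⥤ B) [T.Additive] [PreservesFiniteLimits T] [PreservesFiniteColimits T]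
    (S : SingularityCategory A ⥤ SingularityCategory B) : Prop :=
  Nonempty (Qsg A ⋙ S ≅ exactMapDb T ⋙ Qsg B)

variable (A) in
/-- The objects of `K^{-,b}(Proj A)`: bounded above complexes of projective objects with bounded
cohomology, in the homotopy category of complexes. -/
def projMinusBounded : ObjectProperty (HomotopyCategory A (ComplexShape.up ℤ)) := fun K =>
  (∀ n : ℤ, Projective (K.as.X n)) ∧ (∃ b : ℤ, CochainComplex.IsStrictlyLE K.as b) ∧
    ∃ a : ℤ, CochainComplex.IsGE K.as a

variable (A) in
/-- The canonical functor `K^{-,b}(Proj A) ⥤ D^b(A)`. -/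
def projToDb : (projMinusBounded A).FullSubcategory ⥤ DerivedCategory.Bounded A :=
  (DerivedCategory.TStructure.t (C := A)).bounded.lift
    ((projMinusBounded A).ι ⋙ DerivedCategory.Qh) (by
      rintro ⟨⟨K⟩, -, ⟨b, hb⟩, ⟨a, ha⟩⟩
      have : CochainComplex.IsStrictlyLE K b := hb
      have : CochainComplex.IsGE K a := ha
      have e := (DerivedCategory.quotientCompQhIso A).app K
      exact ⟨⟨a, DerivedCategory.TStructure.t.isGE_of_iso e.symm a⟩,
        ⟨b, DerivedCategory.TStructure.t.isLE_of_iso e.symm b⟩⟩)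

/-- `LT : D^b(A) ⥤ D^b(B)` is the left derived functor of the additive functor `T : A ⥤ B`: it is
computed by applying `T` degreewise to bounded above complexes of projective objects. (When `A` has
enough projectives the functor `K^{-,b}(Proj A) ⥤ D^b(A)` is an equivalence, so this
determines `LT` up to isomorphism.) -/
def IsLeftDerivedDb (T : A ⥤ B) [T.Additive]
    (LT : DerivedCategory.Bounded A ⥤ DerivedCategory.Bounded B) : Prop :=
  Nonempty (projToDb A ⋙ LT ⋙ DerivedCategory.Bounded.ι ≅
    (projMinusBounded A).ι ⋙ T.mapHomotopyCategory (ComplexShape.up ℤ) ⋙ DerivedCategory.Qh)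

/-- `S : D_sg(A) ⥤ D_sg(B)` is the functor `L_sg T` induced by the left derived functor
`D^b(A) ⥤ D^b(B)` of `T : A ⥤ B`. -/
def IsSgLeftDerived (T : A ⥤ B) [T.Additive]
    (S : SingularityCategory A ⥤ SingularityCategory B) : Prop :=
  ∃ LT : DerivedCategory.Bounded A ⥤ DerivedCategory.Bounded B,
    IsLeftDerivedDb T LT ∧ Nonempty (Qsg A ⋙ S ≅ LT ⋙ Qsg B)

/-- `s` is the restriction, up to isomorphism in `D_sg(B)`, of the functor `S : D_sg(A) ⥤ D_sg(B)`
to the stable categories of Gorenstein projective objects. -/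
def IsStableRestriction (S : SingularityCategory A ⥤ SingularityCategory B)
    (s : StableGProj A ⥤ StableGProj B) : Prop :=
  Nonempty (s ⋙ stableToSg B ≅ stableToSg A ⋙ S)

end Induced

/-! ### Finitely generated right modules -/

section Modules

variable {R : Type u₁} [Ring R] {S : Type u₂} [Ring S]

/-- A functor between categories of modules preserves finitely generated modules. -/
def PreservesFG (T : ModuleCat.{v₁} R ⥤ ModuleCat.{v₂} S) : Prop :=
  ∀ X : ModuleCat.{v₁} R, ModuleCat.isFG R X → ModuleCat.isFG S (T.obj X)

/-- The restriction to finitely generated modules of a functor which preserves them. -/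
def restrictFG (T : ModuleCat.{v₁} R ⥤ ModuleCat.{v₂} S) (h : PreservesFG T) :
    FGModuleCat.{v₁} R ⥤ FGModuleCat.{v₂} S :=
  (ModuleCat.isFG S).lift ((ModuleCat.isFG R).ι ⋙ T) (fun X => h X.obj X.property)

variable (T : ModuleCat.{v₁} R ⥤ ModuleCat.{v₂} S) (h : PreservesFG T)

instance [T.Additive] : (restrictFG T h).Additive where
  map_add {X Y f g} := by
    apply ObjectProperty.hom_ext
    exact T.map_add

instance [IsNoetherianRing R] [IsNoetherianRing S] [PreservesFiniteLimits T] :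
    PreservesFiniteLimits (restrictFG T h) := by
  have : PreservesFiniteLimits (restrictFG T h ⋙ (ModuleCat.isFG.{v₂} S).ι) :=
    inferInstanceAs
      (PreservesFiniteLimits (forget₂ (FGModuleCat.{v₁} R) (ModuleCat.{v₁} R) ⋙ T))
  exact preservesFiniteLimits_of_reflects_of_preserves _ (ModuleCat.isFG.{v₂} S).ι

instance [IsNoetherianRing R] [IsNoetherianRing S] [PreservesFiniteColimits T] :
    PreservesFiniteColimits (restrictFG T h) := by
  have : PreservesFiniteColimits (restrictFG T h ⋙ (ModuleCat.isFG.{v₂} S).ι) :=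
    inferInstanceAs
      (PreservesFiniteColimits (forget₂ (FGModuleCat.{v₁} R) (ModuleCat.{v₁} R) ⋙ T))
  exact preservesFiniteColimits_of_reflects_of_preserves _ (ModuleCat.isFG.{v₂} S).ι

end Modules

end

end CleftGP

open CleftGP

/-! Nilpotency of `F` gives a form of Nakayama's lemma (`isZero_of_epi_rad`), from which `l`, `e`
and `F` preserve finitely generated modules. On these categories the argument uses only a
`CleftSplitting`: an adjunction `l ⊣ e` with `e` faithful exact, and natural exact sequences `0 ⟶ F
X ⟶ e l X ⟶ X ⟶ 0` split by the unit. The functor `i` is no longer needed.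

The stable category embeds fully faithfully in the singularity category. Indeed, if `Ext^i(X, Q) =
0` for `i ≥ 1` and `Q` projective, then a morphism from `X` to a bounded complex of projectives
lifts to its part in degrees `≥ 0` (`exists_lift_truncation`). So morphisms out of Gorenstein
projectives in `D_sg` are represented by morphisms of modules, uniquely up to maps through
projectives. Since `F` is perfect, Gorenstein projectives are acyclic for all powers of `F`, hence
`L_sg F` is computed on them by `F`. Moreover `l` preserves Gorenstein projectives, and `Hom(l X, Y)
≃ Hom(X, e Y)` persists in `D_sg` for `X` Gorenstein projective (`bijective_unit_comp`). The object
`F X` is a complement of `X` in `e l X`. Thus the functor induced by `F` is zero if and only if the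
unit `X ⟶ e l X` is invertible in `D_sg` for all Gorenstein projective `X`.

Suppose that `e` induces an equivalence. Choose `Y` with `e Y ≅ X` in `D_sg`. Full faithfulness and
the adjunction show that the transpose `φ : l X ⟶ Y` induces bijections on morphisms to Gorenstein
projectives. By Yoneda `φ` is invertible, then so is `e φ`, and then so is the unit. Conversely,
suppose that the units are invertible. Essential surjectivity is immediate. For `Y` Gorenstein
projective, let `X` represent `e Y`; the transpose `φ : l X ⟶ Y` becomes invertible under `e`. After
adding a projective, `φ` is onto with a kernel `K` such that `e K` has finite projective dimension
and is acyclic for the powers of `F`. Nilpotency then bounds the projective dimension of `K` itself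
(`finProjDim_of_finProjDim_map`), so `φ` is invertible. This reduces full faithfulness to sources `l
X`, where it is the adjunction.

The functor induced by `F` exists because `e l X` is isomorphic in `D_sg` to a Gorenstein projective
`Y`: the splitting of `X` off `e l X` lifts to a splitting of `X` off some `Y ⊞ P`, whose complement
is Gorenstein projective and represents `F X` (`exists_toSg_iso`). -/

namespace CleftGP

/-! ### Brutal truncation and dévissage of bounded complexes -/

section Derived

variable {A : Type u} [Category.{v} A] [Abelian A]

/-- A cochain complex which is zero in degrees `> b` has a quotient obtained by killing its
component in degree `b`. -/
lemma exists_quotient_of_isStrictlyLE (K : CochainComplex A ℤ) (b : ℤ) [K.IsStrictlyLE b] :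
    ∃ (L : CochainComplex A ℤ) (p : K ⟶ L) (i : (CochainComplex.singleFunctor A b).obj (K.X b) ⟶ K)
      (w : i ≫ p = 0),
      L.IsStrictlyLE (b - 1) ∧ (∀ n, n < b → IsIso (p.f n)) ∧ (ShortComplex.mk i p w).ShortExact := by
  -- The top component is a subcomplex because the differential leaving it is zero.
  let i : (CochainComplex.singleFunctor A b).obj (K.X b) ⟶ K :=
    HomologicalComplex.mkHomFromSingle (𝟙 _)
      (fun k hk => (K.isZero_of_isStrictlyLE b k (by simp at hk; lia)).eq_of_tgt _ _)
  have hz (n : ℤ) (hn : n ≠ b) :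
      IsZero (((CochainComplex.singleFunctor A b).obj (K.X b)).X n) :=
    HomologicalComplex.isZero_single_obj_X _ _ _ _ hn
  have hi : i.f b = (HomologicalComplex.singleObjXSelf (ComplexShape.up ℤ) b (K.X b)).hom ≫ 𝟙 _ :=
    HomologicalComplex.mkHomFromSingle_f _ _
  have hb : IsIso (i.f b) := by
    rw [hi]
    exact IsIso.comp_isIso' (Iso.isIso_hom _) inferInstance
  have : Mono i := HomologicalComplex.mono_of_mono_f _ (fun n => by
    by_cases hn : n = b
    · subst hn; infer_instance
    · exact ⟨fun _ _ _ => (hz n hn).eq_of_tgt _ _⟩)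
  have hS : (ShortComplex.mk i (cokernel.π i) (cokernel.condition i)).ShortExact :=
    { exact := ShortComplex.exact_cokernel i }
  have hS' (n : ℤ) := hS.map_of_exact (HomologicalComplex.eval A _ n)
  refine ⟨cokernel i, cokernel.π i, i, cokernel.condition i, ?_, ?_, hS⟩
  · rw [CochainComplex.isStrictlyLE_iff]
    intro n hn
    have he : Epi ((cokernel.π i).f n) := (hS' n).epi_g
    by_cases hn' : n = b
    · subst hn'
      have hze : (cokernel.π i).f n = 0 := by
        rw [← cancel_epi (i.f n), comp_zero]
        exact ((ShortComplex.mk i (cokernel.π i) (cokernel.condition i)).map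
          (HomologicalComplex.eval A _ n)).zero
      exact IsZero.of_epi_eq_zero _ hze
    · exact IsZero.of_epi ((cokernel.π i).f n) (K.isZero_of_isStrictlyLE b n (by lia))
  · intro n hn
    exact (hS' n).isIso_g_iff.2 (hz n (by lia))

/-- The `m` degrees from `c` upwards are killed one at a time, starting from the top. -/
lemma exists_brutal_truncation (K : CochainComplex A ℤ) (c : ℤ) (m : ℕ)
    (hK : K.IsStrictlyLE (c - 1 + m)) :
    ∃ (L : CochainComplex A ℤ) (p : K ⟶ L), L.IsStrictlyLE (c - 1) ∧
      ∀ n, n < c → IsIso (p.f n) := by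
  induction m generalizing K with
  | zero => exact ⟨K, 𝟙 K, by simpa using hK, fun n _ => by
      rw [HomologicalComplex.id_f]; infer_instance⟩
  | succ m ih =>
    obtain ⟨L, p, -, -, hL, hp, -⟩ := exists_quotient_of_isStrictlyLE K (c - 1 + (m + 1 : ℕ))
    obtain ⟨M, q, hM, hq⟩ := ih L (by convert hL using 1; push_cast; ring)
    refine ⟨M, p ≫ q, hM, fun n hn => ?_⟩
    have := hp n (by lia)
    have := hq n hn
    rw [HomologicalComplex.comp_f]
    infer_instance

/-- The brutal truncation of a bounded above complex. -/
lemma exists_brutal_truncation_shortExact (K : CochainComplex A ℤ) (b c : ℤ)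
    [K.IsStrictlyLE b] :
    ∃ S : ShortComplex (CochainComplex A ℤ), S.ShortExact ∧ S.X₂ = K ∧
      S.X₁.IsStrictlyGE c ∧ S.X₃.IsStrictlyLE (c - 1) ∧
      (∀ n, c ≤ n → Nonempty (S.X₁.X n ≅ K.X n)) ∧
      (∀ n, n < c → Nonempty (S.X₃.X n ≅ K.X n)) := by
  -- There are `b + 1 - c` degrees from `c` to `b`; `toNat` covers the case `b < c`, where nothing
  -- is killed.
  obtain ⟨L, p, hL, hp⟩ := exists_brutal_truncation K c (b + 1 - c).toNat (by
    rw [CochainComplex.isStrictlyLE_iff]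
    exact fun n hn => K.isZero_of_isStrictlyLE b n (by lia))
  have : Epi p := HomologicalComplex.epi_of_epi_f _ (fun n => by
    by_cases hn : n < c
    · have := hp n hn; infer_instance
    · exact ⟨fun _ _ _ => (L.isZero_of_isStrictlyLE (c - 1) n (by lia)).eq_of_src _ _⟩)
  have hS : (ShortComplex.mk (kernel.ι p) p (kernel.condition p)).ShortExact :=
    { exact := ShortComplex.exact_kernel p }
  have hS' (n : ℤ) := hS.map_of_exact (HomologicalComplex.eval A _ n)
  refine ⟨_, hS, rfl, ?_, hL, fun n hn => ?_, fun n hn => ?_⟩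
  · rw [CochainComplex.isStrictlyGE_iff]
    intro n hn
    exact (hS' n).isIso_g_iff.1 (hp n hn)
  · have : IsIso ((kernel.ι p).f n) := (hS' n).isIso_f_iff.2
      (L.isZero_of_isStrictlyLE (c - 1) n (by lia))
    exact ⟨asIso ((kernel.ι p).f n)⟩
  · have := hp n hn
    exact ⟨(asIso (p.f n)).symm⟩

variable [HasDerivedCategory.{w} A]

/-- A class of objects of the derived category which is closed under extensions contains a bounded
complex as soon as it contains its components. -/
lemma prop_Q_obj_of_bounded (P : ObjectProperty (DerivedCategory A)) [P.IsClosedUnderIsomorphisms]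
    [P.ContainsZero] [P.IsTriangulatedClosed₂] (a b : ℤ) (K : CochainComplex A ℤ)
    [K.IsStrictlyGE a] [hK : K.IsStrictlyLE b]
    (h : ∀ n, a ≤ n → n ≤ b → P ((DerivedCategory.singleFunctor A n).obj (K.X n))) :
    P (DerivedCategory.Q.obj K) := by
  obtain ⟨m, hm⟩ : ∃ m : ℕ, b ≤ a - 1 + m := ⟨(b - (a - 1)).toNat, by lia⟩
  induction m generalizing K b with
  | zero =>
    have hz : IsZero K := by
      rw [IsZero.iff_id_eq_zero]
      ext n
      by_cases hn : n < a
      · exact (K.isZero_of_isStrictlyGE a n hn).eq_of_src _ _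
      · exact (K.isZero_of_isStrictlyLE b n (by simp at hm; lia)).eq_of_src _ _
    exact P.prop_of_isZero (DerivedCategory.Q.map_isZero hz)
  | succ m ih =>
    by_cases hab : b < a
    · exact ih b K h (by lia)
    obtain ⟨L, p, i, w, hL, hp, hS⟩ := exists_quotient_of_isStrictlyLE K b
    have hLGE : L.IsStrictlyGE a := by
      rw [CochainComplex.isStrictlyGE_iff]
      intro n hn
      have := hp n (by lia)
      exact (K.isZero_of_isStrictlyGE a n hn).of_iso (asIso (p.f n)).symm
    have h₃ : P (DerivedCategory.Q.obj L) := ih (b - 1) L (fun n h₁ h₂ => by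
      have := hp n (by lia)
      exact P.prop_of_iso ((DerivedCategory.singleFunctor A n).mapIso (asIso (p.f n)))
        (h n h₁ (by lia))) (by lia)
    have h₁ : P (DerivedCategory.Q.obj ((CochainComplex.singleFunctor A b).obj (K.X b))) :=
      P.prop_of_iso ((DerivedCategory.singleFunctorIsoCompQ A b).app _) (h b (by lia) le_rfl)
    exact P.ext_of_isTriangulatedClosed₂ _ (DerivedCategory.triangleOfSES_distinguished hS) h₁ h₃

end Derived
end CleftGP

/-! ### Perfect complexes and finite projective dimension -/

namespace CleftGP
open Pretriangulated ZeroObject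

section Derived

variable {A : Type u} [Category.{v} A] [Abelian A]

lemma isZero_mappingCone_X {K L : CochainComplex A ℤ} (φ : K ⟶ L) (n : ℤ)
    (h₁ : IsZero (K.X (n + 1))) (h₂ : IsZero (L.X n)) :
    IsZero ((CochainComplex.mappingCone φ).X n) := by
  refine IsZero.of_iso ?_ (HomologicalComplex.homotopyCofiber.XIsoBiprod φ n (n + 1) rfl)
  rw [IsZero.iff_id_eq_zero]
  apply biprod.hom_ext
  · exact h₁.eq_of_tgt _ _
  · exact h₂.eq_of_tgt _ _

lemma projective_mappingCone_X {K L : CochainComplex A ℤ} (φ : K ⟶ L) (n : ℤ)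
    (h₁ : Projective (K.X (n + 1))) (h₂ : Projective (L.X n)) :
    Projective ((CochainComplex.mappingCone φ).X n) :=
  Projective.of_iso (HomologicalComplex.homotopyCofiber.XIsoBiprod φ n (n + 1) rfl).symm
    inferInstance

lemma isStrictlyLE_mappingCone {K L : CochainComplex A ℤ} (φ : K ⟶ L) (b : ℤ)
    (hK : K.IsStrictlyLE (b + 1)) (hL : L.IsStrictlyLE b) :
    (CochainComplex.mappingCone φ).IsStrictlyLE b := by
  rw [CochainComplex.isStrictlyLE_iff]
  exact fun n hn => isZero_mappingCone_X φ n (K.isZero_of_isStrictlyLE (b + 1) _ (by lia))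
    (L.isZero_of_isStrictlyLE b _ hn)

lemma isStrictlyGE_mappingCone {K L : CochainComplex A ℤ} (φ : K ⟶ L) (a : ℤ)
    (hK : K.IsStrictlyGE (a + 1)) (hL : L.IsStrictlyGE a) :
    (CochainComplex.mappingCone φ).IsStrictlyGE a := by
  rw [CochainComplex.isStrictlyGE_iff]
  exact fun n hn => isZero_mappingCone_X φ n (K.isZero_of_isStrictlyGE (a + 1) _ (by lia))
    (L.isZero_of_isStrictlyGE a _ hn)

lemma isStrictlyLE_mono (K : CochainComplex A ℤ) {b b' : ℤ} (hb : b ≤ b') (hK : K.IsStrictlyLE b) :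
    K.IsStrictlyLE b' := by
  rw [CochainComplex.isStrictlyLE_iff]
  exact fun i hi => K.isZero_of_isStrictlyLE b i (by lia)

lemma isStrictlyGE_anti (K : CochainComplex A ℤ) {a a' : ℤ} (ha : a' ≤ a) (hK : K.IsStrictlyGE a) :
    K.IsStrictlyGE a' := by
  rw [CochainComplex.isStrictlyGE_iff]
  exact fun i hi => K.isZero_of_isStrictlyGE a i (by lia)

variable [HasDerivedCategory.{w} A]

/-- Morphisms out of a K-projective complex in the derived category are homotopy classes of chain
maps. -/
lemma exists_Q_map_eq {K L : CochainComplex A ℤ} [K.IsKProjective]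
    (f : DerivedCategory.Q.obj K ⟶ DerivedCategory.Q.obj L) :
    ∃ φ : K ⟶ L, DerivedCategory.Q.map φ = f := by
  obtain ⟨g, hg⟩ := (CochainComplex.IsKProjective.Qh_map_bijective K
    ((HomotopyCategory.quotient _ _).obj L)).2 ((DerivedCategory.quotientCompQhIso A).hom.app K ≫ f ≫
      (DerivedCategory.quotientCompQhIso A).inv.app L)
  obtain ⟨φ, rfl⟩ := (HomotopyCategory.quotient _ _).map_surjective g
  refine ⟨φ, ?_⟩
  rw [← cancel_epi ((DerivedCategory.quotientCompQhIso A).hom.app K),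
    ← DerivedCategory.quotientCompQhIso_hom_naturality, hg]
  simp

lemma Q_hom_eq_zero {K L : CochainComplex A ℤ} [K.IsKProjective]
    (h : ∀ n, IsZero (K.X n) ∨ IsZero (L.X n))
    (f : DerivedCategory.Q.obj K ⟶ DerivedCategory.Q.obj L) : f = 0 := by
  obtain ⟨φ, rfl⟩ := exists_Q_map_eq f
  have : φ = 0 := by
    ext n
    rcases h n with h | h
    · exact h.eq_of_src _ _
    · exact h.eq_of_tgt _ _
  rw [this, Functor.map_zero]

instance isKProjective_singleFunctor (P : A) [Projective P] (n : ℤ) :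
    ((CochainComplex.singleFunctor A n).obj P).IsKProjective := by
  have (i : ℤ) : Projective (((CochainComplex.singleFunctor A n).obj P).X i) :=
    inferInstanceAs (Projective (((HomologicalComplex.single A _ n).obj P).X i))
  have : ((CochainComplex.singleFunctor A n).obj P).IsStrictlyLE n := by
    rw [CochainComplex.isStrictlyLE_iff]
    exact fun i hi => HomologicalComplex.isZero_single_obj_X _ _ _ _ (by lia)
  exact CochainComplex.isKProjective_of_projective _ n

lemma hom_singleFunctor_eq_zero_of_projective {P : A} [Projective P] {Y : A} {m n : ℤ} (h : m ≠ n)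
    (f : (DerivedCategory.singleFunctor A m).obj P ⟶ (DerivedCategory.singleFunctor A n).obj Y) :
    f = 0 :=
  Q_hom_eq_zero (K := (CochainComplex.singleFunctor A m).obj P)
    (L := (CochainComplex.singleFunctor A n).obj Y) (fun i => by
      by_cases hi : i = m
      · exact .inr (HomologicalComplex.isZero_single_obj_X _ _ _ _ (by lia))
      · exact .inl (HomologicalComplex.isZero_single_obj_X _ _ _ _ hi)) f

variable (A) in
/-- The objects of the derived category isomorphic to a bounded complex of projective objects. -/
def perfectObjects : ObjectProperty (DerivedCategory A) := fun X =>
  ∃ (K : CochainComplex A ℤ) (a b : ℤ), K.IsStrictlyGE a ∧ K.IsStrictlyLE b ∧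
    (∀ n : ℤ, Projective (K.X n)) ∧ Nonempty (DerivedCategory.Q.obj K ≅ X)

instance : (perfectObjects A).IsClosedUnderIsomorphisms where
  of_iso := by
    rintro X Y e ⟨K, a, b, h₁, h₂, h₃, ⟨f⟩⟩
    exact ⟨K, a, b, h₁, h₂, h₃, ⟨f ≪≫ e⟩⟩

lemma perfectObjects_singleFunctor (P : A) [Projective P] (n : ℤ) :
    perfectObjects A ((DerivedCategory.singleFunctor A n).obj P) := by
  refine ⟨(CochainComplex.singleFunctor A n).obj P, n, n, ?_, ?_, fun i =>
    inferInstanceAs (Projective (((HomologicalComplex.single A _ n).obj P).X i)),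
    ⟨(DerivedCategory.singleFunctorIsoCompQ A n).symm.app P⟩⟩
  · rw [CochainComplex.isStrictlyGE_iff]
    exact fun i hi => HomologicalComplex.isZero_single_obj_X _ _ _ _ (by lia)
  · rw [CochainComplex.isStrictlyLE_iff]
    exact fun i hi => HomologicalComplex.isZero_single_obj_X _ _ _ _ (by lia)

lemma perfectObjects_of_isZero {X : DerivedCategory A} (hX : IsZero X) : perfectObjects A X := by
  have : Projective (0 : A) := (isZero_zero A).projective
  exact (perfectObjects A).prop_of_iso
    (((DerivedCategory.singleFunctor A 0).map_isZero (isZero_zero A)).iso hX)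
    (perfectObjects_singleFunctor (0 : A) 0)

instance : (perfectObjects A).ContainsZero where
  exists_zero := ⟨0, isZero_zero _, perfectObjects_of_isZero (isZero_zero _)⟩

instance : (perfectObjects A).IsStableUnderShift ℤ where
  isStableUnderShiftBy n := ⟨by
    rintro X ⟨K, a, b, h₁, h₂, h₃, ⟨f⟩⟩
    refine ⟨K⟦n⟧, a - n, b - n, K.isStrictlyGE_shift a n _ (by lia), K.isStrictlyLE_shift b n _ (by lia),
      fun i => h₃ (i + n), ⟨(DerivedCategory.Q.commShiftIso n).app K ≪≫
        (shiftFunctor _ n).mapIso f⟩⟩⟩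

/-- The source is K-projective, so the morphism is given by a chain map, whose mapping cone is again
a bounded complex of projectives. The cone moves the source down by one degree, whence the bound `a
- 1`. -/
instance : (perfectObjects A).IsTriangulatedClosed₃ := .mk' (by
  rintro T hT ⟨K, a, b, h₁, h₂, h₃, ⟨e⟩⟩ ⟨K', a', b', h₁', h₂', h₃', ⟨e'⟩⟩
  have := CochainComplex.isKProjective_of_projective K b
  obtain ⟨φ, hφ⟩ := exists_Q_map_eq (e.hom ≫ T.mor₁ ≫ e'.inv)
  obtain ⟨f, -, -⟩ := exists_iso_of_arrow_iso _ _
    (DerivedCategory.mappingCone_triangle_distinguished φ) hT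
    (Arrow.isoMk e e' (by
      change e.hom ≫ T.mor₁ = DerivedCategory.Q.map φ ≫ e'.hom
      simp [hφ]))
  exact ⟨CochainComplex.mappingCone φ, min (a - 1) a', max b b',
    isStrictlyGE_mappingCone φ _ (isStrictlyGE_anti K (by lia) h₁) (isStrictlyGE_anti K' (by lia) h₁'),
    isStrictlyLE_mappingCone φ _ (isStrictlyLE_mono K (by lia) h₂) (isStrictlyLE_mono K' (by lia) h₂'),
    fun n => projective_mappingCone_X φ n (h₃ _) (h₃' _), ⟨Triangle.π₃.mapIso f⟩⟩)

instance : (perfectObjects A).IsTriangulated where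
  toIsTriangulatedClosed₂ := .of_isTriangulatedClosed₃

instance : (perfectComplexes A).IsTriangulated :=
  inferInstanceAs ((perfectObjects A).inverseImage DerivedCategory.Bounded.ι).IsTriangulated

lemma perfectObjects_of_shortExact {S : ShortComplex A} (hS : S.ShortExact) (n : ℤ)
    (h₁ : perfectObjects A ((DerivedCategory.singleFunctor A n).obj S.X₁))
    (h₂ : perfectObjects A ((DerivedCategory.singleFunctor A n).obj S.X₂)) :
    perfectObjects A ((DerivedCategory.singleFunctor A n).obj S.X₃) :=
  (perfectObjects A).ext_of_isTriangulatedClosed₃ _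
    (DerivedCategory.triangleOfSES_distinguished
      (hS.map_of_exact (HomologicalComplex.single A (ComplexShape.up ℤ) n))) h₁ h₂

/-- An object of finite projective dimension is perfect. -/
lemma perfectObjects_of_hasProjectiveDimensionLE [EnoughProjectives A] (d : ℕ) (X : A)
    (hX : HasProjectiveDimensionLE X d) (n : ℤ) :
    perfectObjects A ((DerivedCategory.singleFunctor A n).obj X) := by
  induction d generalizing X with
  | zero =>
    have : Projective X := (projective_iff_hasProjectiveDimensionLE_zero X).2 hX
    exact perfectObjects_singleFunctor X n
  | succ d ih =>
    have hS : (ShortComplex.mk (kernel.ι (Projective.π X)) (Projective.π X)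
      (kernel.condition _)).ShortExact := { exact := ShortComplex.exact_kernel _ }
    exact perfectObjects_of_shortExact hS n
      (ih _ ((hS.hasProjectiveDimensionLT_X₃_iff d inferInstance).1 hX))
      (perfectObjects_singleFunctor _ n)

/-- A bounded complex of objects of finite projective dimension is perfect. -/
lemma perfectObjects_Q_obj [EnoughProjectives A] (K : CochainComplex A ℤ) (a b : ℤ)
    [K.IsStrictlyGE a] [K.IsStrictlyLE b] (h : ∀ n, ∃ d, HasProjectiveDimensionLE (K.X n) d) :
    perfectObjects A (DerivedCategory.Q.obj K) :=
  prop_Q_obj_of_bounded _ a b K (fun n _ _ =>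
    perfectObjects_of_hasProjectiveDimensionLE _ _ (h n).choose_spec n)

variable (A) in
/-- The objects `X` of the derived category such that `Hom(X, Y[n]) = 0` for large `n` and
all `Y` in `A`. -/
def boundedExtObjects : ObjectProperty (DerivedCategory A) := fun X =>
  ∃ N : ℤ, ∀ n, n ≤ N → ∀ (Y : A) (f : X ⟶ (DerivedCategory.singleFunctor A n).obj Y), f = 0

instance : (boundedExtObjects A).IsClosedUnderIsomorphisms where
  of_iso := by
    rintro X Y e ⟨N, hN⟩
    refine ⟨N, fun n hn Z f => ?_⟩
    rw [← cancel_epi e.hom, hN n hn Z (e.hom ≫ f), comp_zero]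

instance : (boundedExtObjects A).ContainsZero where
  exists_zero := ⟨0, isZero_zero _, 0, fun _ _ _ _ => (isZero_zero _).eq_of_src _ _⟩

instance : (boundedExtObjects A).IsTriangulatedClosed₂ := .mk' (by
  rintro T hT ⟨N, hN⟩ ⟨M, hM⟩
  refine ⟨min N M, fun n hn Y f => ?_⟩
  obtain ⟨g, rfl⟩ := Triangle.yoneda_exact₂ T hT f (hN n (by lia) Y _)
  rw [hM n (by lia) Y g, comp_zero])

/-- By dévissage it suffices to treat a projective placed in degree `n`, which has no nonzero
morphism to an object placed in another degree; so `N = n - 1` works. -/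
lemma perfectObjects_le_boundedExtObjects : perfectObjects A ≤ boundedExtObjects A := by
  rintro X ⟨K, a, b, h₁, h₂, h₃, ⟨e⟩⟩
  refine (boundedExtObjects A).prop_of_iso e (prop_Q_obj_of_bounded _ a b K (fun n _ _ =>
    ⟨n - 1, fun m hm Y f => hom_singleFunctor_eq_zero_of_projective (by lia) f⟩))

lemma ext_eq_zero_of_hom_eq_zero [HasExt.{w₁} A] {X Y : A} (i : ℕ)
    (h : ∀ f : (DerivedCategory.singleFunctor A 0).obj X ⟶
      (DerivedCategory.singleFunctor A (-i)).obj Y, f = 0) (x : Abelian.Ext X Y i) : x = 0 := by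
  apply Abelian.Ext.homEquiv.injective
  rw [← cancel_mono (((DerivedCategory.singleFunctors A).shiftIso (i : ℤ) (-i) 0 (by lia)).hom.app Y)]
  -- Both sides are morphisms covered by `h`, hence both are zero.
  rw [h (_ ≫ _), ← h (_ ≫ _)]

lemma hom_eq_zero_of_ext_eq_zero [HasExt.{w₁} A] {X Y : A} (i : ℕ)
    (h : ∀ x : Abelian.Ext X Y i, x = 0) (f : (DerivedCategory.singleFunctor A 0).obj X ⟶
      (DerivedCategory.singleFunctor A (-i)).obj Y) : f = 0 := by
  rw [← cancel_mono (((DerivedCategory.singleFunctors A).shiftIso (i : ℤ) (-i) 0 (by lia)).inv.app Y)]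
  apply Abelian.Ext.homEquiv.symm.injective
  rw [h (Abelian.Ext.homEquiv.symm (f ≫ _)), ← h (Abelian.Ext.homEquiv.symm (0 ≫ _))]

/-- Morphisms from a perfect object to objects in sufficiently low degrees vanish. A retract
inherits this, and it says that `Ext^i(X, -) = 0` for large `i`. -/
lemma exists_hasProjectiveDimensionLE_of_retract {X : A} {C : DerivedCategory A}
    (hC : perfectObjects A C) (h : Retract ((DerivedCategory.singleFunctor A 0).obj X) C) :
    ∃ d, HasProjectiveDimensionLE X d := by
  obtain ⟨N, hN⟩ := perfectObjects_le_boundedExtObjects C hC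
  let := HasExt.standard A
  refine ⟨N.natAbs, (hasProjectiveDimensionLT_iff _ _).2 fun i hi Y x =>
    ext_eq_zero_of_hom_eq_zero i (fun f => ?_) x⟩
  rw [← Category.id_comp f, ← h.retract, Category.assoc, hN (-i) (by lia) Y (h.r ≫ f), comp_zero]

end Derived
end CleftGP

/-! ### Vanishing of Ext and Gorenstein projective objects -/

namespace CleftGP
open Abelian hiding image image.ι factorThruImage image.fac
open ZeroObject

section Gorenstein

variable {A : Type u} [Category.{v} A] [Abelian A]

attribute [local instance] HasExt.standard

/-- `Ext^i(X, Y) = 0` for all `i ≥ 1`. -/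
def ExtVanishing (X Y : A) : Prop := ∀ (i : ℕ) (x : Ext.{max u v} X Y (i + 1)), x = 0

lemma ExtVanishing.of_projective (X Y : A) [Projective X] : ExtVanishing X Y :=
  fun _ x => x.eq_zero_of_projective

lemma ExtVanishing.of_retract {X X' Y : A} (h : Retract X X') (hX : ExtVanishing X' Y) :
    ExtVanishing X Y := fun i x => by
  rw [← x.mk₀_id_comp, ← h.retract, ← Ext.mk₀_comp_mk₀, Ext.comp_assoc_of_second_deg_zero,
    hX i ((Ext.mk₀ h.r).comp x (zero_add _)), Ext.comp_zero]

lemma ExtVanishing.of_iso {X X' Y : A} (e : X ≅ X') (hX : ExtVanishing X' Y) :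
    ExtVanishing X Y := hX.of_retract e.retract

lemma ExtVanishing.X₁ {S : ShortComplex A} (hS : S.ShortExact) {Y : A} (h₂ : ExtVanishing S.X₂ Y)
    (h₃ : ExtVanishing S.X₃ Y) : ExtVanishing S.X₁ Y := fun i x => by
  obtain ⟨y, rfl⟩ := Ext.contravariant_sequence_exact₁ hS Y x (add_comm _ _) (h₃ _ _)
  rw [h₂ _ y, Ext.comp_zero]

lemma ExtVanishing.X₂ {S : ShortComplex A} (hS : S.ShortExact) {Y : A} (h₁ : ExtVanishing S.X₁ Y)
    (h₃ : ExtVanishing S.X₃ Y) : ExtVanishing S.X₂ Y := fun i x => by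
  obtain ⟨y, rfl⟩ := Ext.contravariant_sequence_exact₂ hS Y x (h₁ _ _)
  rw [h₃ _ y, Ext.comp_zero]

lemma ExtVanishing.right_X₃ {S : ShortComplex A} (hS : S.ShortExact) {X : A}
    (h₁ : ExtVanishing X S.X₁) (h₂ : ExtVanishing X S.X₂) : ExtVanishing X S.X₃ := fun i x => by
  obtain ⟨y, rfl⟩ := Ext.covariant_sequence_exact₃ X hS x rfl (h₁ _ _)
  rw [h₂ _ y, Ext.zero_comp]

lemma ExtVanishing.exists_extension {S : ShortComplex A} (hS : S.ShortExact) {Y : A}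
    (h : ExtVanishing S.X₃ Y) (f : S.X₁ ⟶ Y) : ∃ g : S.X₂ ⟶ Y, S.f ≫ g = f := by
  obtain ⟨y, hy⟩ := Ext.contravariant_sequence_exact₁ hS Y (Ext.mk₀ f) (add_comm 1 0) (h _ _)
  obtain ⟨g, rfl⟩ := (Ext.mk₀_bijective _ _).2 y
  rw [Ext.mk₀_comp_mk₀] at hy
  exact ⟨g, (Ext.mk₀_bijective _ _).1 hy⟩

lemma ext_one_eq_zero {S : ShortComplex A} (hS : S.ShortExact) [Projective S.X₂] {Y : A}
    (h : ∀ f : S.X₁ ⟶ Y, ∃ g : S.X₂ ⟶ Y, S.f ≫ g = f) (x : Ext.{max u v} S.X₃ Y 1) : x = 0 := by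
  obtain ⟨y, rfl⟩ := Ext.contravariant_sequence_exact₃ hS Y x
    (Ext.eq_zero_of_projective _) (add_zero 1)
  obtain ⟨f, rfl⟩ := (Ext.mk₀_bijective _ _).2 y
  obtain ⟨g, rfl⟩ := h f
  rw [← Ext.mk₀_comp_mk₀, hS.extClass_comp_assoc]

lemma ext_succ_eq_zero {S : ShortComplex A} (hS : S.ShortExact) [Projective S.X₂] {Y : A} (i : ℕ)
    (h : ∀ x : Ext.{max u v} S.X₁ Y (i + 1), x = 0) (x : Ext.{max u v} S.X₃ Y (i + 2)) : x = 0 := by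
  obtain ⟨y, rfl⟩ := Ext.contravariant_sequence_exact₃ hS Y x
    (Ext.eq_zero_of_projective _) (n₀ := i + 1) (by lia)
  rw [h y, Ext.comp_zero]

/-- If a class of objects is closed under syzygies along which all morphisms to `Y` extend, then
all `Ext^i(X, Y)` vanish for `i ≥ 1` and `X` in this class. -/
lemma extVanishing_of_class (C : ObjectProperty A) (Y : A)
    (hC : ∀ X, C X → ∃ (S : ShortComplex A) (_ : S.ShortExact) (_ : Projective S.X₂)
      (_ : Nonempty (S.X₃ ≅ X)), C S.X₁ ∧ ∀ f : S.X₁ ⟶ Y, ∃ g : S.X₂ ⟶ Y, S.f ≫ g = f)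
    (X : A) (hX : C X) : ExtVanishing X Y := by
  intro i
  induction i generalizing X with
  | zero =>
    obtain ⟨S, hS, _, ⟨e⟩, -, h⟩ := hC X hX
    intro x
    rw [← x.mk₀_id_comp, ← e.inv_hom_id, ← Ext.mk₀_comp_mk₀, Ext.comp_assoc_of_second_deg_zero,
      ext_one_eq_zero hS h ((Ext.mk₀ e.hom).comp x (zero_add _)), Ext.comp_zero]
  | succ i ih =>
    obtain ⟨S, hS, _, ⟨e⟩, h, -⟩ := hC X hX
    intro x
    rw [← x.mk₀_id_comp, ← e.inv_hom_id, ← Ext.mk₀_comp_mk₀, Ext.comp_assoc_of_second_deg_zero,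
      ext_succ_eq_zero hS i (ih _ h) ((Ext.mk₀ e.hom).comp x (zero_add _)), Ext.comp_zero]

/-- Needed for `Y = e Q` with `Q` projective, which is only known to have finite projective
dimension. -/
lemma ExtVanishing.of_hasProjectiveDimensionLE [EnoughProjectives A] {X : A}
    (hX : ∀ P : A, Projective P → ExtVanishing X P) (d : ℕ) (Y : A)
    (hY : HasProjectiveDimensionLE Y d) : ExtVanishing X Y := by
  induction d generalizing Y with
  | zero => exact hX Y ((projective_iff_hasProjectiveDimensionLE_zero Y).2 hY)
  | succ d ih =>
    have hS : (ShortComplex.mk (kernel.ι (Projective.π Y)) (Projective.π Y)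
      (kernel.condition _)).ShortExact := { exact := ShortComplex.exact_kernel _ }
    exact ExtVanishing.right_X₃ hS
      (ih _ ((hS.hasProjectiveDimensionLT_X₃_iff d inferInstance).1 hY))
      (hX _ inferInstance)

/-- A biinfinite sequence of short exact sequences `0 ⟶ Y n ⟶ P n ⟶ Y (n + 1) ⟶ 0` with `P n`
projective and `Ext^i(Y n, Q) = 0` for `i ≥ 1` and `Q` projective. -/
structure IsGorensteinSequence (Y : ℤ → A) : Prop where
  exists_shortExact : ∀ n, ∃ (P : A) (f : Y n ⟶ P) (g : P ⟶ Y (n + 1)) (w : f ≫ g = 0),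
    Projective P ∧ (ShortComplex.mk f g w).ShortExact
  extVanishing : ∀ n Q, Projective Q → ExtVanishing (Y n) Q

lemma shortExact_image_of_acyclic {K : CochainComplex A ℤ} (hK : K.Acyclic) (n : ℤ) :
    ∃ w, (ShortComplex.mk (image.ι (K.d n (n + 1))) (factorThruImage (K.d (n + 1) (n + 1 + 1)))
      w).ShortExact := by
  have hw : image.ι (K.d n (n + 1)) ≫ factorThruImage (K.d (n + 1) (n + 1 + 1)) = 0 := by
    rw [← cancel_epi (factorThruImage (K.d n (n + 1))), ← cancel_mono (image.ι (K.d (n + 1) _))]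
    simp
  refine ⟨hw, { exact := ?_ }⟩
  have h := (K.exactAt_iff' n (n + 1) (n + 1 + 1) (by simp) (by simp)).1 (hK (n + 1))
  -- Exactness is insensitive to replacing the first term by its image (`φ`) and the last term by a
  -- subobject containing the image (`ψ`).
  let φ : K.sc' n (n + 1) (n + 1 + 1) ⟶ ShortComplex.mk (image.ι (K.d n (n + 1)))
      (K.d (n + 1) (n + 1 + 1)) (by rw [← image.fac (K.d (n + 1) (n + 1 + 1)), reassoc_of% hw, zero_comp]) :=
    { τ₁ := factorThruImage (K.d n (n + 1))
      τ₂ := 𝟙 (K.X (n + 1))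
      τ₃ := 𝟙 (K.X (n + 1 + 1))
      comm₁₂ := (image.fac (K.d n (n + 1))).trans (Category.comp_id _).symm
      comm₂₃ := (Category.id_comp _).trans (Category.comp_id _).symm }
  have : Epi φ.τ₁ := inferInstanceAs (Epi (factorThruImage (K.d n (n + 1))))
  have : IsIso φ.τ₂ := inferInstanceAs (IsIso (𝟙 _))
  have : Mono φ.τ₃ := inferInstanceAs (Mono (𝟙 _))
  have h' := (ShortComplex.exact_iff_of_epi_of_isIso_of_mono φ).1 h
  let ψ : ShortComplex.mk (image.ι (K.d n (n + 1))) (factorThruImage (K.d (n + 1) (n + 1 + 1))) hw ⟶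
    ShortComplex.mk (image.ι (K.d n (n + 1))) (K.d (n + 1) (n + 1 + 1))
      (by rw [← image.fac (K.d (n + 1) (n + 1 + 1)), reassoc_of% hw, zero_comp]) :=
    { τ₁ := 𝟙 _
      τ₂ := 𝟙 _
      τ₃ := image.ι _ }
  have : Epi ψ.τ₁ := inferInstanceAs (Epi (𝟙 _))
  have : IsIso ψ.τ₂ := inferInstanceAs (IsIso (𝟙 _))
  have : Mono ψ.τ₃ := inferInstanceAs (Mono (image.ι _))
  exact (ShortComplex.exact_iff_of_epi_of_isIso_of_mono ψ).2 h'

lemma IsTotallyAcyclic.isGorensteinSequence {K : CochainComplex A ℤ} (hK : IsTotallyAcyclic K) :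
    IsGorensteinSequence (fun n => image (K.d n (n + 1))) where
  exists_shortExact n := by
    obtain ⟨w, h⟩ := shortExact_image_of_acyclic hK.acyclic n
    exact ⟨_, _, _, w, hK.projective _, h⟩
  extVanishing n Q hQ := by
    refine extVanishing_of_class (fun X => ∃ n, X = image (K.d n (n + 1))) Q ?_ _ ⟨n, rfl⟩
    rintro _ ⟨n, rfl⟩
    obtain ⟨m, rfl⟩ : ∃ m, n = m + 1 := ⟨n - 1, by lia⟩
    obtain ⟨w, h⟩ := shortExact_image_of_acyclic hK.acyclic m
    refine ⟨_, h, hK.projective _, ⟨Iso.refl _⟩, ⟨m, rfl⟩, fun f => ?_⟩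
    -- A morphism from the image to `Q`, pulled back to `K.X m`, kills the previous differential;
    -- coacyclicity then extends it over `K.X (m + 1)`.
    obtain ⟨g, hg⟩ := hK.coacyclic Q hQ m (factorThruImage (K.d m (m + 1)) ≫ f) (by
      rw [← Category.assoc, show K.d (m - 1) m ≫ factorThruImage (K.d m (m + 1)) = 0 by
        rw [← cancel_mono (image.ι _)]; simp, zero_comp])
    refine ⟨g, ?_⟩
    rw [← cancel_epi (factorThruImage (K.d m (m + 1))), ← hg]
    simp

lemma IsGorensteinSequence.shift {Y : ℤ → A} (h : IsGorensteinSequence Y) (a : ℤ) :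
    IsGorensteinSequence (fun n => Y (n + a)) where
  exists_shortExact n := by
    have := h.exists_shortExact (n + a)
    rwa [add_right_comm] at this
  extVanishing n := h.extVanishing (n + a)

lemma IsGorensteinSequence.isGorensteinProjective_zero {Y : ℤ → A} (h : IsGorensteinSequence Y) :
    isGorensteinProjective A (Y 0) := by
  choose P f g w hP hS using h.exists_shortExact
  -- The short exact sequences are spliced into one complex of projectives.
  let K := CochainComplex.of P (fun n => g n ≫ f (n + 1)) (fun n => by
    simp [reassoc_of% (w (n + 1))])
  have hd (n : ℤ) : K.d n (n + 1) = g n ≫ f (n + 1) :=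
    CochainComplex.of_d P (fun n => g n ≫ f (n + 1)) n
  have hf (n : ℤ) : Mono (f n) := (hS n).mono_f
  have hg (n : ℤ) : Epi (g n) := (hS n).epi_g
  refine ⟨K, ⟨hP, fun n => ?_, fun Q hQ n φ hφ => ?_⟩, ⟨?_⟩⟩
  · obtain ⟨m, rfl⟩ : ∃ m, n = m + 1 := ⟨n - 1, by lia⟩
    rw [K.exactAt_iff' m (m + 1) (m + 1 + 1) (by simp) (by simp)]
    let T : ShortComplex A := ShortComplex.mk (f (m + 1)) (g (m + 1) ≫ f (m + 1 + 1))
      (by rw [reassoc_of% (w (m + 1)), zero_comp])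
    let α : K.sc' m (m + 1) (m + 1 + 1) ⟶ T :=
      { τ₁ := g m
        τ₂ := 𝟙 _
        τ₃ := 𝟙 _
        comm₁₂ := (hd m).symm.trans (Category.comp_id _).symm
        comm₂₃ := (Category.id_comp _).trans ((hd (m + 1)).symm.trans (Category.comp_id _).symm) }
    have : Epi α.τ₁ := hg m
    have : IsIso α.τ₂ := inferInstanceAs (IsIso (𝟙 _))
    have : Mono α.τ₃ := inferInstanceAs (Mono (𝟙 _))
    rw [ShortComplex.exact_iff_of_epi_of_isIso_of_mono α]
    let β : ShortComplex.mk (f (m + 1)) (g (m + 1)) (w _) ⟶ T :=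
      { τ₁ := 𝟙 _
        τ₂ := 𝟙 _
        τ₃ := f (m + 1 + 1)
        comm₁₂ := (Category.id_comp _).trans (Category.comp_id _).symm
        comm₂₃ := Category.id_comp _ }
    have : Epi β.τ₁ := inferInstanceAs (Epi (𝟙 _))
    have : IsIso β.τ₂ := inferInstanceAs (IsIso (𝟙 _))
    have : Mono β.τ₃ := hf _
    rw [← ShortComplex.exact_iff_of_epi_of_isIso_of_mono β]
    exact (hS _).exact
  · obtain ⟨m, rfl⟩ : ∃ m, n = m + 1 := ⟨n - 1, by lia⟩
    rw [add_sub_cancel_right, hd, Category.assoc] at hφ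
    have hφ' : f (m + 1) ≫ φ = 0 := by
      rw [← cancel_epi (g m)]
      exact hφ.trans comp_zero.symm
    -- As `φ` kills `Y (m + 1)`, it descends to `Y (m + 2)`, and extends from there to `P (m + 2)`
    -- because `Ext^1(Y (m + 3), Q) = 0`.
    obtain ⟨ψ, hψ⟩ := (h.extVanishing (m + 1 + 1 + 1) Q hQ).exists_extension (hS (m + 1 + 1))
      ((hS (m + 1)).exact.desc φ hφ')
    refine ⟨ψ, ?_⟩
    rw [hd, Category.assoc]
    have e := (hS (m + 1)).exact.g_desc φ hφ'
    rw [← hψ] at e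
    exact e
  · let M : MonoFactorisation (K.d (-1) 0) :=
      { I := Y 0
        m := f 0
        e := g (-1)
        fac := (hd (-1)).symm }
    have hM : M.m ≫ cokernel.π (K.d (-1) 0) = 0 := by
      have : Epi M.e := hg (-1)
      rw [← cancel_epi M.e, ← Category.assoc, M.fac, cokernel.condition, comp_zero]
    have : StrongEpi M.e := by
      have : Epi M.e := hg (-1)
      exact strongEpi_of_epi M.e
    exact (IsImage.isoExt (StrongEpiMonoFactorisation.mk M).toMonoIsImage (Image.isImage _))

lemma isGorensteinProjective_of_iso {X Y : A} (e : X ≅ Y) (hX : isGorensteinProjective A X) :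
    isGorensteinProjective A Y := by
  obtain ⟨P, hP, ⟨f⟩⟩ := hX
  exact ⟨P, hP, ⟨e.symm ≪≫ f⟩⟩

lemma IsGorensteinSequence.isGorensteinProjective {Y : ℤ → A} (h : IsGorensteinSequence Y) (n : ℤ) :
    isGorensteinProjective A (Y n) := by
  simpa using (h.shift n).isGorensteinProjective_zero

lemma exists_isGorensteinSequence {X : A} (hX : isGorensteinProjective A X) :
    ∃ Y : ℤ → A, IsGorensteinSequence Y ∧ Nonempty (Y 0 ≅ X) := by
  obtain ⟨P, hP, ⟨e⟩⟩ := hX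
  exact ⟨_, hP.isGorensteinSequence.shift (-1), ⟨by exact e.symm⟩⟩

lemma extVanishing_of_isGorensteinProjective {X : A} (hX : isGorensteinProjective A X) (Q : A)
    (hQ : Projective Q) : ExtVanishing X Q := by
  obtain ⟨Y, hY, ⟨e⟩⟩ := exists_isGorensteinSequence hX
  exact (hY.extVanishing 0 Q hQ).of_iso e.symm

lemma exists_shortExact_right {X : A} (hX : isGorensteinProjective A X) :
    ∃ (P Z : A) (f : X ⟶ P) (g : P ⟶ Z) (w : f ≫ g = 0), Projective P ∧
      isGorensteinProjective A Z ∧ (ShortComplex.mk f g w).ShortExact := by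
  obtain ⟨Y, hY, ⟨e⟩⟩ := exists_isGorensteinSequence hX
  obtain ⟨P, f, g, w, hP, hS⟩ := hY.exists_shortExact 0
  refine ⟨P, Y (0 + 1), e.inv ≫ f, g, by simp [w], hP, hY.isGorensteinProjective _, ?_⟩
  exact ShortComplex.shortExact_of_iso (S₁ := ShortComplex.mk f g w)
    (ShortComplex.isoMk e (Iso.refl _) (Iso.refl _)) hS

lemma exists_shortExact_left {X : A} (hX : isGorensteinProjective A X) :
    ∃ (P Z : A) (f : Z ⟶ P) (g : P ⟶ X) (w : f ≫ g = 0), Projective P ∧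
      isGorensteinProjective A Z ∧ (ShortComplex.mk f g w).ShortExact := by
  obtain ⟨Y, hY, ⟨e⟩⟩ := exists_isGorensteinSequence hX
  obtain ⟨P, f, g, w, hP, hS⟩ := hY.exists_shortExact (-1)
  refine ⟨P, Y (-1), f, g ≫ e.hom, by simp [reassoc_of% w], hP, hY.isGorensteinProjective _, ?_⟩
  exact ShortComplex.shortExact_of_iso (S₁ := ShortComplex.mk f g w)
    (ShortComplex.isoMk (Iso.refl _) (Iso.refl _) e) hS

/-- Coinduction principle for Gorenstein projective objects. -/
lemma isGorensteinProjective_of_class [EnoughProjectives A] (C : ObjectProperty A)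
    (h₁ : ∀ X, C X → ∀ Q : A, Projective Q → ExtVanishing X Q)
    (h₂ : ∀ X, C X → ∃ (P Z : A) (f : X ⟶ P) (g : P ⟶ Z) (w : f ≫ g = 0), Projective P ∧
      C Z ∧ (ShortComplex.mk f g w).ShortExact) (X : A) (hX : C X) :
    isGorensteinProjective A X := by
  choose P Z f g w hP hZ hS using h₂
  -- The class supplies the right half of the sequence. The left half `L` consists of arbitrary
  -- syzygies, which inherit the vanishing of Ext.
  let R : ℕ → { Y : A // C Y } := fun n => n.rec ⟨X, hX⟩ (fun _ Y => ⟨Z Y.1 Y.2, hZ Y.1 Y.2⟩)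
  let L : ℕ → A := Nat.rec (motive := fun _ => A) X (fun _ Y => kernel (Projective.π Y))
  have hker (Y : A) : (ShortComplex.mk (kernel.ι (Projective.π Y)) (Projective.π Y)
      (kernel.condition _)).ShortExact := { exact := ShortComplex.exact_kernel _ }
  have hL (n : ℕ) (Q : A) (hQ : Projective Q) : ExtVanishing (L n) Q := by
    induction n with
    | zero => exact h₁ X hX Q hQ
    | succ n ih =>
      have h : ExtVanishing (Projective.over (L n)) Q :=
        ExtVanishing.of_projective (A := A) (Projective.over (L n)) Q
      exact ExtVanishing.X₁ (hker (L n)) h ih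
  let Y : ℤ → A := fun n => match n with
    | .ofNat k => (R k).1
    | .negSucc k => L (k + 1)
  have hY : IsGorensteinSequence Y := ⟨fun n => ?_, fun n Q hQ => ?_⟩
  · exact hY.isGorensteinProjective_zero
  · rcases n with k | k
    · exact ⟨_, _, _, _, hP _ _, hS (R k).1 (R k).2⟩
    · rcases k with _ | k
      · exact ⟨_, _, _, _, inferInstance, hker X⟩
      · exact ⟨_, _, _, _, inferInstance, hker (L (k + 1))⟩
  · rcases n with k | k
    · exact h₁ _ (R k).2 Q hQ
    · exact hL (k + 1) Q hQ

lemma isGorensteinProjective_of_projective [EnoughProjectives A] (P : A) [Projective P] :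
    isGorensteinProjective A P := by
  refine isGorensteinProjective_of_class (fun X => Projective X)
    (fun X _ Q _ => .of_projective X Q) (fun X hX => ?_) P inferInstance
  refine ⟨X, 0, 𝟙 X, 0, comp_zero, hX, (isZero_zero A).projective, ?_⟩
  exact ShortComplex.Splitting.shortExact
    { r := 𝟙 X
      s := 0
      s_g := (isZero_zero A).eq_of_src _ _ }

/-- The cokernels of a monomorphism of short exact sequences. -/
lemma exists_shortExact_cokernel {S T : ShortComplex A} (hS : S.ShortExact) (hT : T.ShortExact)
    (φ : S ⟶ T) [Mono φ.τ₁] [Mono φ.τ₃] :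
    Mono φ.τ₂ ∧ ∃ R : ShortComplex A, R.ShortExact ∧ Nonempty (R.X₁ ≅ cokernel φ.τ₁) ∧
      Nonempty (R.X₂ ≅ cokernel φ.τ₂) ∧ Nonempty (R.X₃ ≅ cokernel φ.τ₃) := by
  have := hS.epi_g
  have := hT.mono_f
  have h₂ : Mono φ.τ₂ := by
    have := hS.mono_f
    exact ShortComplex.mono_τ₂_of_exact_of_mono φ hS.exact
  let I : ShortComplex.SnakeInput A :=
    { L₀ := kernel φ
      L₁ := S
      L₂ := T
      L₃ := cokernel φ
      v₀₁ := kernel.ι φ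
      v₁₂ := φ
      v₂₃ := cokernel.π φ
      w₀₂ := kernel.condition φ
      w₁₃ := cokernel.condition φ
      h₀ := kernelIsKernel φ
      h₃ := cokernelIsCokernel φ
      L₁_exact := hS.exact
      epi_L₁_g := inferInstance
      L₂_exact := hT.exact
      mono_L₂_f := inferInstance }
  -- The snake's connecting morphism starts at `ker φ.τ₃ = 0`, so the sequence of cokernels is also
  -- exact on the left.
  have h₀ : IsZero I.L₀.X₃ := by
    have : Mono I.v₀₁.τ₃ := ⟨fun a b h => Fork.IsLimit.hom_ext I.h₀τ₃ h⟩
    refine IsZero.of_mono_eq_zero I.v₀₁.τ₃ ?_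
    have := I.w₀₂_τ₃
    rwa [show I.v₁₂.τ₃ = φ.τ₃ from rfl, ← zero_comp (f := φ.τ₃), cancel_mono] at this
  refine ⟨h₂, I.L₃, ?_, ?_⟩
  · have hm : Mono I.L₃.f := I.L₂'_exact.mono_g (h₀.eq_of_src _ _)
    have he : Epi I.L₃.g := by
      have : Epi I.v₂₃.τ₃ := ⟨fun a b h => Cofork.IsColimit.hom_ext I.h₃τ₃ h⟩
      have : Epi I.L₂.g := hT.epi_g
      have : Epi (I.v₂₃.τ₂ ≫ I.L₃.g) := by rw [I.v₂₃.comm₂₃]; infer_instance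
      exact epi_of_epi I.v₂₃.τ₂ I.L₃.g
    exact { exact := I.L₃_exact }
  · exact ⟨⟨I.h₃τ₁.coconePointUniqueUpToIso
        (colimit.isColimit (parallelPair φ.τ₁ 0))⟩,
      ⟨I.h₃τ₂.coconePointUniqueUpToIso
        (colimit.isColimit (parallelPair φ.τ₂ 0))⟩,
      ⟨I.h₃τ₃.coconePointUniqueUpToIso
        (colimit.isColimit (parallelPair φ.τ₃ 0))⟩⟩

lemma cokernel_iso_of_shortExact {S : ShortComplex A} (hS : S.ShortExact) :
    Nonempty (cokernel S.f ≅ S.X₃) := by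
  have := hS.epi_g
  exact ⟨IsColimit.coconePointUniqueUpToIso (cokernelIsCokernel _) hS.exact.gIsCokernel⟩

/-- An extension of Gorenstein projective objects is Gorenstein projective. -/
lemma isGorensteinProjective_of_shortExact [EnoughProjectives A] {S : ShortComplex A}
    (hS : S.ShortExact) (h₁ : isGorensteinProjective A S.X₁) (h₃ : isGorensteinProjective A S.X₃) :
    isGorensteinProjective A S.X₂ := by
  refine isGorensteinProjective_of_class (fun E => ∃ S : ShortComplex A, S.ShortExact ∧
    isGorensteinProjective A S.X₁ ∧ isGorensteinProjective A S.X₃ ∧ Nonempty (S.X₂ ≅ E)) ?_ ?_ _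
      ⟨S, hS, h₁, h₃, ⟨Iso.refl _⟩⟩
  · rintro E ⟨S, hS, h₁, h₃, ⟨e⟩⟩ Q hQ
    exact ((ExtVanishing.X₂ hS (extVanishing_of_isGorensteinProjective h₁ Q hQ)
      (extVanishing_of_isGorensteinProjective h₃ Q hQ))).of_iso e.symm
  · rintro E ⟨S, hS, h₁, h₃, ⟨e⟩⟩
    obtain ⟨P, Z, f, g, w, hP, hZ, hT⟩ := exists_shortExact_right h₁
    obtain ⟨P', Z', f', g', w', hP', hZ', hT'⟩ := exists_shortExact_right h₃
    -- Horseshoe construction on the right: `f` extends over the middle term since `Ext^1(S.X₃, P) =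
    -- 0`. The cokernel is then an extension of `Z'` by `Z`, hence in the same class.
    obtain ⟨k, hk⟩ := (extVanishing_of_isGorensteinProjective h₃ P hP).exists_extension hS f
    let T := ShortComplex.mk (biprod.inl : P ⟶ P ⊞ P') biprod.snd (by simp)
    have hTs : T.ShortExact := (ShortComplex.Splitting.ofHasBinaryBiproduct P P').shortExact
    let φ : S ⟶ T :=
      { τ₁ := f
        τ₂ := biprod.lift k (S.g ≫ f')
        τ₃ := f'
        comm₁₂ := by
          apply biprod.hom_ext <;> simp [T, hk]
        comm₂₃ := by simp [T] }
    have : Mono φ.τ₁ := hT.mono_f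
    have : Mono φ.τ₃ := hT'.mono_f
    obtain ⟨hm, R, hR, ⟨e₁⟩, ⟨e₂⟩, ⟨e₃⟩⟩ := exists_shortExact_cokernel hS hTs φ
    obtain ⟨c₁⟩ := cokernel_iso_of_shortExact hT
    obtain ⟨c₃⟩ := cokernel_iso_of_shortExact hT'
    refine ⟨P ⊞ P', cokernel φ.τ₂, e.inv ≫ φ.τ₂, cokernel.π φ.τ₂, by simp, inferInstance,
      ⟨R, hR, isGorensteinProjective_of_iso (e₁ ≪≫ c₁).symm hZ,
        isGorensteinProjective_of_iso (e₃ ≪≫ c₃).symm hZ', ⟨e₂⟩⟩, ?_⟩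
    refine ShortComplex.shortExact_of_iso (ShortComplex.isoMk e (Iso.refl _) (Iso.refl _))
      (S₁ := ShortComplex.mk φ.τ₂ (cokernel.π φ.τ₂) (cokernel.condition _)) ?_
    exact { exact := ShortComplex.exact_cokernel _ }

/-- A complement of a Gorenstein projective direct summand in a Gorenstein projective object is
Gorenstein projective. -/
lemma isGorensteinProjective_of_splitting [EnoughProjectives A] {Z W X : A} (i : Z ⟶ W) (p : W ⟶ X)
    (w : i ≫ p = 0) (s : (ShortComplex.mk i p w).Splitting) (hW : isGorensteinProjective A W)
    (hX : isGorensteinProjective A X) : isGorensteinProjective A Z := by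
  have hi : Mono i := s.shortExact.mono_f
  obtain ⟨P, W', f, g, w', hP, hW', hS⟩ := exists_shortExact_right hW
  have hf : Mono f := hS.mono_f
  obtain ⟨c⟩ := cokernel_iso_of_shortExact s.shortExact
  obtain ⟨c'⟩ := cokernel_iso_of_shortExact hS
  -- The cokernel of `Z ⟶ W ⟶ P` is an extension of `coker f ≅ W'` by `coker i ≅ X`. So a
  -- coresolution of `Z` can start with `P` and continue inside the Gorenstein projectives.
  have hV : isGorensteinProjective A (cokernel (i ≫ f)) := by
    let T : ShortComplex A := ShortComplex.mk (cokernel.map i (i ≫ f) (𝟙 _) f (by simp))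
      (cokernel.map (i ≫ f) f i (𝟙 _) (by simp)) (by
        rw [← cancel_epi (cokernel.π i)]; simp)
    have hT : T.ShortExact := by
      have := kernelCokernelCompSequence_exact i f
      have hm : Mono T.f := (this.exact 2).mono_g ((isZero_kernel_of_mono f).eq_of_src _ _)
      have he : Epi T.g := by
        have : Epi (cokernel.π (i ≫ f) ≫ T.g) := by simp [T]; infer_instance
        exact epi_of_epi (cokernel.π (i ≫ f)) T.g
      exact { exact := this.exact 3 }
    exact isGorensteinProjective_of_shortExact hT (isGorensteinProjective_of_iso c.symm hX)
      (isGorensteinProjective_of_iso c'.symm hW')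
  refine isGorensteinProjective_of_class (fun E => E = Z ∨ isGorensteinProjective A E) ?_ ?_ Z
    (.inl rfl)
  · rintro E (rfl | hE) Q hQ
    · exact (extVanishing_of_isGorensteinProjective hW Q hQ).of_retract ⟨i, s.r, s.f_r⟩
    · exact extVanishing_of_isGorensteinProjective hE Q hQ
  · rintro E (rfl | hE)
    · exact ⟨P, _, i ≫ f, cokernel.π _, cokernel.condition _, hP, .inr hV,
        { exact := ShortComplex.exact_cokernel _ }⟩
    · obtain ⟨P, Z, f, g, w, hP, hZ, hS⟩ := exists_shortExact_right hE
      exact ⟨P, Z, f, g, w, hP, .inr hZ, hS⟩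

end Gorenstein
end CleftGP

namespace CleftGP
open Pretriangulated ZeroObject

/-! ### Morphisms from Gorenstein projective objects to perfect complexes -/

section FullyFaithful

variable {A : Type u} [Category.{v} A] [Abelian A] [HasDerivedCategory.{w} A]

attribute [local instance] HasExt.standard

lemma exists_truncation_of_perfectObjects {C : DerivedCategory A} (hC : perfectObjects A C) (c : ℤ) :
    ∃ (K L : CochainComplex A ℤ) (a b : ℤ) (f : DerivedCategory.Q.obj K ⟶ C)
      (g : C ⟶ DerivedCategory.Q.obj L) (h : DerivedCategory.Q.obj L ⟶ (DerivedCategory.Q.obj K)⟦(1 : ℤ)⟧),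
      Triangle.mk f g h ∈ distTriang _ ∧ K.IsStrictlyGE c ∧ K.IsStrictlyLE b ∧
      L.IsStrictlyGE a ∧ L.IsStrictlyLE (c - 1) ∧ (∀ n, Projective (K.X n)) ∧
      ∀ n, Projective (L.X n) := by
  obtain ⟨M, a, b, hMa, hMb, hM, ⟨e⟩⟩ := hC
  obtain ⟨S, hS, rfl, h₁, h₃, h₁', h₃'⟩ := exists_brutal_truncation_shortExact M b c
  have hT := DerivedCategory.triangleOfSES_distinguished hS
  refine ⟨S.X₁, S.X₃, a, b, DerivedCategory.Q.map S.f ≫ e.hom, e.inv ≫ DerivedCategory.Q.map S.g,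
    DerivedCategory.triangleOfSESδ hS, isomorphic_distinguished _ hT _
      (Triangle.isoMk _ _ (Iso.refl _) e.symm (Iso.refl _) ?_ ?_ ?_), h₁, ?_, ?_, h₃,
      fun n => ?_, fun n => ?_⟩
  · have h : (DerivedCategory.Q.map S.f ≫ e.hom) ≫ e.inv = 𝟙 _ ≫ DerivedCategory.Q.map S.f := by
      simp
    exact h
  · exact Category.comp_id _
  · have h : DerivedCategory.triangleOfSESδ hS ≫ (𝟙 (DerivedCategory.Q.obj S.X₁))⟦(1 : ℤ)⟧' =
        𝟙 _ ≫ DerivedCategory.triangleOfSESδ hS := by simp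
    exact h
  · rw [CochainComplex.isStrictlyLE_iff]
    intro n hn
    by_cases hc : c ≤ n
    · exact (S.X₂.isZero_of_isStrictlyLE b n hn).of_iso (h₁' n hc).some
    · exact S.X₁.isZero_of_isStrictlyGE c n (by lia)
  · rw [CochainComplex.isStrictlyGE_iff]
    intro n hn
    by_cases hc : n < c
    · exact (S.X₂.isZero_of_isStrictlyGE a n hn).of_iso (h₃' n hc).some
    · exact S.X₃.isZero_of_isStrictlyLE (c - 1) n (by lia)
  · by_cases hc : c ≤ n
    · exact Projective.of_iso (h₁' n hc).some.symm (hM n)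
    · exact (S.X₁.isZero_of_isStrictlyGE c n (by lia)).projective
  · by_cases hc : n < c
    · exact Projective.of_iso (h₃' n hc).some.symm (hM n)
    · exact (S.X₃.isZero_of_isStrictlyLE (c - 1) n (by lia)).projective

/-- The objects of the derived category which receive no nonzero morphism from `X`. -/
def rightOrthogonalTo (X : DerivedCategory A) : ObjectProperty (DerivedCategory A) := fun Y =>
  ∀ f : X ⟶ Y, f = 0

instance (X : DerivedCategory A) : (rightOrthogonalTo X).IsClosedUnderIsomorphisms where
  of_iso := by
    rintro Y Z e hY f
    rw [← cancel_mono e.inv, hY (f ≫ e.inv), zero_comp]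

instance (X : DerivedCategory A) : (rightOrthogonalTo X).ContainsZero where
  exists_zero := ⟨0, isZero_zero _, fun _ => (isZero_zero _).eq_of_tgt _ _⟩

instance (X : DerivedCategory A) : (rightOrthogonalTo X).IsTriangulatedClosed₂ := .mk' (by
  rintro T hT h₁ h₃ f
  obtain ⟨g, rfl⟩ := Triangle.coyoneda_exact₂ T hT f (h₃ _)
  rw [h₁ g, zero_comp])

variable {X : A} (hX : ∀ Q : A, Projective Q → ExtVanishing X Q)
include hX

/-- A projective `Q` placed in degree `-(i + 1)` receives from `X` the group `Ext^(i+1)(X, Q) = 0`;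
dévissage gives the rest. -/
lemma hom_Q_eq_zero_of_extVanishing (L : CochainComplex A ℤ) (a : ℤ) [L.IsStrictlyGE a]
    [L.IsStrictlyLE (-1)] (hL : ∀ n, Projective (L.X n))
    (f : (DerivedCategory.singleFunctor A 0).obj X ⟶ DerivedCategory.Q.obj L) : f = 0 := by
  refine prop_Q_obj_of_bounded (rightOrthogonalTo _) a (-1) L (fun n _ hn f => ?_) f
  obtain ⟨i, rfl⟩ : ∃ i : ℕ, n = -((i + 1 : ℕ) : ℤ) := ⟨(-n - 1).toNat, by lia⟩
  exact hom_eq_zero_of_ext_eq_zero (i + 1) (hX _ (hL _) i) f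

lemma exists_lift_truncation {C : DerivedCategory A} (hC : perfectObjects A C)
    (f : (DerivedCategory.singleFunctor A 0).obj X ⟶ C) :
    ∃ (K : CochainComplex A ℤ) (b : ℤ) (g : (DerivedCategory.singleFunctor A 0).obj X ⟶
        DerivedCategory.Q.obj K) (h : DerivedCategory.Q.obj K ⟶ C), g ≫ h = f ∧
      K.IsStrictlyGE 0 ∧ K.IsStrictlyLE b ∧ ∀ n, Projective (K.X n) := by
  obtain ⟨K, L, a, b, i, p, δ, hT, h₁, h₂, h₃, h₄, h₅, h₆⟩ :=
    exists_truncation_of_perfectObjects hC 0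
  have : L.IsStrictlyLE (-1) := h₄
  obtain ⟨g, hg⟩ := Triangle.coyoneda_exact₂ _ hT f (hom_Q_eq_zero_of_extVanishing hX L a h₆ _)
  exact ⟨K, b, g, i, hg.symm, h₁, h₂, h₅⟩

/-- The source of fullness, for a fraction `X ⟶ Z ⟵ Y` with perfect cone `C`. The composite `X ⟶ C`
lifts to a complex `K` of projectives in degrees `≥ 0`. The map `K ⟶ C ⟶ Y[1]` vanishes because
`Y[1]` lives in degree `-1`, so `K ⟶ C` lifts to `t : K ⟶ Z`. What remains of `f` after subtracting
`x ≫ t` dies in `C`, hence comes from `Y`. -/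
lemma exists_eq_add_of_perfectObjects {Y : A} {Z C : DerivedCategory A}
    (s : (DerivedCategory.singleFunctor A 0).obj Y ⟶ Z) (p : Z ⟶ C) (δ : C ⟶ _)
    (hT : Triangle.mk s p δ ∈ distTriang _) (hC : perfectObjects A C)
    (f : (DerivedCategory.singleFunctor A 0).obj X ⟶ Z) :
    ∃ (a : X ⟶ Y) (C' : DerivedCategory A) (_ : perfectObjects A C')
      (x : (DerivedCategory.singleFunctor A 0).obj X ⟶ C') (t : C' ⟶ Z),
      f = (DerivedCategory.singleFunctor A 0).map a ≫ s + x ≫ t := by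
  obtain ⟨K, b, x, i, hx, h₁, h₂, h₃⟩ := exists_lift_truncation hX hC (f ≫ p)
  have := CochainComplex.isKProjective_of_projective K b
  have hi : i ≫ δ = 0 := by
    rw [← cancel_mono (((DerivedCategory.singleFunctors A).shiftIso 1 (-1) 0 (by lia)).hom.app Y),
      zero_comp]
    refine Q_hom_eq_zero (K := K) (L := (CochainComplex.singleFunctor A (-1)).obj Y) (fun n => ?_) _
    by_cases hn : n = -1
    · exact .inl (K.isZero_of_isStrictlyGE 0 n (by lia))
    · exact .inr (HomologicalComplex.isZero_single_obj_X _ _ _ _ hn)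
  obtain ⟨(t : _ ⟶ Z), ht⟩ := Triangle.coyoneda_exact₃ _ hT i hi
  obtain ⟨a, ha⟩ := Triangle.coyoneda_exact₂ _ hT (f - x ≫ t) (by
    change (f - x ≫ t) ≫ p = 0
    have ht' : i = t ≫ p := ht
    rw [Preadditive.sub_comp, ← hx, ht', Category.assoc, sub_self])
  obtain ⟨a, rfl⟩ := (DerivedCategory.singleFunctor A 0).map_surjective a
  exact ⟨a, DerivedCategory.Q.obj K, ⟨K, 0, b, h₁, h₂, h₃, ⟨Iso.refl _⟩⟩, x, t,
    sub_eq_iff_eq_add.1 ha⟩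

/-- The source of faithfulness: `C` may be replaced by a complex `K` of projectives in degrees `≥
0`. Its part in degrees `≥ 1` has no nonzero morphism to `Y`, so the factorization passes through
the projective `K^0`. -/
lemma exists_factors_projective_of_perfectObjects {Y : A} (f : X ⟶ Y) {C : DerivedCategory A}
    (hC : perfectObjects A C) (x : (DerivedCategory.singleFunctor A 0).obj X ⟶ C)
    (y : C ⟶ (DerivedCategory.singleFunctor A 0).obj Y)
    (h : (DerivedCategory.singleFunctor A 0).map f = x ≫ y) :
    ∃ (P : A) (_ : Projective P) (a : X ⟶ P) (b : P ⟶ Y), f = a ≫ b := by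
  obtain ⟨K, b, x, i, rfl, h₁, h₂, h₃⟩ := exists_lift_truncation hX hC x
  obtain ⟨S, hS, rfl, h₁', h₃', h₁'', h₃''⟩ := exists_brutal_truncation_shortExact K b 1
  have hT := DerivedCategory.triangleOfSES_distinguished hS
  have hb : S.X₁.IsStrictlyLE b := by
    rw [CochainComplex.isStrictlyLE_iff]
    intro n hn
    by_cases hc : 1 ≤ n
    · exact (S.X₂.isZero_of_isStrictlyLE b n hn).of_iso (h₁'' n hc).some
    · exact S.X₁.isZero_of_isStrictlyGE 1 n (by lia)
  have hp (n : ℤ) : Projective (S.X₁.X n) := by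
    by_cases hc : 1 ≤ n
    · exact Projective.of_iso (h₁'' n hc).some.symm (h₃ n)
    · exact (S.X₁.isZero_of_isStrictlyGE 1 n (by lia)).projective
  have := CochainComplex.isKProjective_of_projective S.X₁ b
  obtain ⟨(z : DerivedCategory.Q.obj S.X₃ ⟶ _), hz⟩ := Triangle.yoneda_exact₂ _ hT (i ≫ y)
    (Q_hom_eq_zero (K := S.X₁) (L := (CochainComplex.singleFunctor A 0).obj Y) (fun n => by
      by_cases hn : n = 0
      · exact .inl (S.X₁.isZero_of_isStrictlyGE 1 n (by lia))
      · exact .inr (HomologicalComplex.isZero_single_obj_X _ _ _ _ hn)) _)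
  have : S.X₃.IsStrictlyLE 0 := h₃'
  have : S.X₃.IsStrictlyGE 0 := by
    rw [CochainComplex.isStrictlyGE_iff]
    intro n hn
    exact (S.X₂.isZero_of_isStrictlyGE 0 n hn).of_iso (h₃'' n (by lia)).some
  obtain ⟨P, ⟨e⟩⟩ := S.X₃.exists_iso_single 0
  have hP : Projective P := Projective.of_iso
    ((h₃'' 0 (by lia)).some.symm ≪≫ (HomologicalComplex.eval _ _ 0).mapIso e ≪≫
      HomologicalComplex.singleObjXSelf (ComplexShape.up ℤ) 0 P) (h₃ 0)
  let e' : DerivedCategory.Q.obj S.X₃ ≅ (DerivedCategory.singleFunctor A 0).obj P :=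
    DerivedCategory.Q.mapIso e
  obtain ⟨α, hα⟩ := (DerivedCategory.singleFunctor A 0).map_surjective
    (x ≫ DerivedCategory.Q.map S.g ≫ e'.hom)
  obtain ⟨β, hβ⟩ := (DerivedCategory.singleFunctor A 0).map_surjective (e'.inv ≫ z)
  have hz' : i ≫ y = DerivedCategory.Q.map S.g ≫ z := hz
  refine ⟨P, hP, α, β, (DerivedCategory.singleFunctor A 0).map_injective ?_⟩
  rw [h, Functor.map_comp, hα, hβ]
  simp [hz']

end FullyFaithful

/-! ### Morphisms and triangles in the singularity category -/

section Singularity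

variable (A : Type u) [Category.{v} A] [Abelian A] [HasDerivedCategory.{w} A]

/-- The canonical functor to the singularity category, `X ↦ X[0]`. -/
noncomputable abbrev toSg : A ⥤ SingularityCategory A := single A ⋙ Qsg A

variable {A}

attribute [local instance] HasExt.standard

/-- By calculus of fractions `f - g` is killed by some `s` with perfect cone, so it factors through
the fibre of `s`. -/
lemma exists_factors_perfectObjects {X Y : DerivedCategory.Bounded A} (f g : X ⟶ Y)
    (h : (Qsg A).map f = (Qsg A).map g) :
    ∃ (C : DerivedCategory A) (_ : perfectObjects A C) (a : X.obj ⟶ C) (b : C ⟶ Y.obj),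
      f.hom - g.hom = a ≫ b := by
  obtain ⟨Z, s, hs, fac⟩ := (MorphismProperty.map_eq_iff_postcomp _ (perfectComplexes A).trW f g).1 h
  obtain ⟨C, b, c, hT, hC⟩ := ((perfectComplexes A).trW_iff' s).1 hs
  obtain ⟨a, ha⟩ := Triangle.coyoneda_exact₂ _ hT (f - g) (by
    change (f - g) ≫ s = 0
    rw [Preadditive.sub_comp, fac, sub_self])
  exact ⟨C.obj, hC, a.hom, b.hom, congr_arg (fun k => k.hom) ha⟩

lemma perfectObjects_bounded {C : DerivedCategory A} (hC : perfectObjects A C) :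
    DerivedCategory.TStructure.t.bounded C := by
  obtain ⟨K, a, b, h₁, h₂, -, ⟨e⟩⟩ := hC
  exact DerivedCategory.TStructure.t.bounded.prop_of_iso e
    ⟨⟨a, inferInstance⟩, ⟨b, inferInstance⟩⟩

lemma isZero_Qsg_obj (C : DerivedCategory.Bounded A) (hC : perfectComplexes A C) :
    IsZero ((Qsg A).obj C) := by
  have : IsIso ((Qsg A).map (0 : C ⟶ 0)) := by
    apply Localization.inverts (Qsg A) (perfectComplexes A).trW
    refine ⟨_, _, _, rot_of_distTriang _ (contractible_distinguished C), ?_⟩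
    exact (perfectComplexes A).le_shift 1 _ hC
  exact ((Qsg A).map_isZero (isZero_zero _)).of_iso (asIso ((Qsg A).map (0 : C ⟶ 0)))

lemma exists_toSg_map_eq {X Y : A} (hX : ∀ Q : A, Projective Q → ExtVanishing X Q)
    (α : (toSg A).obj X ⟶ (toSg A).obj Y) : ∃ a : X ⟶ Y, (toSg A).map a = α := by
  obtain ⟨φ, hφ⟩ := Localization.exists_leftFraction (Qsg A) (perfectComplexes A).trW α
  obtain ⟨C, p, δ, hT, hC⟩ := φ.hs
  obtain ⟨a, C', hC', x, (t : C' ⟶ φ.Y'.obj), hxt⟩ := exists_eq_add_of_perfectObjects hX _ _ _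
    (DerivedCategory.Bounded.ι.map_distinguished _ hT) hC φ.f.hom
  refine ⟨a, ?_⟩
  have := Localization.inverts (Qsg A) _ _ φ.hs
  rw [← cancel_mono ((Qsg A).map φ.s), hφ, φ.map_comp_map_s]
  let C'' : DerivedCategory.Bounded A := ⟨C', perfectObjects_bounded hC'⟩
  obtain ⟨x', t', h⟩ : ∃ (x' : (single A).obj X ⟶ C'') (t' : C'' ⟶ φ.Y'),
      φ.f = (single A).map a ≫ φ.s + x' ≫ t' :=
    ⟨ObjectProperty.homMk x, ObjectProperty.homMk t, ObjectProperty.hom_ext _ hxt⟩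
  -- The summand through the perfect object `C'` disappears in the quotient.
  rw [h, (Qsg A).map_add, (Qsg A).map_comp x' t',
    (isZero_Qsg_obj C'' hC').eq_of_tgt ((Qsg A).map x') 0, zero_comp, add_zero, Functor.map_comp]
  rfl

lemma exists_factors_projective_of_toSg_map_eq {X Y : A}
    (hX : ∀ Q : A, Projective Q → ExtVanishing X Q) (f g : X ⟶ Y)
    (h : (toSg A).map f = (toSg A).map g) :
    ∃ (P : A) (_ : Projective P) (a : X ⟶ P) (b : P ⟶ Y), f - g = a ≫ b := by
  obtain ⟨C, hC, x, y, hxy⟩ := exists_factors_perfectObjects _ _ h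
  refine exists_factors_projective_of_perfectObjects hX _ hC x y ?_
  rw [Functor.map_sub]
  exact hxy

lemma exists_hasProjectiveDimensionLE_of_isZero_toSg {X : A} (hX : IsZero ((toSg A).obj X)) :
    ∃ d, HasProjectiveDimensionLE X d := by
  obtain ⟨C, hC, x, y, hxy⟩ := exists_factors_perfectObjects (𝟙 ((single A).obj X)) 0 (hX.eq_of_src _ _)
  exact exists_hasProjectiveDimensionLE_of_retract hC ⟨x, y, hxy.symm.trans (sub_zero _)⟩

lemma toSg_distinguished {S : ShortComplex A} (hS : S.ShortExact) :
    ∃ δ, Triangle.mk ((toSg A).map S.f) ((toSg A).map S.g) δ ∈ distTriang (SingularityCategory A) := by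
  let d : DerivedCategory.Bounded.ι.obj ((single A).obj S.X₃) ⟶
    (DerivedCategory.Bounded.ι.obj ((single A).obj S.X₁))⟦(1 : ℤ)⟧ := hS.singleδ
  let c := (DerivedCategory.Bounded.ι.commShiftIso (1 : ℤ)).app ((single A).obj S.X₁)
  let T : Triangle (DerivedCategory.Bounded A) := Triangle.mk ((single A).map S.f) ((single A).map S.g)
    (DerivedCategory.Bounded.ι.preimage (d ≫ c.inv))
  have hT : T ∈ distTriang _ := by
    rw [← DerivedCategory.Bounded.ι.map_distinguished_iff]
    refine isomorphic_distinguished _ hS.singleTriangle_distinguished _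
      (Triangle.isoMk _ _ (Iso.refl _) (Iso.refl _) (Iso.refl _) ?_ ?_ ?_)
    · exact (Category.comp_id _).trans (Category.id_comp _).symm
    · exact (Category.comp_id _).trans (Category.id_comp _).symm
    · have h : (DerivedCategory.Bounded.ι.map (DerivedCategory.Bounded.ι.preimage (d ≫ c.inv)) ≫
          c.hom) ≫ (𝟙 (DerivedCategory.Bounded.ι.obj ((single A).obj S.X₁)))⟦(1 : ℤ)⟧' =
          𝟙 _ ≫ d := by
        rw [Functor.map_preimage, CategoryTheory.Functor.map_id]
        exact (Category.comp_id _).trans ((Category.assoc _ _ _).trans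
          ((congr_arg (d ≫ ·) c.inv_hom_id).trans
            ((Category.comp_id d).trans (Category.id_comp d).symm)))
      exact h
  exact ⟨_, (Qsg A).map_distinguished _ hT⟩

lemma isZero_toSg_X₁ {S : ShortComplex A} (hS : S.ShortExact) (h : IsIso ((toSg A).map S.g)) :
    IsZero ((toSg A).obj S.X₁) := by
  obtain ⟨δ, hT⟩ := toSg_distinguished hS
  exact (Triangle.isZero₁_iff_isIso₂ _ hT).2 h

lemma isZero_toSg_obj_of_hasProjectiveDimensionLE [EnoughProjectives A] {X : A} {d : ℕ}
    (hX : HasProjectiveDimensionLE X d) : IsZero ((toSg A).obj X) :=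
  isZero_Qsg_obj _ (perfectObjects_of_hasProjectiveDimensionLE d X hX 0)

end Singularity

end CleftGP

namespace CleftGP
open Pretriangulated HomologicalComplex

/-! ### The long exact homology sequence of a mapping cone -/

section MappingCone

variable {A : Type u} [Category.{v} A] [Abelian A] {K L : CochainComplex A ℤ} (φ : K ⟶ L)

attribute [local instance] HasDerivedCategory.standard

lemma mono_homologyMap_of_exactAt_mappingCone (n m : ℤ) (hm : n + 1 = m)
    (h : (CochainComplex.mappingCone φ).ExactAt n) : Mono (homologyMap φ m) :=
  (CochainComplex.homologyMap_exact₁_of_distTriang (CochainComplex.mappingCone.triangle φ)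
    (DerivedCategory.mappingCone_triangle_distinguished φ) n m hm).mono_g
      (IsZero.eq_of_src h.isZero_homology _ _)

lemma exactAt_mappingCone_of_mono (n m : ℤ) (hm : n + 1 = m) (hL : L.ExactAt n)
    [Mono (homologyMap φ m)] : (CochainComplex.mappingCone φ).ExactAt n := by
  have hT := DerivedCategory.mappingCone_triangle_distinguished φ
  have h₃ := CochainComplex.homologyMap_exact₃_of_distTriang (CochainComplex.mappingCone.triangle φ)
    hT n m hm
  have hδ : CochainComplex.homologyδOfTriangle (CochainComplex.mappingCone.triangle φ) n m hm = 0 := by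
    have : Mono (homologyMap (CochainComplex.mappingCone.triangle φ).mor₁ m) :=
      inferInstanceAs (Mono (homologyMap φ m))
    rw [← cancel_mono (homologyMap (CochainComplex.mappingCone.triangle φ).mor₁ m),
      CochainComplex.homologyδOfTriangle_homologyMap _ hT n m hm, zero_comp]
  rw [exactAt_iff_isZero_homology]
  exact h₃.isZero_X₂ (IsZero.eq_of_src hL.isZero_homology _ _) hδ

lemma exactAt_of_mappingCone₁ (n m : ℤ) (hm : n + 1 = m)
    (h : (CochainComplex.mappingCone φ).ExactAt n) (hL : L.ExactAt m) : K.ExactAt m := by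
  have := mono_homologyMap_of_exactAt_mappingCone φ n m hm h
  rw [exactAt_iff_isZero_homology]
  exact IsZero.of_mono (homologyMap φ m) hL.isZero_homology

lemma exactAt_of_mappingCone₂ (n : ℤ) (hK : K.ExactAt n)
    (h : (CochainComplex.mappingCone φ).ExactAt n) : L.ExactAt n := by
  rw [exactAt_iff_isZero_homology]
  exact (CochainComplex.homologyMap_exact₂_of_distTriang (CochainComplex.mappingCone.triangle φ)
    (DerivedCategory.mappingCone_triangle_distinguished φ) n).isZero_X₂
      (IsZero.eq_of_src hK.isZero_homology _ _) (IsZero.eq_of_tgt h.isZero_homology _ _)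

lemma exactAt_mappingCone (n m : ℤ) (hm : n + 1 = m) (hL : L.ExactAt n) (hK : K.ExactAt m) :
    (CochainComplex.mappingCone φ).ExactAt n := by
  have : Mono (homologyMap φ m) := ⟨fun _ _ _ => IsZero.eq_of_tgt hK.isZero_homology _ _⟩
  exact exactAt_mappingCone_of_mono φ n m hm hL

end MappingCone

/-! ### Left derived functors through K-projective complexes -/

section LeftDerived

variable {A : Type u₁} [Category.{v₁} A] [Abelian A] {B : Type u₂} [Category.{v₂} B] [Abelian B]
  (T : A ⥤ B) [T.Additive]

/-- The functor induced on cochain complexes. -/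
abbrev mapC : CochainComplex A ℤ ⥤ CochainComplex B ℤ :=
  T.mapHomologicalComplex (ComplexShape.up ℤ)

lemma isStrictlyLE_mapC (K : CochainComplex A ℤ) (b : ℤ) [K.IsStrictlyLE b] :
    ((mapC T).obj K).IsStrictlyLE b := by
  rw [CochainComplex.isStrictlyLE_iff]
  exact fun i hi => T.map_isZero (K.isZero_of_isStrictlyLE b i hi)

lemma isStrictlyGE_mapC (K : CochainComplex A ℤ) (b : ℤ) [K.IsStrictlyGE b] :
    ((mapC T).obj K).IsStrictlyGE b := by
  rw [CochainComplex.isStrictlyGE_iff]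
  exact fun i hi => T.map_isZero (K.isZero_of_isStrictlyGE b i hi)

/-- Quasi-isomorphisms between K-projective complexes are homotopy equivalences, which every
additive functor preserves. -/
lemma quasiIso_mapC {K L : CochainComplex A ℤ} [K.IsKProjective] [L.IsKProjective] (φ : K ⟶ L)
    [QuasiIso φ] : QuasiIso ((mapC T).map φ) := by
  obtain ⟨e, rfl⟩ := (CochainComplex.IsKProjective.quasiIso_iff φ).1 inferInstance
  have : QuasiIso (T.mapHomotopyEquiv e).hom := inferInstance
  exact this

lemma quasiIso_of_isIso_Q [HasDerivedCategory.{w} A] {K L : CochainComplex A ℤ} (φ : K ⟶ L)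
    (h : IsIso (DerivedCategory.Q.map φ)) : QuasiIso φ :=
  (DerivedCategory.isIso_Q_map_iff_quasiIso _ φ).1 h

lemma exactAt_iff_of_quasiIso {K L : CochainComplex A ℤ} (φ : K ⟶ L) [QuasiIso φ] (n : ℤ) :
    K.ExactAt n ↔ L.ExactAt n := by
  rw [exactAt_iff_isZero_homology, exactAt_iff_isZero_homology]
  exact (asIso (homologyMap φ n)).isZero_iff

lemma exactAt_mapC_iff [HasDerivedCategory.{w} A] {K L : CochainComplex A ℤ} [K.IsKProjective]
    [L.IsKProjective] (e : DerivedCategory.Q.obj K ≅ DerivedCategory.Q.obj L) (n : ℤ) :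
    ((mapC T).obj K).ExactAt n ↔ ((mapC T).obj L).ExactAt n := by
  obtain ⟨φ, hφ⟩ := exists_Q_map_eq e.hom
  have := quasiIso_of_isIso_Q φ (by rw [hφ]; infer_instance)
  have := quasiIso_mapC T φ
  exact exactAt_iff_of_quasiIso ((mapC T).map φ) n

lemma isZero_leftDerived_iff_exactAt_cochainComplex [HasProjectiveResolutions A] {X : A}
    (R : ProjectiveResolution X) (i : ℕ) : IsZero ((T.leftDerived (i + 1)).obj X) ↔
      ((mapC T).obj R.cochainComplex).ExactAt (-(i + 1 : ℕ)) := by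
  rw [(R.isoLeftDerivedObj T (i + 1)).isZero_iff]
  change IsZero (((T.mapHomologicalComplex _).obj R.complex).homology (i + 1)) ↔ _
  rw [← exactAt_iff_isZero_homology, exactAt_iff' _ (i + 2) (i + 1) i (by simp) (by simp),
    exactAt_iff' _ (-((i + 2 : ℕ) : ℤ)) (-((i + 1 : ℕ) : ℤ)) (-(i : ℤ)) (by simp; lia) (by simp)]
  refine (ShortComplex.exact_iff_of_iso (ShortComplex.isoMk
    (T.mapIso (R.cochainComplexXIso _ (i + 2))) (T.mapIso (R.cochainComplexXIso _ (i + 1)))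
    (T.mapIso (R.cochainComplexXIso _ i)) ?_ ?_)).symm
  · have := R.cochainComplex_d (-((i + 2 : ℕ) : ℤ)) (-((i + 1 : ℕ) : ℤ)) (i + 2) (i + 1)
    exact (T.map_comp _ _).symm.trans ((congr_arg T.map (by rw [this]; simp)).trans (T.map_comp _ _))
  · have := R.cochainComplex_d (-((i + 1 : ℕ) : ℤ)) (-(i : ℤ)) (i + 1) i
    exact (T.map_comp _ _).symm.trans ((congr_arg T.map (by rw [this]; simp)).trans (T.map_comp _ _))

instance isIso_Q_map_π' [HasDerivedCategory.{w} A] {X : A} (R : ProjectiveResolution X) :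
    IsIso (DerivedCategory.Q.map R.π') :=
  (DerivedCategory.isIso_Q_map_iff_quasiIso _ _).2 inferInstance

/-- A projective resolution is isomorphic to the resolved object in the derived category. -/
noncomputable def isoQCochainComplex [HasDerivedCategory.{w} A] {X : A} (R : ProjectiveResolution X) :
    DerivedCategory.Q.obj R.cochainComplex ≅ (DerivedCategory.singleFunctor A 0).obj X :=
  @asIso _ _ _ _ (DerivedCategory.Q.map R.π') (isIso_Q_map_π' R)

instance {X : A} (R : ProjectiveResolution X) : R.cochainComplex.IsKProjective :=
  CochainComplex.isKProjective_of_projective _ 0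

lemma isZero_leftDerived_iff [EnoughProjectives A] [HasDerivedCategory.{w} A] {X : A}
    (K : CochainComplex A ℤ) [K.IsKProjective]
    (e : DerivedCategory.Q.obj K ≅ (DerivedCategory.singleFunctor A 0).obj X) (i : ℕ) :
    IsZero ((T.leftDerived (i + 1)).obj X) ↔ ((mapC T).obj K).ExactAt (-(i + 1 : ℕ)) := by
  rw [isZero_leftDerived_iff_exactAt_cochainComplex T (projectiveResolution X)]
  exact exactAt_mapC_iff T (isoQCochainComplex _ ≪≫ e.symm) _

section

variable {S : ShortComplex A} (hS : S.ShortExact) {R₁ : ProjectiveResolution S.X₁}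
  {R₂ : ProjectiveResolution S.X₂} (φ : ProjectiveResolution.Hom R₁ R₂ S.f)

include hS in
lemma nonempty_iso_Q_mappingCone [HasDerivedCategory.{w} A] :
    Nonempty (DerivedCategory.Q.obj (CochainComplex.mappingCone φ.hom') ≅
      (DerivedCategory.singleFunctor A 0).obj S.X₃) := by
  obtain ⟨e, -, -⟩ := exists_iso_of_arrow_iso (C := DerivedCategory A) _ _
    (DerivedCategory.mappingCone_triangle_distinguished (C := A) φ.hom')
    hS.singleTriangle_distinguished
    (Arrow.isoMk (isoQCochainComplex R₁) (isoQCochainComplex R₂) (by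
      exact (DerivedCategory.Q.map_comp _ _).symm.trans
        ((congr_arg DerivedCategory.Q.map φ.hom'_comp_π'.symm).trans (DerivedCategory.Q.map_comp _ _))))
  exact ⟨Triangle.π₃.mapIso e⟩

instance : (CochainComplex.mappingCone φ.hom').IsKProjective := by
  have := isStrictlyLE_mappingCone φ.hom' 0 (isStrictlyLE_mono _ zero_le_one inferInstance)
    inferInstance
  have (n : ℤ) := projective_mappingCone_X φ.hom' n inferInstance inferInstance
  exact CochainComplex.isKProjective_of_projective _ 0

include hS in
-- The cone of a lift of `S.f` to projective resolutions is a K-projective model of `S.X₃`, and `T`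
-- commutes with cones. The long exact sequence of derived functors thus becomes that of a mapping
-- cone, without a horseshoe lemma.
lemma isZero_leftDerived_X₃_iff [EnoughProjectives A] (i : ℕ) :
    IsZero ((T.leftDerived (i + 1)).obj S.X₃) ↔
      (CochainComplex.mappingCone ((mapC T).map φ.hom')).ExactAt (-(i + 1 : ℕ)) := by
  let := HasDerivedCategory.standard A
  obtain ⟨e⟩ := nonempty_iso_Q_mappingCone hS φ
  rw [isZero_leftDerived_iff T _ e]
  exact exactAt_iff_of_quasiIso (CochainComplex.mappingCone.mapHomologicalComplexIso φ.hom' T).hom _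

end

/-- The degree zero part of the augmentation of a projective resolution. -/
noncomputable def augmentationZero {X : A} (R : ProjectiveResolution X) : R.complex.X 0 ⟶ X :=
  R.π.f 0

instance {X : A} (R : ProjectiveResolution X) : Epi (augmentationZero R) :=
  inferInstanceAs (Epi (R.π.f 0))

lemma hom_comp_augmentationZero {X Y : A} {f : X ⟶ Y} {R : ProjectiveResolution X}
    {R' : ProjectiveResolution Y} (φ : ProjectiveResolution.Hom R R' f) :
    φ.hom.f 0 ≫ augmentationZero R' = augmentationZero R ≫ f :=
  φ.hom_f_zero_comp_π_f_zero.trans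
    (congr_arg (augmentationZero R ≫ ·) (ChainComplex.single₀_map_f_zero f))

lemma d_comp_augmentationZero {X : A} (R : ProjectiveResolution X) :
    R.complex.d 1 0 ≫ augmentationZero R = 0 := R.complex_d_comp_π_f_zero

/-- The augmentation of a projective resolution. -/
noncomputable def augmentation {X : A} (R : ProjectiveResolution X) : R.cochainComplex.X 0 ⟶ X :=
  (R.cochainComplexXIso 0 0).hom ≫ augmentationZero R

instance {X : A} (R : ProjectiveResolution X) : Epi (augmentation R) := epi_comp _ _

/-- The degree zero part of a complex concentrated in degree zero. -/
noncomputable def singleXZero (X : A) : ((CochainComplex.singleFunctor A 0).obj X).X 0 ≅ X :=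
  HomologicalComplex.singleObjXSelf (.up ℤ) 0 X

lemma π'_f_zero_comp {X : A} (R : ProjectiveResolution X) :
    R.π'.f 0 ≫ (singleXZero X).hom = augmentation R := by
  have h : R.π'.f 0 = augmentation R ≫ (singleXZero X).inv :=
    R.π'_f_zero.trans (Category.assoc _ _ _).symm
  rw [h, Category.assoc, Iso.inv_hom_id, Category.comp_id]

lemma hom'_f_zero_comp_augmentation {X Y : A} {f : X ⟶ Y} {R : ProjectiveResolution X}
    {R' : ProjectiveResolution Y} (φ : ProjectiveResolution.Hom R R' f) :
    φ.hom'.f 0 ≫ augmentation R' = augmentation R ≫ f := by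
  rw [φ.hom'_f 0 0 rfl, augmentation, augmentation, Category.assoc, Category.assoc, Category.assoc,
    Iso.inv_hom_id_assoc, hom_comp_augmentationZero]

lemma d_comp_augmentation {X : A} (R : ProjectiveResolution X) :
    R.cochainComplex.d (-1) 0 ≫ augmentation R = 0 := by
  rw [R.cochainComplex_d (-1) 0 1 0, augmentation, Category.assoc, Category.assoc,
    Iso.inv_hom_id_assoc, d_comp_augmentationZero, comp_zero]

lemma augmentation_exact {X : A} (R : ProjectiveResolution X) :
    (ShortComplex.mk _ _ (d_comp_augmentation R)).Exact := by
  have h₁ : (R.cochainComplexXIso (-1) 1).hom ≫ R.complex.d 1 0 =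
      R.cochainComplex.d (-1) 0 ≫ (R.cochainComplexXIso 0 0).hom := by
    rw [R.cochainComplex_d (-1) 0 1 0, Category.assoc, Category.assoc, Iso.inv_hom_id,
      Category.comp_id]
  let e : ShortComplex.mk _ _ (d_comp_augmentation R) ≅
      ShortComplex.mk _ _ (d_comp_augmentationZero R) :=
    ShortComplex.isoMk (R.cochainComplexXIso (-1) 1) (R.cochainComplexXIso 0 0) (Iso.refl X) h₁
      (Category.comp_id _).symm
  exact (ShortComplex.exact_iff_of_iso e).2 R.exact₀

/-- A lift of a morphism to projective resolutions. -/
noncomputable def resolutionHom [EnoughProjectives A] {X Y : A} (f : X ⟶ Y) :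
    ProjectiveResolution.Hom (projectiveResolution X) (projectiveResolution Y) f where
  hom := ProjectiveResolution.lift f _ _
  hom_f_zero_comp_π_f_zero := by
    rw [ProjectiveResolution.lift_commutes_zero, ChainComplex.single₀_map_f_zero]
    rfl

variable [EnoughProjectives A] {S : ShortComplex A} (hS : S.ShortExact)

include hS in
lemma isZero_leftDerived_X₁ (i : ℕ) (h₃ : IsZero ((T.leftDerived (i + 2)).obj S.X₃))
    (h₂ : IsZero ((T.leftDerived (i + 1)).obj S.X₂)) :
    IsZero ((T.leftDerived (i + 1)).obj S.X₁) := by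
  let φ := resolutionHom S.f
  rw [isZero_leftDerived_iff_exactAt_cochainComplex T (projectiveResolution _)] at h₂ ⊢
  rw [isZero_leftDerived_X₃_iff T hS φ] at h₃
  exact exactAt_of_mappingCone₁ _ _ _ (by lia) h₃ h₂

include hS in
lemma isZero_leftDerived_X₂ (i : ℕ) (h₁ : IsZero ((T.leftDerived (i + 1)).obj S.X₁))
    (h₃ : IsZero ((T.leftDerived (i + 1)).obj S.X₃)) :
    IsZero ((T.leftDerived (i + 1)).obj S.X₂) := by
  let φ := resolutionHom S.f
  rw [isZero_leftDerived_iff_exactAt_cochainComplex T (projectiveResolution _)] at h₁ ⊢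
  rw [isZero_leftDerived_X₃_iff T hS φ] at h₃
  exact exactAt_of_mappingCone₂ _ _ h₁ h₃

include hS in
lemma isZero_leftDerived_X₃ (i : ℕ) (h₂ : IsZero ((T.leftDerived (i + 2)).obj S.X₂))
    (h₁ : IsZero ((T.leftDerived (i + 1)).obj S.X₁)) :
    IsZero ((T.leftDerived (i + 2)).obj S.X₃) := by
  let φ := resolutionHom S.f
  rw [isZero_leftDerived_iff_exactAt_cochainComplex T (projectiveResolution _)] at h₁ h₂
  rw [isZero_leftDerived_X₃_iff T hS φ]
  exact exactAt_mappingCone _ _ _ (by lia) h₂ h₁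

variable [PreservesFiniteColimits T]

omit [EnoughProjectives A] in
-- A right exact `T` preserves the cokernel presenting `X`. In the top degree of a complex, opcycles
-- agree with homology, so this identifies `H^0` of the image of the resolution with `T X`.
lemma exists_opcycles_iso {X : A} (R : ProjectiveResolution X) :
    ∃ e : ((mapC T).obj R.cochainComplex).opcycles 0 ≅ T.obj X,
      ((mapC T).obj R.cochainComplex).pOpcycles 0 ≫ e.hom =
        T.map (augmentation R) := by
  have hc := (augmentation_exact R).gIsCokernel
  have hc' := (CokernelCofork.mapIsColimit _ hc T)
  have h₀ := ((mapC T).obj R.cochainComplex).opcyclesIsCokernel (-1) 0 (by simp)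
  refine ⟨h₀.coconePointUniqueUpToIso hc', ?_⟩
  exact h₀.comp_coconePointUniqueUpToIso_hom hc' WalkingParallelPair.one

omit [EnoughProjectives A] [PreservesFiniteColimits T] in
lemma exists_opcycles_single_iso (X : A) :
    ∃ e : ((mapC T).obj ((CochainComplex.singleFunctor A 0).obj X)).opcycles 0 ≅ T.obj X,
      ((mapC T).obj ((CochainComplex.singleFunctor A 0).obj X)).pOpcycles 0 ≫ e.hom =
        T.map (singleXZero X).hom := by
  have := ((mapC T).obj ((CochainComplex.singleFunctor A 0).obj X)).isIso_pOpcycles (-1) 0 (by simp)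
    (((T.map_isZero (HomologicalComplex.isZero_single_obj_X _ _ _ _ (by lia)))).eq_of_src _ _)
  refine ⟨(asIso (((mapC T).obj ((CochainComplex.singleFunctor A 0).obj X)).pOpcycles 0)).symm ≪≫
    T.mapIso (singleXZero X), ?_⟩
  exact IsIso.hom_inv_id_assoc
    (((mapC T).obj ((CochainComplex.singleFunctor A 0).obj X)).pOpcycles 0) _

omit [EnoughProjectives A] in
lemma mono_opcyclesMap_iff {X Y : A} {f : X ⟶ Y} {R : ProjectiveResolution X}
    {R' : ProjectiveResolution Y} (φ : ProjectiveResolution.Hom R R' f) :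
    Mono (opcyclesMap ((mapC T).map φ.hom') 0) ↔ Mono (T.map f) := by
  obtain ⟨e, he⟩ := exists_opcycles_iso T R
  obtain ⟨e', he'⟩ := exists_opcycles_iso T R'
  have h : opcyclesMap ((mapC T).map φ.hom') 0 ≫ e'.hom = e.hom ≫ T.map f := by
    rw [← cancel_epi (((mapC T).obj R.cochainComplex).pOpcycles 0), p_opcyclesMap_assoc, he',
      reassoc_of% he]
    exact (T.map_comp _ _).symm.trans
      ((congr_arg T.map (hom'_f_zero_comp_augmentation φ)).trans (T.map_comp _ _))
  exact (MorphismProperty.monomorphisms B).arrow_mk_iso_iff (Arrow.isoMk e e' h.symm)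

lemma mono_homologyMap_iff_mono_opcyclesMap {K L : CochainComplex B ℤ} (φ : K ⟶ L) (n : ℤ)
    [K.IsStrictlyLE n] [L.IsStrictlyLE n] : Mono (homologyMap φ n) ↔ Mono (opcyclesMap φ n) := by
  have h₁ := K.isIso_homologyι n (n + 1) (by simp)
    ((K.isZero_of_isStrictlyLE n (n + 1) (by lia)).eq_of_tgt _ _)
  have h₂ := L.isIso_homologyι n (n + 1) (by simp)
    ((L.isZero_of_isStrictlyLE n (n + 1) (by lia)).eq_of_tgt _ _)
  exact (MorphismProperty.monomorphisms B).arrow_mk_iso_iff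
    (Arrow.isoMk (asIso (K.homologyι n)) (asIso (L.homologyι n)) (by simp))

omit [EnoughProjectives A] in
lemma mono_homologyMap_iff {X Y : A} {f : X ⟶ Y} {R : ProjectiveResolution X}
    {R' : ProjectiveResolution Y} (φ : ProjectiveResolution.Hom R R' f) :
    Mono (homologyMap ((mapC T).map φ.hom') 0) ↔ Mono (T.map f) := by
  have := isStrictlyLE_mapC T R.cochainComplex 0
  have := isStrictlyLE_mapC T R'.cochainComplex 0
  rw [mono_homologyMap_iff_mono_opcyclesMap, mono_opcyclesMap_iff]

include hS in
-- This is the end `L_1 T X₃ ⟶ T X₁ ⟶ T X₂` of the long exact sequence.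
lemma mono_map_of_isZero_leftDerived (h : IsZero ((T.leftDerived 1).obj S.X₃)) :
    Mono (T.map S.f) := by
  rw [isZero_leftDerived_X₃_iff T hS (resolutionHom S.f) 0] at h
  rw [← mono_homologyMap_iff T (resolutionHom S.f)]
  exact mono_homologyMap_of_exactAt_mappingCone _ _ _ (by simp) h

include hS in
lemma isZero_leftDerived_one_of_mono (h₂ : IsZero ((T.leftDerived 1).obj S.X₂))
    [hf : Mono (T.map S.f)] : IsZero ((T.leftDerived 1).obj S.X₃) := by
  rw [isZero_leftDerived_iff_exactAt_cochainComplex T (projectiveResolution _) 0] at h₂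
  rw [isZero_leftDerived_X₃_iff T hS (resolutionHom S.f) 0]
  rw [← mono_homologyMap_iff T (resolutionHom S.f)] at hf
  exact exactAt_mappingCone_of_mono _ _ 0 (by simp) h₂

/-- The image under a right exact functor of a projective resolution of an acyclic object is
quasi-isomorphic to the image of this object. -/
lemma quasiIso_map_π' {X : A} (R : ProjectiveResolution X)
    (hX : ∀ i, IsZero ((T.leftDerived (i + 1)).obj X)) : QuasiIso ((mapC T).map R.π') := by
  refine ⟨fun n => ?_⟩
  have h₁ := isStrictlyLE_mapC T R.cochainComplex 0
  have h₂ := isStrictlyLE_mapC T ((CochainComplex.singleFunctor A 0).obj X) 0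
  by_cases hn : n = 0
  · subst hn
    rw [quasiIsoAt_iff_isIso_homologyMap]
    obtain ⟨e, he⟩ := exists_opcycles_iso T R
    obtain ⟨e', he'⟩ := exists_opcycles_single_iso T X
    have h : opcyclesMap ((mapC T).map R.π') 0 ≫ e'.hom = e.hom := by
      rw [← cancel_epi (((mapC T).obj R.cochainComplex).pOpcycles 0), p_opcyclesMap_assoc, he', he]
      exact (T.map_comp _ _).symm.trans (congr_arg T.map (π'_f_zero_comp R))
    have h₁ := ((mapC T).obj R.cochainComplex).isIso_homologyι 0 1 (by simp)
      ((CochainComplex.isZero_of_isStrictlyLE _ 0 1 (by lia)).eq_of_tgt _ _)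
    have h₂ := ((mapC T).obj ((CochainComplex.singleFunctor A 0).obj X)).isIso_homologyι 0 1 (by simp)
      ((CochainComplex.isZero_of_isStrictlyLE _ 0 1 (by lia)).eq_of_tgt _ _)
    have h₃ : IsIso (opcyclesMap ((mapC T).map R.π') 0) := by
      rw [show opcyclesMap ((mapC T).map R.π') 0 = e.hom ≫ e'.inv by rw [← h]; simp]
      infer_instance
    have h₄ := homologyι_naturality ((mapC T).map R.π') 0
    rw [← IsIso.eq_comp_inv] at h₄
    rw [h₄]
    infer_instance
  · have h₃ : ((mapC T).obj ((CochainComplex.singleFunctor A 0).obj X)).ExactAt n :=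
      ShortComplex.exact_of_isZero_X₂ _
        (T.map_isZero (HomologicalComplex.isZero_single_obj_X _ _ _ _ hn))
    rw [quasiIsoAt_iff_exactAt' _ _ h₃]
    by_cases hn' : 0 < n
    · exact ShortComplex.exact_of_isZero_X₂ _
        (((mapC T).obj R.cochainComplex).isZero_of_isStrictlyLE 0 n hn')
    · obtain ⟨i, rfl⟩ : ∃ i : ℕ, n = -((i + 1 : ℕ) : ℤ) := ⟨(-n - 1).toNat, by lia⟩
      exact (isZero_leftDerived_iff_exactAt_cochainComplex T R i).1 (hX i)

end LeftDerived

end CleftGP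

namespace CleftGP
open Pretriangulated HomologicalComplex ZeroObject

/-! ### Bounded above complexes of projectives as a model of the bounded derived category -/

section Resolutions

variable (A : Type u) [Category.{v} A] [Abelian A] [HasDerivedCategory.{w} A]

/-- The objects of the derived category which are isomorphic to bounded above complexes of
projective objects. -/
def projectiveMinusObjects : ObjectProperty (DerivedCategory A) := fun X =>
  ∃ (K : CochainComplex A ℤ) (b : ℤ), K.IsStrictlyLE b ∧
    (∀ n : ℤ, Projective (K.X n)) ∧ Nonempty (DerivedCategory.Q.obj K ≅ X)

variable {A}

instance : (projectiveMinusObjects A).IsClosedUnderIsomorphisms where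
  of_iso := by
    rintro X Y e ⟨K, b, h₂, h₃, ⟨f⟩⟩
    exact ⟨K, b, h₂, h₃, ⟨f ≪≫ e⟩⟩

instance : (projectiveMinusObjects A).IsStableUnderShift ℤ where
  isStableUnderShiftBy n := ⟨by
    rintro X ⟨K, b, h₂, h₃, ⟨f⟩⟩
    refine ⟨K⟦n⟧, b - n, K.isStrictlyLE_shift b n _ (by lia),
      fun i => h₃ (i + n), ⟨(DerivedCategory.Q.commShiftIso n).app K ≪≫
        (shiftFunctor _ n).mapIso f⟩⟩⟩

instance : (projectiveMinusObjects A).ContainsZero where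
  exists_zero := by
    obtain ⟨K, a, b, h₁, h₂, h₃, h₄⟩ := perfectObjects_of_isZero (isZero_zero (DerivedCategory A))
    exact ⟨0, isZero_zero _, K, b, h₂, h₃, h₄⟩

instance : (projectiveMinusObjects A).IsTriangulatedClosed₃ := .mk' (by
  rintro T hT ⟨K, b, h₂, h₃, ⟨e⟩⟩ ⟨K', b', h₂', h₃', ⟨e'⟩⟩
  have := CochainComplex.isKProjective_of_projective K b
  obtain ⟨φ, hφ⟩ := exists_Q_map_eq (e.hom ≫ T.mor₁ ≫ e'.inv)
  obtain ⟨f, -, -⟩ := exists_iso_of_arrow_iso _ _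
    (DerivedCategory.mappingCone_triangle_distinguished φ) hT
    (Arrow.isoMk e e' (by
      change e.hom ≫ T.mor₁ = DerivedCategory.Q.map φ ≫ e'.hom
      simp [hφ]))
  exact ⟨CochainComplex.mappingCone φ, max b b',
    isStrictlyLE_mappingCone φ _ (isStrictlyLE_mono K (by lia) h₂) (isStrictlyLE_mono K' (by lia) h₂'),
    fun n => projective_mappingCone_X φ n (h₃ _) (h₃' _), ⟨Triangle.π₃.mapIso f⟩⟩)

instance : (projectiveMinusObjects A).IsTriangulated where
  toIsTriangulatedClosed₂ := .of_isTriangulatedClosed₃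

lemma projectiveMinusObjects_singleFunctor [EnoughProjectives A] (X : A) (n : ℤ) :
    projectiveMinusObjects A ((DerivedCategory.singleFunctor A n).obj X) := by
  have h : projectiveMinusObjects A ((DerivedCategory.singleFunctor A 0).obj X) :=
    ⟨(projectiveResolution X).cochainComplex, 0, inferInstance, inferInstance,
      ⟨isoQCochainComplex _⟩⟩
  exact (projectiveMinusObjects A).prop_of_iso
    (((DerivedCategory.singleFunctors A).shiftIso (-n) n 0 (by lia)).app X)
    ((projectiveMinusObjects A).le_shift (-n) _ h)

lemma projectiveMinusObjects_of_bounded [EnoughProjectives A] (X : DerivedCategory.Bounded A) :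
    projectiveMinusObjects A X.obj := by
  obtain ⟨X, ⟨a, ha⟩, ⟨b, hb⟩⟩ := X
  have : X.IsGE a := ha
  have : X.IsLE b := hb
  obtain ⟨K, h₁, h₂, ⟨e⟩⟩ := DerivedCategory.exists_iso_Q_obj_of_isGE_of_isLE X a b
  exact (projectiveMinusObjects A).prop_of_iso e.symm
    (prop_Q_obj_of_bounded _ a b K (fun n _ _ => projectiveMinusObjects_singleFunctor _ n))

omit [HasDerivedCategory.{w} A] in
lemma isKProjective_of_projMinusBounded {K : HomotopyCategory A (ComplexShape.up ℤ)}
    (hK : projMinusBounded A K) : CochainComplex.IsKProjective K.as := by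
  obtain ⟨h, ⟨b, hb⟩, -⟩ := hK
  have : CochainComplex.IsStrictlyLE K.as b := hb
  exact CochainComplex.isKProjective_of_projective (C := A) K.as b

instance : (projToDb A).Faithful where
  map_injective {K L} f g h := by
    have := isKProjective_of_projMinusBounded K.property
    apply ObjectProperty.hom_ext
    exact (CochainComplex.IsKProjective.Qh_map_bijective K.obj.as L.obj).1
      (congr_arg (fun k => k.hom) h)

instance : (projToDb A).Full where
  map_surjective {K L} f := by
    have := isKProjective_of_projMinusBounded K.property
    obtain ⟨g, hg⟩ := (CochainComplex.IsKProjective.Qh_map_bijective K.obj.as L.obj).2 f.hom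
    exact ⟨ObjectProperty.homMk g, ObjectProperty.hom_ext _ hg⟩

/-- A bounded above complex of projective objects with bounded cohomology, as an object of
`projMinusBounded`. -/
def projMinusBoundedMk (K : CochainComplex A ℤ) (a b : ℤ) (hb : K.IsStrictlyLE b) (ha : K.IsGE a)
    (hK : ∀ n, Projective (K.X n)) : (projMinusBounded A).FullSubcategory :=
  ⟨(HomotopyCategory.quotient _ _).obj K, hK, ⟨b, hb⟩, ⟨a, ha⟩⟩

/-- The image in the derived category of a complex of projective objects. -/
noncomputable def projToDbMkIso (K : CochainComplex A ℤ) (a b : ℤ) (hb : K.IsStrictlyLE b)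
    (ha : K.IsGE a) (hK : ∀ n, Projective (K.X n)) :
    ((projToDb A).obj (projMinusBoundedMk K a b hb ha hK)).obj ≅ DerivedCategory.Q.obj K :=
  (DerivedCategory.quotientCompQhIso A).app K

lemma exists_projToDb_iso [EnoughProjectives A] (X : DerivedCategory.Bounded A) :
    ∃ (K : CochainComplex A ℤ) (a b : ℤ) (hb : K.IsStrictlyLE b) (ha : K.IsGE a)
      (hK : ∀ n, Projective (K.X n)),
      Nonempty ((projToDb A).obj (projMinusBoundedMk K a b hb ha hK) ≅ X) := by
  obtain ⟨K, b, hb, hK, ⟨e⟩⟩ := projectiveMinusObjects_of_bounded X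
  obtain ⟨a, ha⟩ := X.property.1
  have ha' : K.IsGE a := by
    rw [← DerivedCategory.isGE_Q_obj_iff]
    exact DerivedCategory.TStructure.t.isGE_of_iso e.symm a
  exact ⟨K, a, b, hb, ha', hK,
    ⟨DerivedCategory.Bounded.ι.preimageIso (projToDbMkIso K a b hb ha' hK ≪≫ e)⟩⟩

instance [EnoughProjectives A] : (projToDb A).EssSurj where
  mem_essImage X := by
    obtain ⟨K, a, b, hb, ha, hK, e⟩ := exists_projToDb_iso X
    exact ⟨_, e⟩

instance [EnoughProjectives A] : (projToDb A).IsEquivalence where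

end Resolutions

/-! ### The left derived functor on bounded derived and singularity categories -/

section LeftDerivedDb

variable {A : Type u₁} [Category.{v₁} A] [Abelian A] [HasDerivedCategory.{w₁} A]
  {B : Type u₂} [Category.{v₂} B] [Abelian B] [HasDerivedCategory.{w₂} B]
  (T : A ⥤ B) [T.Additive]

omit [HasDerivedCategory.{w₁} A] in
lemma exactAt_iff_of_isIso_f {K L : CochainComplex A ℤ} (φ : K ⟶ L) (n : ℤ)
    (h₁ : IsIso (φ.f (n - 1))) (h₂ : IsIso (φ.f n)) (h₃ : IsIso (φ.f (n + 1))) :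
    K.ExactAt n ↔ L.ExactAt n := by
  rw [exactAt_iff' _ (n - 1) n (n + 1) (by simp) (by simp),
    exactAt_iff' _ (n - 1) n (n + 1) (by simp) (by simp)]
  exact ShortComplex.exact_iff_of_iso (ShortComplex.isoMk (@asIso _ _ _ _ _ h₁)
    (@asIso _ _ _ _ _ h₂) (@asIso _ _ _ _ _ h₃) (φ.comm _ _) (φ.comm _ _))

omit [HasDerivedCategory.{w₁} A] in
lemma exactAt_shift_iff (K : CochainComplex A ℤ) (d n m : ℤ) (h : n + d = m) :
    (K⟦d⟧).ExactAt n ↔ K.ExactAt m := by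
  rw [exactAt_iff_isZero_homology, exactAt_iff_isZero_homology]
  exact (((HomologicalComplex.homologyFunctor A (.up ℤ) 0).shiftIso d n m (by lia)).app K).isZero_iff

omit [HasDerivedCategory.{w₁} A] [HasDerivedCategory.{w₂} B] in
lemma exactAt_mapC_shift_iff (K : CochainComplex A ℤ) (d n m : ℤ) (h : n + d = m) :
    ((mapC T).obj (K⟦d⟧)).ExactAt n ↔ ((mapC T).obj K).ExactAt m := by
  rw [← exactAt_shift_iff _ d n m h]
  exact exactAt_iff_of_quasiIso (((mapC T).commShiftIso d).hom.app K) n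

omit [HasDerivedCategory.{w₂} B] in
lemma isZero_leftDerived_iff_of_iso_singleFunctor [EnoughProjectives A] {X : A}
    (K : CochainComplex A ℤ) (b d : ℤ) [K.IsStrictlyLE b] [∀ n, Projective (K.X n)]
    (e : DerivedCategory.Q.obj K ≅ (DerivedCategory.singleFunctor A d).obj X) (i : ℕ) :
    IsZero ((T.leftDerived (i + 1)).obj X) ↔ ((mapC T).obj K).ExactAt (d - (i + 1 : ℕ)) := by
  have := K.isStrictlyLE_shift b d (b - d) (by lia)
  have (n : ℤ) : Projective ((K⟦d⟧).X n) := inferInstanceAs (Projective (K.X (n + d)))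
  have := CochainComplex.isKProjective_of_projective (K⟦d⟧) (b - d)
  rw [← exactAt_mapC_shift_iff T K d (-(i + 1 : ℕ)) _ (by lia)]
  exact isZero_leftDerived_iff T (K⟦d⟧) ((DerivedCategory.Q.commShiftIso d).app K ≪≫
    (shiftFunctor _ d).mapIso e ≪≫
      ((DerivedCategory.singleFunctors A).shiftIso d 0 d (by lia)).app X) i

omit [HasDerivedCategory.{w₂} B] in
/-- A functor whose left derived functors vanish in high degrees preserves complexes of projective
objects with bounded cohomology. -/
lemma isGE_mapC [EnoughProjectives A] (N : ℕ)
    (hN : ∀ p, N ≤ p → ∀ X, IsZero ((T.leftDerived (p + 1)).obj X))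
    (K : CochainComplex A ℤ) (a b : ℤ) [K.IsStrictlyLE b] [K.IsGE a] [∀ n, Projective (K.X n)] :
    ((mapC T).obj K).IsGE (a - 1 - N) := by
  -- Below degree `a` the complex is exact, so its brutal truncation resolves a single object `X`
  -- placed in degree `a - 1`.
  obtain ⟨L, p, hL, hp⟩ := exists_brutal_truncation K a (b + 1 - a).toNat
    (isStrictlyLE_mono (b := b) K (by lia) inferInstance)
  have hL' (n : ℤ) : Projective (L.X n) := by
    by_cases hn : n < a
    · have := hp n hn
      exact Projective.of_iso (asIso (p.f n)) inferInstance
    · exact (L.isZero_of_isStrictlyLE (a - 1) n (by lia)).projective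
  have : L.IsGE (a - 1) := by
    rw [CochainComplex.isGE_iff]
    intro i hi
    rw [← exactAt_iff_of_isIso_f p i (hp _ (by lia)) (hp _ (by lia)) (hp _ (by lia))]
    exact K.exactAt_of_isGE a i (by lia)
  obtain ⟨X, ⟨e⟩⟩ := DerivedCategory.exists_iso_singleFunctor_obj_of_isGE_of_isLE
    (DerivedCategory.Q.obj L) (a - 1)
  rw [CochainComplex.isGE_iff]
  intro i hi
  have := hp (i - 1) (by lia)
  have := hp i (by lia)
  have := hp (i + 1) (by lia)
  rw [exactAt_iff_of_isIso_f ((mapC T).map p) i (inferInstanceAs (IsIso (T.map (p.f _))))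
    (inferInstanceAs (IsIso (T.map (p.f _)))) (inferInstanceAs (IsIso (T.map (p.f _))))]
  -- The homology of `T L` in degree `i` is `L_(p+1) T X` with `p + 1 = a - 1 - i`, and `i < a - 1 -
  -- N` means `p ≥ N`.
  have h := (isZero_leftDerived_iff_of_iso_singleFunctor T L (a - 1) (a - 1) e (a - 1 - i - 1).toNat).1
    (hN _ (by lia) X)
  convert h using 1
  lia

variable [EnoughProjectives A]

lemma exists_isLeftDerivedDb (N : ℕ)
    (hN : ∀ p, N ≤ p → ∀ X, IsZero ((T.leftDerived (p + 1)).obj X)) :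
    ∃ LT : DerivedCategory.Bounded A ⥤ DerivedCategory.Bounded B, IsLeftDerivedDb T LT := by
  let G : (projMinusBounded A).FullSubcategory ⥤ DerivedCategory.Bounded B :=
    (DerivedCategory.TStructure.t (C := B)).bounded.lift
      ((projMinusBounded A).ι ⋙ T.mapHomotopyCategory (ComplexShape.up ℤ) ⋙ DerivedCategory.Qh) (by
        rintro ⟨⟨K⟩, hK, ⟨b, hb⟩, ⟨a, ha⟩⟩
        have : CochainComplex.IsStrictlyLE K b := hb
        have : CochainComplex.IsGE K a := ha
        have (n : ℤ) : Projective (K.X n) := hK n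
        have h₁ := isGE_mapC T N hN K a b
        have h₂ := isStrictlyLE_mapC T K b
        exact DerivedCategory.TStructure.t.bounded.prop_of_iso
          ((DerivedCategory.quotientCompQhIso B).symm.app ((mapC T).obj K))
          ⟨⟨a - 1 - N, inferInstance⟩, ⟨b, inferInstance⟩⟩)
  refine ⟨(projToDb A).inv ⋙ G, ⟨?_⟩⟩
  exact Functor.isoWhiskerRight ((projToDb A).asEquivalence.unitIso.symm)
    (G ⋙ DerivedCategory.Bounded.ι)

variable {T} {LT : DerivedCategory.Bounded A ⥤ DerivedCategory.Bounded B}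

omit [EnoughProjectives A] in
lemma nonempty_leftDerivedDb_obj_iso (h : IsLeftDerivedDb T LT) (K : CochainComplex A ℤ)
    (a b : ℤ) (hb : K.IsStrictlyLE b) (ha : K.IsGE a) (hK : ∀ n, Projective (K.X n)) :
    Nonempty ((LT.obj ((projToDb A).obj (projMinusBoundedMk K a b hb ha hK))).obj ≅
      DerivedCategory.Q.obj ((mapC T).obj K)) := by
  obtain ⟨e⟩ := h
  exact ⟨e.app _ ≪≫ (DerivedCategory.quotientCompQhIso B).app ((mapC T).obj K)⟩

omit [EnoughProjectives A] in
lemma nonempty_leftDerivedDb_map_iso (h : IsLeftDerivedDb T LT) {K L : CochainComplex A ℤ}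
    (a b : ℤ) (hb : K.IsStrictlyLE b) (ha : K.IsGE a) (hK : ∀ n, Projective (K.X n))
    (a' b' : ℤ) (hb' : L.IsStrictlyLE b') (ha' : L.IsGE a') (hL : ∀ n, Projective (L.X n))
    (f : (projToDb A).obj (projMinusBoundedMk K a b hb ha hK) ⟶
      (projToDb A).obj (projMinusBoundedMk L a' b' hb' ha' hL)) :
    ∃ φ : K ⟶ L, Nonempty (Arrow.mk f.hom ≅ Arrow.mk (DerivedCategory.Q.map φ)) ∧
      Nonempty (Arrow.mk (LT.map f).hom ≅ Arrow.mk (DerivedCategory.Q.map ((mapC T).map φ))) := by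
  obtain ⟨g, rfl⟩ := (projToDb A).map_surjective f
  obtain ⟨φ, hφ⟩ := (HomotopyCategory.quotient A (ComplexShape.up ℤ)).map_surjective g.hom
  obtain ⟨e⟩ := h
  refine ⟨φ, ⟨Arrow.isoMk ((DerivedCategory.quotientCompQhIso A).app K)
    ((DerivedCategory.quotientCompQhIso A).app L) ?_⟩, ⟨Arrow.isoMk
      (e.app _ ≪≫ (DerivedCategory.quotientCompQhIso B).app ((mapC T).obj K))
      (e.app _ ≪≫ (DerivedCategory.quotientCompQhIso B).app ((mapC T).obj L)) ?_⟩⟩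
  · have h := (DerivedCategory.quotientCompQhIso_hom_naturality φ).symm
    rw [hφ] at h
    exact h
  · have h₁ := e.hom.naturality g
    have h₂ := (DerivedCategory.quotientCompQhIso_hom_naturality ((mapC T).map φ)).symm
    have h₃ : (T.mapHomotopyCategory (ComplexShape.up ℤ)).map g.hom =
        (HomotopyCategory.quotient _ _).map ((mapC T).map φ) := by
      rw [← hφ]
      rfl
    rw [← h₃] at h₂
    exact (Category.assoc _ _ _).trans ((congr_arg (e.hom.app _ ≫ ·) h₂).trans
      ((Category.assoc _ _ _).symm.trans ((congr_arg (· ≫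
        (DerivedCategory.quotientCompQhIso B).hom.app _) h₁.symm).trans (Category.assoc _ _ _))))

omit [EnoughProjectives A] in
/-- The left derived functor preserves perfect complexes. -/
lemma perfectObjects_Q_mapC [EnoughProjectives B]
    (hT : ∀ P : A, Projective P → ∃ d, HasProjectiveDimensionLE (T.obj P) d)
    (K : CochainComplex A ℤ) [K.IsKProjective] (hK : perfectObjects A (DerivedCategory.Q.obj K)) :
    perfectObjects B (DerivedCategory.Q.obj ((mapC T).obj K)) := by
  obtain ⟨L, a, b, ha, hb, hL, ⟨e⟩⟩ := hK
  have := CochainComplex.isKProjective_of_projective L b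
  obtain ⟨φ, hφ⟩ := exists_Q_map_eq e.hom
  have := quasiIso_of_isIso_Q φ (by rw [hφ]; infer_instance)
  have := quasiIso_mapC T φ
  have := isStrictlyGE_mapC T L a
  have := isStrictlyLE_mapC T L b
  exact (perfectObjects B).prop_of_iso (asIso (DerivedCategory.Q.map ((mapC T).map φ)))
    (perfectObjects_Q_obj ((mapC T).obj L) a b (fun n => hT _ (hL n)))

/-- A single chain map `φ` between complexes of projectives models `f`, and its image under `T`
models `LT f`. The cone of the latter is `T` applied to the perfect cone of `φ`, hence perfect. -/
lemma isInvertedBy_leftDerivedDb [EnoughProjectives B] (h : IsLeftDerivedDb T LT)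
    (hT : ∀ P : A, Projective P → ∃ d, HasProjectiveDimensionLE (T.obj P) d) :
    (perfectComplexes A).trW.IsInvertedBy (LT ⋙ Qsg B) := by
  intro X Y f hf
  obtain ⟨K, a, b, hb, ha, hK, ⟨eX⟩⟩ := exists_projToDb_iso X
  obtain ⟨L, a', b', hb', ha', hL, ⟨eY⟩⟩ := exists_projToDb_iso Y
  let f' := eX.hom ≫ f ≫ eY.inv
  have hf' : (perfectComplexes A).trW f' :=
    ((perfectComplexes A).trW.arrow_mk_iso_iff (Arrow.isoMk eX eY (by
      change eX.hom ≫ f = (eX.hom ≫ f ≫ eY.inv) ≫ eY.hom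
      simp))).2 hf
  suffices IsIso ((Qsg B).map (LT.map f')) by
    have h : f = eX.inv ≫ f' ≫ eY.hom := by simp [f']
    rw [h]
    change IsIso ((Qsg B).map (LT.map _))
    simp only [Functor.map_comp]
    infer_instance
  apply Localization.inverts (Qsg B) (perfectComplexes B).trW
  obtain ⟨φ, ⟨e₁⟩, ⟨e₂⟩⟩ := nonempty_leftDerivedDb_map_iso h a b hb ha hK a' b' hb' ha' hL f'
  change ((perfectObjects A).inverseImage DerivedCategory.Bounded.ι).trW f' at hf'
  rw [ObjectProperty.inverseImage_trW_iff] at hf'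
  change ((perfectObjects B).inverseImage DerivedCategory.Bounded.ι).trW (LT.map f')
  rw [ObjectProperty.inverseImage_trW_iff]
  have hf'' := ((perfectObjects A).trW.arrow_mk_iso_iff e₁).1 hf'
  refine ((perfectObjects B).trW.arrow_mk_iso_iff e₂).2 ?_
  have h₁ := ((perfectObjects A).trW_iff_of_distinguished _
    (DerivedCategory.mappingCone_triangle_distinguished φ)).1 hf''
  refine ((perfectObjects B).trW_iff_of_distinguished _
    (DerivedCategory.mappingCone_triangle_distinguished ((mapC T).map φ))).2 ?_
  have := isStrictlyLE_mappingCone φ (max b b') (isStrictlyLE_mono K (by lia) hb)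
    (isStrictlyLE_mono L (by lia) hb')
  have (n : ℤ) := projective_mappingCone_X φ n (hK _) (hL _)
  have := CochainComplex.isKProjective_of_projective (CochainComplex.mappingCone φ) (max b b')
  exact (perfectObjects B).prop_of_iso (DerivedCategory.Q.mapIso
    (CochainComplex.mappingCone.mapHomologicalComplexIso φ T)) (perfectObjects_Q_mapC hT _ h₁)

lemma exists_isSgLeftDerived [EnoughProjectives B] (N : ℕ)
    (hN : ∀ p, N ≤ p → ∀ X, IsZero ((T.leftDerived (p + 1)).obj X))
    (hT : ∀ P : A, Projective P → ∃ d, HasProjectiveDimensionLE (T.obj P) d) :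
    ∃ S : SingularityCategory A ⥤ SingularityCategory B, IsSgLeftDerived T S := by
  obtain ⟨LT, h⟩ := exists_isLeftDerivedDb T N hN
  exact ⟨Localization.lift (LT ⋙ Qsg B) (isInvertedBy_leftDerivedDb h hT) (Qsg A), LT, h,
    ⟨Localization.fac _ _ _⟩⟩

lemma nonempty_leftDerivedDb_single_iso [PreservesFiniteColimits T] (h : IsLeftDerivedDb T LT)
    {X : A} (hX : ∀ i, IsZero ((T.leftDerived (i + 1)).obj X)) :
    Nonempty (LT.obj ((single A).obj X) ≅ (single B).obj (T.obj X)) := by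
  let R := projectiveResolution X
  let K := projMinusBoundedMk R.cochainComplex 0 0 inferInstance inferInstance inferInstance
  let e₁ : (projToDb A).obj K ≅ (single A).obj X :=
    DerivedCategory.Bounded.ι.preimageIso (projToDbMkIso _ _ _ _ _ _ ≪≫ isoQCochainComplex R)
  obtain ⟨e₂⟩ := nonempty_leftDerivedDb_obj_iso h R.cochainComplex 0 0 inferInstance inferInstance
    inferInstance
  have := quasiIso_map_π' T R hX
  let e₃ : DerivedCategory.Q.obj ((mapC T).obj R.cochainComplex) ≅
      DerivedCategory.Q.obj ((mapC T).obj ((CochainComplex.singleFunctor A 0).obj X)) :=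
    asIso (DerivedCategory.Q.map ((mapC T).map R.π'))
  let e₄ : (mapC T).obj ((CochainComplex.singleFunctor A 0).obj X) ≅
      (CochainComplex.singleFunctor B 0).obj (T.obj X) :=
    (HomologicalComplex.singleMapHomologicalComplex T (ComplexShape.up ℤ) 0).app X
  exact ⟨LT.mapIso e₁.symm ≪≫ DerivedCategory.Bounded.ι.preimageIso
    (e₂ ≪≫ e₃ ≪≫ DerivedCategory.Q.mapIso e₄)⟩

lemma nonempty_sgLeftDerived_toSg_iso [PreservesFiniteColimits T]
    {S : SingularityCategory A ⥤ SingularityCategory B} (h : IsSgLeftDerived T S)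
    {X : A} (hX : ∀ i, IsZero ((T.leftDerived (i + 1)).obj X)) :
    Nonempty (S.obj ((toSg A).obj X) ≅ (toSg B).obj (T.obj X)) := by
  obtain ⟨LT, h, ⟨e⟩⟩ := h
  obtain ⟨e'⟩ := nonempty_leftDerivedDb_single_iso h hX
  exact ⟨e.app _ ≪≫ (Qsg B).mapIso e'⟩

end LeftDerivedDb

/-! ### Exact functors on singularity categories -/

section Exact

variable {A : Type u₁} [Category.{v₁} A] [Abelian A] [HasDerivedCategory.{w₁} A]
  {B : Type u₂} [Category.{v₂} B] [Abelian B] [HasDerivedCategory.{w₂} B] [EnoughProjectives B]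
  (T : A ⥤ B) [T.Additive] [PreservesFiniteLimits T] [PreservesFiniteColimits T]

lemma perfectObjects_mapDerivedCategory
    (hT : ∀ P : A, Projective P → ∃ d, HasProjectiveDimensionLE (T.obj P) d)
    {X : DerivedCategory A} (hX : perfectObjects A X) :
    perfectObjects B (T.mapDerivedCategory.obj X) := by
  obtain ⟨L, a, b, ha, hb, hL, ⟨e⟩⟩ := hX
  have := isStrictlyGE_mapC T L a
  have := isStrictlyLE_mapC T L b
  exact (perfectObjects B).prop_of_iso
    ((T.mapDerivedCategoryFactors.app L).symm ≪≫ T.mapDerivedCategory.mapIso e)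
    (perfectObjects_Q_obj ((mapC T).obj L) a b (fun n => hT _ (hL n)))

lemma exists_isSgInduced
    (hT : ∀ P : A, Projective P → ∃ d, HasProjectiveDimensionLE (T.obj P) d) :
    ∃ S : SingularityCategory A ⥤ SingularityCategory B, IsSgInduced T S := by
  have h : (perfectComplexes A).trW.IsInvertedBy (exactMapDb T ⋙ Qsg B) := by
    intro X Y f hf
    apply Localization.inverts (Qsg B) (perfectComplexes B).trW
    change ((perfectObjects A).inverseImage DerivedCategory.Bounded.ι).trW f at hf
    rw [ObjectProperty.inverseImage_trW_iff] at hf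
    change ((perfectObjects B).inverseImage DerivedCategory.Bounded.ι).trW ((exactMapDb T).map f)
    rw [ObjectProperty.inverseImage_trW_iff]
    obtain ⟨Z, g, h, hT', hZ⟩ := hf
    exact ((perfectObjects B).trW_iff_of_distinguished _
      (T.mapDerivedCategory.map_distinguished _ hT')).2 (perfectObjects_mapDerivedCategory T hT hZ)
  exact ⟨Localization.lift (exactMapDb T ⋙ Qsg B) h (Qsg A), ⟨Localization.fac _ _ _⟩⟩

/-- The functor induced by an exact functor on the bounded derived category extends this functor. -/
noncomputable def singleExactMapDbIso : single A ⋙ exactMapDb T ≅ T ⋙ single B :=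
  NatIso.ofComponents (fun X => ObjectProperty.isoMk _
    ((T.mapDerivedCategorySingleFunctor 0).app X)) (fun {X Y} f => by
      apply ObjectProperty.hom_ext
      exact (T.mapDerivedCategorySingleFunctor 0).hom.naturality f)

omit [EnoughProjectives B] in
lemma nonempty_toSg_comp_iso {S : SingularityCategory A ⥤ SingularityCategory B}
    (h : IsSgInduced T S) : Nonempty (toSg A ⋙ S ≅ T ⋙ toSg B) := by
  obtain ⟨e⟩ := h
  exact ⟨Functor.isoWhiskerLeft (single A) e ≪≫
    Functor.isoWhiskerRight (singleExactMapDbIso T) (Qsg B)⟩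

end Exact

end CleftGP

namespace CleftGP

/-! ### Acyclic objects and finite projective dimension -/

section Iterates

variable {B : Type u} [Category.{v} B] (F : B ⥤ B)

/-- The definition puts the extra copy of `F` last; here it comes first, so that powers of `F` can
be evaluated at objects `F X`. -/
lemma iter_succ' (n : ℕ) : iter F (n + 1) = F ⋙ iter F n := by
  induction n with
  | zero => rfl
  | succ n ih => exact congr_arg (· ⋙ F) ih

instance preservesFiniteColimits_iter [PreservesFiniteColimits F] :
    ∀ n, PreservesFiniteColimits (iter F n)
  | 0 => inferInstanceAs (PreservesFiniteColimits (𝟭 B))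
  | n + 1 =>
    have := preservesFiniteColimits_iter n
    inferInstanceAs (PreservesFiniteColimits (iter F n ⋙ F))

end Iterates

section LeftDerived

variable {A : Type u₁} [Category.{v₁} A] [Abelian A] [EnoughProjectives A]
  {B : Type u₂} [Category.{v₂} B] [Abelian B] (T : A ⥤ B) [T.Additive]

/-- The higher left derived functors of `T` vanish on `X`. -/
def LeftAcyclic (X : A) : Prop := ∀ i, IsZero ((T.leftDerived (i + 1)).obj X)

variable {T}

lemma LeftAcyclic.of_projective (X : A) [Projective X] : LeftAcyclic T X := fun _ =>
  Functor.isZero_leftDerived_obj_projective_succ _ _ _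

lemma LeftAcyclic.of_retract {X Y : A} (h : Retract X Y) (hY : LeftAcyclic T Y) :
    LeftAcyclic T X := fun i => by
  have h' := h.map (T.leftDerived (i + 1))
  rw [IsZero.iff_id_eq_zero, ← h'.retract, (hY i).eq_of_tgt h'.i 0, zero_comp]

lemma LeftAcyclic.of_iso {X Y : A} (e : X ≅ Y) (hY : LeftAcyclic T Y) : LeftAcyclic T X :=
  hY.of_retract e.retract

lemma LeftAcyclic.X₁ {S : ShortComplex A} (hS : S.ShortExact) (h₂ : LeftAcyclic T S.X₂)
    (h₃ : LeftAcyclic T S.X₃) : LeftAcyclic T S.X₁ := fun i =>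
  isZero_leftDerived_X₁ T hS i (h₃ _) (h₂ _)

lemma LeftAcyclic.X₂ {S : ShortComplex A} (hS : S.ShortExact) (h₁ : LeftAcyclic T S.X₁)
    (h₃ : LeftAcyclic T S.X₃) : LeftAcyclic T S.X₂ := fun i =>
  isZero_leftDerived_X₂ T hS i (h₁ _) (h₃ _)

lemma LeftAcyclic.X₃ [PreservesFiniteColimits T] {S : ShortComplex A} (hS : S.ShortExact)
    (h₁ : LeftAcyclic T S.X₁) (h₂ : LeftAcyclic T S.X₂) (h : Mono (T.map S.f)) :
    LeftAcyclic T S.X₃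
  | 0 => isZero_leftDerived_one_of_mono T hS (h₂ _)
  | i + 1 => isZero_leftDerived_X₃ T hS i (h₂ _) (h₁ _)

lemma LeftAcyclic.shortExact_map [PreservesFiniteColimits T] {S : ShortComplex A}
    (hS : S.ShortExact) (h₃ : LeftAcyclic T S.X₃) : (S.map T).ShortExact := by
  have := hS.epi_g
  have : Mono (S.map T).f := mono_map_of_isZero_leftDerived T hS (h₃ 0)
  have : Epi (S.map T).g := inferInstanceAs (Epi (T.map S.g))
  exact { exact := (hS.exact.map_of_epi_of_preservesCokernel T inferInstance inferInstance) }

/-- Objects with infinite coresolutions by acyclic objects are acyclic, if the derived functors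
vanish in high degrees. -/
lemma leftAcyclic_of_class (N : ℕ) (hN : ∀ p, N ≤ p → ∀ X, IsZero ((T.leftDerived (p + 1)).obj X))
    (C : ObjectProperty A) (hC : ∀ X, C X → ∃ S : ShortComplex A, S.ShortExact ∧
      Nonempty (S.X₁ ≅ X) ∧ LeftAcyclic T S.X₂ ∧ C S.X₃) (X : A) (hX : C X) :
    LeftAcyclic T X := by
  -- Descending induction on `i`, with `k` measuring the distance to the range of vanishing:
  -- `L_(i+1) T` at `X` is controlled by `L_(i+2) T` at the cosyzygy.
  suffices ∀ k i X, N ≤ i + k → C X → IsZero ((T.leftDerived (i + 1)).obj X) from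
    fun i => this N i X (by lia) hX
  intro k
  induction k with
  | zero => exact fun i X hi _ => hN i hi X
  | succ k ih =>
    intro i X hi hX
    obtain ⟨S, hS, ⟨e⟩, h₂, h₃⟩ := hC X hX
    exact (isZero_leftDerived_X₁ T hS i (ih (i + 1) _ (by lia) h₃) (h₂ i)).of_iso
      ((T.leftDerived (i + 1)).mapIso e.symm)

lemma leftAcyclic_of_isGorensteinProjective (N : ℕ)
    (hN : ∀ p, N ≤ p → ∀ X, IsZero ((T.leftDerived (p + 1)).obj X)) {X : A}
    (hX : isGorensteinProjective A X) : LeftAcyclic T X :=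
  leftAcyclic_of_class N hN (isGorensteinProjective A) (fun X hX => by
    obtain ⟨P, Z, f, g, w, hP, hZ, hS⟩ := exists_shortExact_right hX
    exact ⟨_, hS, ⟨Iso.refl _⟩, .of_projective P, hZ⟩) X hX

end LeftDerived

section FiniteProjectiveDimension

variable {A : Type u} [Category.{v} A] [Abelian A]

/-- `X` has finite projective dimension. -/
def FinProjDim (X : A) : Prop := ∃ d, HasProjectiveDimensionLE X d

lemma FinProjDim.of_retract {X Y : A} (h : Retract X Y) (hY : FinProjDim Y) : FinProjDim X := by
  obtain ⟨d, hd⟩ := hY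
  exact ⟨d, h.hasProjectiveDimensionLT _⟩

lemma FinProjDim.of_projective (X : A) [Projective X] : FinProjDim X :=
  ⟨0, (projective_iff_hasProjectiveDimensionLE_zero X).1 inferInstance⟩

lemma FinProjDim.of_isZero {X : A} (hX : IsZero X) : FinProjDim X :=
  have := hX.projective
  .of_projective X

lemma FinProjDim.X₂ {S : ShortComplex A} (hS : S.ShortExact) (h₁ : FinProjDim S.X₁)
    (h₃ : FinProjDim S.X₃) : FinProjDim S.X₂ := by
  obtain ⟨a, ha⟩ := h₁
  obtain ⟨b, hb⟩ := h₃
  exact ⟨max a b, hS.hasProjectiveDimensionLT_X₂ _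
    (hasProjectiveDimensionLT_of_ge _ (a + 1) _ (by lia))
    (hasProjectiveDimensionLT_of_ge _ (b + 1) _ (by lia))⟩

lemma FinProjDim.X₃ {S : ShortComplex A} (hS : S.ShortExact) (h₁ : FinProjDim S.X₁)
    (h₂ : FinProjDim S.X₂) : FinProjDim S.X₃ := by
  obtain ⟨a, ha⟩ := h₁
  obtain ⟨b, hb⟩ := h₂
  exact ⟨max a b + 1, hS.hasProjectiveDimensionLT_X₃ _
    (hasProjectiveDimensionLT_of_ge _ (a + 1) _ (by lia))
    (hasProjectiveDimensionLT_of_ge _ (b + 1) _ (by lia))⟩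

/-- Induction on the projective dimension. -/
lemma FinProjDim.induction [EnoughProjectives A] {C : ObjectProperty A}
    (h₀ : ∀ P, Projective P → C P)
    (h : ∀ S : ShortComplex A, S.ShortExact → Projective S.X₂ → FinProjDim S.X₁ → C S.X₁ → C S.X₃)
    {X : A} (hX : FinProjDim X) : C X := by
  obtain ⟨d, hd⟩ := hX
  induction d generalizing X with
  | zero => exact h₀ X ((projective_iff_hasProjectiveDimensionLE_zero X).2 hd)
  | succ d ih =>
    let S : ShortComplex A := ShortComplex.mk (kernel.ι (Projective.π X)) (Projective.π X) (by simp)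
    have hS : S.ShortExact :=
      { exact := ShortComplex.exact_of_f_is_kernel _ (kernelIsKernel _) }
    have h₁ : HasProjectiveDimensionLE S.X₁ d :=
      (hS.hasProjectiveDimensionLT_X₃_iff d inferInstance).1 hd
    exact h S hS inferInstance ⟨d, h₁⟩ (ih h₁)

end FiniteProjectiveDimension

lemma IsPerfect.exists_vanishing {B : Type u} [Category.{v} B] [Abelian B] [EnoughProjectives B]
    {F : B ⥤ B} [F.Additive] (hF : IsPerfect F) (j : ℕ) :
    ∃ N, ∀ p, N ≤ p → ∀ X, IsZero (((iter F (j + 1)).leftDerived (p + 1)).obj X) := by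
  obtain ⟨n, hn⟩ := hF.vanishing
  exact ⟨n, fun p hp X => hn _ _ (by lia) (by lia) (by lia) X⟩

lemma IsPerfect.leftAcyclic {B : Type u} [Category.{v} B] [Abelian B] [EnoughProjectives B]
    {F : B ⥤ B} [F.Additive] (hF : IsPerfect F) (j : ℕ) {X : B} (hX : isGorensteinProjective B X) :
    LeftAcyclic (iter F (j + 1)) X := by
  obtain ⟨N, hN⟩ := hF.exists_vanishing j
  exact leftAcyclic_of_isGorensteinProjective N hN hX

lemma IsPerfect.mono_map {B : Type u} [Category.{v} B] [Abelian B] [EnoughProjectives B]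
    {F : B ⥤ B} [F.Additive] (hF : IsPerfect F) {S : ShortComplex B} (hS : S.ShortExact)
    (h : LeftAcyclic F S.X₃) : Mono (F.map S.f) :=
  have := hF.rightExact
  mono_map_of_isZero_leftDerived F hS (h 0)

/-! ### Preservation properties of `l` and `e` -/

section Adjunction

variable {B : Type u₁} [Category.{v₁} B] {A : Type u₂} [Category.{v₂} A]
  {l : B ⥤ A} {e : A ⥤ B} (adj : l ⊣ e)

include adj in
/-- For a faithful right adjoint `e`, the object `e Q` is a retract of `e (l P)` for some projective
object `P` if `Q` is projective. -/
lemma exists_retract_of_projective [EnoughProjectives B] [e.Faithful] (Q : A) [Projective Q] :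
    ∃ (P : B) (_ : Projective P), Nonempty (Retract (e.obj Q) (e.obj (l.obj P))) := by
  -- The counit is an epimorphism because `e` is faithful, and `l` preserves epimorphisms as a left
  -- adjoint.
  have : Epi (l.map (Projective.π (e.obj Q)) ≫ adj.counit.app Q) := by
    have := adj.leftAdjoint_preservesColimits
    infer_instance
  let r := l.map (Projective.π (e.obj Q)) ≫ adj.counit.app Q
  exact ⟨Projective.over (e.obj Q), inferInstance,
    ⟨Retract.map ⟨Projective.factorThru (𝟙 Q) r, r, Projective.factorThru_comp _ _⟩ e⟩⟩

end Adjunction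

/-- Natural short exact sequences `0 ⟶ F X ⟶ e (l X) ⟶ X ⟶ 0` which are split by the unit of the
adjunction `l ⊣ e`. -/
structure CleftSplitting {B : Type u₁} [Category.{v₁} B] [Abelian B] {A : Type u₂}
    [Category.{v₂} A] [Abelian A] {l : B ⥤ A} {e : A ⥤ B} (adj : l ⊣ e) (F : B ⥤ B) where
  κ : F ⟶ l ⋙ e
  ρ : l ⋙ e ⟶ 𝟭 B
  zero (X : B) : κ.app X ≫ ρ.app X = 0
  shortExact (X : B) : (ShortComplex.mk (κ.app X) (ρ.app X) (zero X)).ShortExact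
  unit_ρ (X : B) : adj.unit.app X ≫ ρ.app X = 𝟙 X

namespace CleftSplitting

attribute [local instance] HasExt.standard

variable {B : Type u₁} [Category.{v₁} B] [Abelian B] [EnoughProjectives B]
  {A : Type u₂} [Category.{v₂} A] [Abelian A]
  {l : B ⥤ A} {e : A ⥤ B} {adj : l ⊣ e} {F : B ⥤ B} [F.Additive] (σ : CleftSplitting adj F)
  (hF : IsPerfect F)

include σ

/-- The splitting of the short exact sequence `0 ⟶ F X ⟶ e (l X) ⟶ X ⟶ 0`. -/
noncomputable def splitting (X : B) :
    (ShortComplex.mk (σ.κ.app X) (σ.ρ.app X) (σ.zero X)).Splitting :=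
  ShortComplex.Splitting.ofExactOfSection _ (σ.shortExact X).exact (adj.unit.app X) (σ.unit_ρ X)
    (σ.shortExact X).mono_f

omit [EnoughProjectives B] [F.Additive] in
-- Since `e l X` is an extension of `X` by `F X`, the four lemma makes `e (l f)` a monomorphism, and
-- the faithful `e` reflects this.
lemma mono_map_map [e.Faithful] {X Y : B} (f : X ⟶ Y) [Mono f] (h : Mono (F.map f)) :
    Mono (l.map f) := by
  let φ : ShortComplex.mk (σ.κ.app X) (σ.ρ.app X) (σ.zero X) ⟶
      ShortComplex.mk (σ.κ.app Y) (σ.ρ.app Y) (σ.zero Y) :=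
    { τ₁ := F.map f
      τ₂ := e.map (l.map f)
      τ₃ := f
      comm₁₂ := σ.κ.naturality f
      comm₂₃ := σ.ρ.naturality f }
  have : Mono φ.τ₁ := h
  have : Mono φ.τ₃ := ‹Mono f›
  have : Mono (e.map (l.map f)) := (exists_shortExact_cokernel (σ.shortExact X) (σ.shortExact Y) φ).1
  exact e.mono_of_mono_map this

omit [EnoughProjectives B] [F.Additive] in
lemma shortExact_map [e.Faithful] [l.Additive] {S : ShortComplex B} (hS : S.ShortExact)
    (h₃ : Mono (F.map S.f)) : (S.map l).ShortExact := by
  have := adj.leftAdjoint_preservesColimits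
  have := hS.epi_g
  have := hS.mono_f
  have : Mono (S.map l).f := σ.mono_map_map S.f h₃
  have : Epi (S.map l).g := inferInstanceAs (Epi (l.map S.g))
  exact { exact := (hS.exact.map_of_epi_of_preservesCokernel l inferInstance inferInstance) }

include hF

variable [e.Faithful]

/-- The object `e Q` is a retract of some `e l P`, an extension of `P` by `F P`; the first condition
of perfectness applies to `F P`. -/
lemma leftAcyclic_of_projective (j : ℕ) (Q : A) [Projective Q] :
    LeftAcyclic (iter F (j + 1)) (e.obj Q) := by
  obtain ⟨P, hP, ⟨r⟩⟩ := exists_retract_of_projective adj Q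
  exact .of_retract r (.X₂ (σ.shortExact P) (fun i => hF.condR _ _ (by lia) (by lia) P hP)
    (.of_projective P))

lemma finProjDim_of_projective (Q : A) [Projective Q] : FinProjDim (e.obj Q) := by
  obtain ⟨P, hP, ⟨r⟩⟩ := exists_retract_of_projective adj Q
  exact .of_retract r (.X₂ (σ.shortExact P) (hF.finiteProjDim P hP) (.of_projective P))

variable [EnoughProjectives A] [l.Additive] [PreservesFiniteColimits e]

/-- Acyclicity of Gorenstein projectives makes `l` exact on the sequences in question, and `l`
preserves projectives. To extend `l Z ⟶ Q` over `l P` means to extend its transpose `Z ⟶ e Q` over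
`P`, which is possible as `e Q` has finite projective dimension. -/
lemma isGorensteinProjective_map {X : B} (hX : isGorensteinProjective B X) :
    isGorensteinProjective A (l.obj X) := by
  have hl {S : ShortComplex B} (hS : S.ShortExact) (h₃ : isGorensteinProjective B S.X₃) :
      (S.map l).ShortExact := σ.shortExact_map hS (hF.mono_map hS
        (hF.leftAcyclic 0 h₃))
  refine isGorensteinProjective_of_class (fun Y => ∃ X, isGorensteinProjective B X ∧
    Nonempty (Y ≅ l.obj X)) ?_ ?_ _ ⟨X, hX, ⟨Iso.refl _⟩⟩
  · intro Y hY Q hQ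
    refine extVanishing_of_class (fun Y => ∃ X, isGorensteinProjective B X ∧
      Nonempty (Y ≅ l.obj X)) Q ?_ Y hY
    rintro Y ⟨X, hX, ⟨i⟩⟩
    obtain ⟨P, Z, f, g, w, hP, hZ, hS⟩ := exists_shortExact_left hX
    refine ⟨_, hl hS hX, adj.map_projective P hP, ⟨i.symm⟩, ⟨Z, hZ, ⟨Iso.refl _⟩⟩, fun a => ?_⟩
    obtain ⟨d, hd⟩ := σ.finProjDim_of_projective hF Q
    obtain ⟨b, hb⟩ := ExtVanishing.exists_extension hS (ExtVanishing.of_hasProjectiveDimensionLE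
      (fun P hP => extVanishing_of_isGorensteinProjective hX P hP) d (e.obj Q) hd)
      (adj.homEquiv _ _ a)
    refine ⟨(adj.homEquiv _ _).symm b, ?_⟩
    change l.map f ≫ _ = a
    exact (adj.homEquiv_naturality_left_symm f b).symm.trans
      ((congr_arg (adj.homEquiv _ _).symm hb).trans ((adj.homEquiv _ _).symm_apply_apply a))
  · rintro Y ⟨X, hX, ⟨i⟩⟩
    obtain ⟨P, Z, f, g, w, hP, hZ, hS⟩ := exists_shortExact_right hX
    have w' : (i.hom ≫ l.map f) ≫ l.map g = 0 := by
      rw [Category.assoc, ← l.map_comp, w, l.map_zero, comp_zero]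
    let φ : (ShortComplex.mk f g w).map l ≅ ShortComplex.mk (i.hom ≫ l.map f) (l.map g) w' :=
      ShortComplex.isoMk i.symm (Iso.refl _) (Iso.refl _)
        ((i.inv_hom_id_assoc _).trans (Category.comp_id _).symm)
        ((Category.id_comp _).trans (Category.comp_id _).symm)
    exact ⟨l.obj P, l.obj Z, i.hom ≫ l.map f, l.map g, w', adj.map_projective P hP,
      ⟨Z, hZ, ⟨Iso.refl _⟩⟩, ShortComplex.shortExact_of_iso φ (hl hS hZ)⟩

variable [PreservesFiniteLimits e] [e.Additive]

omit [EnoughProjectives A] [l.Additive] in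
-- A coresolution of `Y` by projectives `Q` is sent by the exact `e` to a coresolution by the
-- acyclic objects `e Q`.
lemma leftAcyclic_map_of_isGorensteinProjective (j : ℕ) {Y : A}
    (hY : isGorensteinProjective A Y) : LeftAcyclic (iter F (j + 1)) (e.obj Y) := by
  obtain ⟨N, hN⟩ := hF.exists_vanishing j
  refine leftAcyclic_of_class N hN (fun X => ∃ Y, isGorensteinProjective A Y ∧
    Nonempty (e.obj Y ≅ X)) ?_ _ ⟨Y, hY, ⟨Iso.refl _⟩⟩
  rintro X ⟨Y, hY, ⟨i⟩⟩
  obtain ⟨P, Z, f, g, w, hP, hZ, hS⟩ := exists_shortExact_right hY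
  exact ⟨_, hS.map_of_exact e, ⟨i⟩, σ.leftAcyclic_of_projective hF j P, Z, hZ, ⟨Iso.refl _⟩⟩

end CleftSplitting

section Splitting

variable {A : Type u} [Category.{v} A] [Abelian A]

/-- Allows kernels of two retractions of the same section to be identified, both being the cokernel
of that section. -/
lemma nonempty_cokernel_section_iso {S : ShortComplex A} (s : S.Splitting) :
    Nonempty (cokernel s.s ≅ S.X₁) := by
  let s' : (ShortComplex.mk s.s s.r s.s_r).Splitting :=
    { r := S.g
      s := S.f
      f_r := s.s_g
      s_g := s.f_r
      id := by
        rw [add_comm]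
        exact s.id }
  exact cokernel_iso_of_shortExact s'.shortExact

end Splitting

/-! ### Finite projective dimension under `F`, `l` and `e` -/

section Perfect

variable {B : Type u} [Category.{v} B] [Abelian B] [EnoughProjectives B] {F : B ⥤ B} [F.Additive]
  (hF : IsPerfect F)

include hF

lemma IsPerfect.shortExact_map {S : ShortComplex B} (hS : S.ShortExact)
    (h : LeftAcyclic F S.X₃) : (S.map F).ShortExact :=
  have := hF.rightExact
  h.shortExact_map hS

lemma IsPerfect.finProjDim {X : B} (hX : FinProjDim X) (h : LeftAcyclic F X) :
    FinProjDim (F.obj X) := by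
  refine FinProjDim.induction (C := fun X => LeftAcyclic F X → FinProjDim (F.obj X))
    (fun P hP _ => hF.finiteProjDim P hP) (fun S hS hP _ ih h => ?_) hX h
  exact FinProjDim.X₃ (hF.shortExact_map hS h) (ih (.X₁ hS (.of_projective _) h))
    (hF.finiteProjDim _ hP)

/-- All powers of `F` are needed at once: in the induction, `F^(j+1)` must send `F S.f` to a
monomorphism, which follows from acyclicity of `S.X₃` for `F^(j+2)`. -/
lemma IsPerfect.leftAcyclic_obj {X : B} (hX : FinProjDim X) (h : ∀ j, LeftAcyclic (iter F (j + 1)) X)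
    (j : ℕ) : LeftAcyclic (iter F (j + 1)) (F.obj X) := by
  have := hF.rightExact
  refine FinProjDim.induction (C := fun X => (∀ j, LeftAcyclic (iter F (j + 1)) X) →
    LeftAcyclic (iter F (j + 1)) (F.obj X))
    (fun P hP _ i => hF.condR _ _ (by lia) (by lia) P hP) (fun S hS hP _ ih h => ?_) hX h
  refine .X₃ (hF.shortExact_map hS (h 0)) (ih (fun j => .X₁ hS (.of_projective _) (h j)))
    (fun i => hF.condR _ _ (by lia) (by lia) _ hP) ?_
  have h' := mono_map_of_isZero_leftDerived (iter F (j + 1 + 1)) hS (h (j + 1) 0)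
  rw [iter_succ'] at h'
  exact h'

end Perfect

namespace CleftSplitting

variable {B : Type u₁} [Category.{v₁} B] [Abelian B] [EnoughProjectives B]
  {A : Type u₂} [Category.{v₂} A] [Abelian A]
  {l : B ⥤ A} {e : A ⥤ B} {adj : l ⊣ e} {F : B ⥤ B} [F.Additive] (σ : CleftSplitting adj F)
  (hF : IsPerfect F) [e.Faithful] [e.Additive] [PreservesFiniteLimits e]
  [PreservesFiniteColimits e] [l.Additive]

include σ

include hF in
omit [e.Additive] [PreservesFiniteLimits e] in
lemma finProjDim_map {X : B} (hX : FinProjDim X) (h : LeftAcyclic F X) :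
    FinProjDim (l.obj X) := by
  refine FinProjDim.induction (C := fun X => LeftAcyclic F X → FinProjDim (l.obj X))
    (fun P hP _ => ?_) (fun S hS hP _ ih h => ?_) hX h
  · have := adj.map_projective P hP
    exact .of_projective _
  · have := adj.map_projective _ hP
    exact FinProjDim.X₃ (σ.shortExact_map hS (hF.mono_map hS h))
      (ih (.X₁ hS (.of_projective _) h)) (.of_projective (l.obj S.X₂))

omit [EnoughProjectives B] [F.Additive] [l.Additive] in
/-- The short exact sequence given by the kernel of the counit of the adjunction. -/
lemma exists_shortExact_counit (Z : A) : ∃ S : ShortComplex A, S.ShortExact ∧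
    S.X₂ = l.obj (e.obj Z) ∧ S.X₃ = Z ∧ Nonempty (e.obj S.X₁ ≅ F.obj (e.obj Z)) := by
  let S : ShortComplex A := ShortComplex.mk (kernel.ι (adj.counit.app Z)) (adj.counit.app Z) (by simp)
  have hS : S.ShortExact :=
    { exact := ShortComplex.exact_of_f_is_kernel _ (kernelIsKernel _)
      epi_g := inferInstanceAs (Epi (adj.counit.app Z)) }
  refine ⟨S, hS, rfl, rfl, ?_⟩
  have hS' := hS.map_of_exact e
  -- Both `e` of the counit and the retraction of `σ` at `e Z` are split by the unit at `e Z`, so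
  -- their kernels agree.
  let s : (S.map e).Splitting := ShortComplex.Splitting.ofExactOfSection _ hS'.exact
    (adj.unit.app (e.obj Z)) (adj.right_triangle_components Z) hS'.mono_f
  obtain ⟨i⟩ := nonempty_cokernel_section_iso s
  obtain ⟨j⟩ := nonempty_cokernel_section_iso (σ.splitting (e.obj Z))
  exact ⟨i.symm ≪≫ j⟩

include hF in
/-- The functor `e` reflects finite projective dimension on objects which are sent to acyclic
objects, if `F` is nilpotent. -/
lemma finProjDim_of_finProjDim_map (m : ℕ) (Z : A) (hm : IsZero ((iter F m).obj (e.obj Z)))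
    (hZ : FinProjDim (e.obj Z)) (h : ∀ j, LeftAcyclic (iter F (j + 1)) (e.obj Z)) :
    FinProjDim Z := by
  induction m generalizing Z with
  | zero =>
    refine .of_isZero ((IsZero.iff_id_eq_zero _).2 (e.map_injective ?_))
    exact hm.eq_of_src _ _
  | succ m ih =>
    -- The kernel of `l e Z ⟶ Z` is sent by `e` to `F (e Z)`, which is killed by one power of `F`
    -- fewer, while `l e Z` has finite projective dimension.
    obtain ⟨S, hS, h₂, rfl, ⟨i⟩⟩ := σ.exists_shortExact_counit Z
    refine .X₃ hS (ih S.X₁ ?_ (.of_retract i.retract (hF.finProjDim hZ (h 0)))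
      (fun j => .of_iso i (hF.leftAcyclic_obj hZ h j))) ?_
    · rw [iter_succ'] at hm
      exact hm.of_iso ((iter F m).mapIso i)
    · rw [h₂]
      exact σ.finProjDim_map hF hZ (h 0)

end CleftSplitting
end CleftGP

namespace CleftGP
open Pretriangulated ZeroObject

/-! ### The stable category inside the singularity category -/

section Stable

attribute [local instance] HasExt.standard

variable (A : Type u) [Category.{v} A] [Abelian A] [HasDerivedCategory.{w} A]

instance : (stableToSg A).Full where
  map_surjective {X Y} α := by
    obtain ⟨a, ha⟩ := exists_toSg_map_eq
      (fun Q hQ => extVanishing_of_isGorensteinProjective X.as.property Q hQ) α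
    exact ⟨(Quotient.functor (stableRel A)).map (ObjectProperty.homMk a : X.as ⟶ Y.as), ha⟩

instance : (stableToSg A).Faithful where
  map_injective {X Y f g} h := by
    obtain ⟨f', rfl⟩ := (Quotient.functor (stableRel A)).map_surjective f
    obtain ⟨g', rfl⟩ := (Quotient.functor (stableRel A)).map_surjective g
    exact CategoryTheory.Quotient.sound _ (exists_factors_projective_of_toSg_map_eq
      (fun Q hQ => extVanishing_of_isGorensteinProjective X.as.property Q hQ) f'.hom g'.hom h)

variable {A}

lemma exists_toSg_map_eq_of_isGorensteinProjective {X Y : A} (hX : isGorensteinProjective A X)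
    (α : (toSg A).obj X ⟶ (toSg A).obj Y) : ∃ a : X ⟶ Y, (toSg A).map a = α :=
  exists_toSg_map_eq (fun Q hQ => extVanishing_of_isGorensteinProjective hX Q hQ) α

lemma exists_factors_projective_of_isGorensteinProjective {X Y : A}
    (hX : isGorensteinProjective A X) (f g : X ⟶ Y) (h : (toSg A).map f = (toSg A).map g) :
    ∃ (P : A) (_ : Projective P) (a : X ⟶ P) (b : P ⟶ Y), f - g = a ≫ b :=
  exists_factors_projective_of_toSg_map_eq
    (fun Q hQ => extVanishing_of_isGorensteinProjective hX Q hQ) f g h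

/-- A Gorenstein projective object, as an object of the stable category. -/
def stableMk {X : A} (hX : isGorensteinProjective A X) : StableGProj A := ⟨⟨X, hX⟩⟩

lemma isIso_toSg_map_of_isZero {S : ShortComplex A} (hS : S.ShortExact)
    (h : IsZero ((toSg A).obj S.X₁)) : IsIso ((toSg A).map S.g) := by
  obtain ⟨δ, hT⟩ := toSg_distinguished hS
  exact (Triangle.isZero₁_iff_isIso₂ _ hT).1 h

/-- The kernels of two epimorphisms which are isomorphic in the singularity category. -/
lemma nonempty_toSg_X₁_iso {S S' : ShortComplex A} (hS : S.ShortExact) (hS' : S'.ShortExact)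
    (i : (toSg A).obj S.X₂ ≅ (toSg A).obj S'.X₂) (j : (toSg A).obj S.X₃ ≅ (toSg A).obj S'.X₃)
    (h : (toSg A).map S.g ≫ j.hom = i.hom ≫ (toSg A).map S'.g) :
    Nonempty ((toSg A).obj S.X₁ ≅ (toSg A).obj S'.X₁) := by
  obtain ⟨δ, hT⟩ := toSg_distinguished hS
  obtain ⟨δ', hT'⟩ := toSg_distinguished hS'
  obtain ⟨f, -, -⟩ := exists_iso_of_arrow_iso _ _ (rot_of_distTriang _ hT)
    (rot_of_distTriang _ hT') (Arrow.isoMk i j h.symm)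
  exact ⟨(shiftFunctor (SingularityCategory A) (1 : ℤ)).preimageIso (Triangle.π₃.mapIso f)⟩

end Stable

section FullyFaithful

lemma isZero_obj_iff_of_fullyFaithful {C : Type u₁} [Category.{v₁} C] {D : Type u₂}
    [Category.{v₂} D] [HasZeroMorphisms D] (T : C ⥤ D) [T.Full] [T.Faithful] (X : C) :
    IsZero (T.obj X) ↔ IsZero X := by
  refine ⟨fun h => ⟨fun Y => ⟨⟨⟨T.preimage 0⟩, fun f => T.map_injective (h.eq_of_src _ _)⟩⟩,
    fun Y => ⟨⟨⟨T.preimage 0⟩, fun f => T.map_injective (h.eq_of_tgt _ _)⟩⟩⟩, fun h => ?_⟩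
  rw [IsZero.iff_id_eq_zero, ← T.map_preimage (0 : T.obj X ⟶ T.obj X), ← T.map_id]
  exact congr_arg _ (h.eq_of_src _ _)

lemma bijective_map_iff_of_iso {C : Type u₁} [Category.{v₁} C] {D : Type u₂} [Category.{v₂} D]
    {T T' : C ⥤ D} (i : T ≅ T') (X Y : C) :
    Function.Bijective (T.map : (X ⟶ Y) → _) ↔ Function.Bijective (T'.map : (X ⟶ Y) → _) := by
  have h : (T'.map : (X ⟶ Y) → _) = (Iso.homCongr (i.app X) (i.app Y)) ∘ T.map := by
    ext f
    simp
  rw [h, Equiv.comp_bijective]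

end FullyFaithful

section StableRestriction

variable {B : Type u₁} [Category.{v₁} B] [Abelian B] [HasDerivedCategory.{w₁} B]
  {A : Type u₂} [Category.{v₂} A] [Abelian A] [HasDerivedCategory.{w₂} A]
  {S : SingularityCategory A ⥤ SingularityCategory B} {s : StableGProj A ⥤ StableGProj B}

lemma IsStableRestriction.bijective_map_iff (hα : IsStableRestriction S s) (X Y : StableGProj A) :
    Function.Bijective (s.map : (X ⟶ Y) → _) ↔ Function.Bijective
      (S.map : ((stableToSg A).obj X ⟶ (stableToSg A).obj Y) → _) := by
  obtain ⟨α⟩ := hα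
  have h₁ : Function.Bijective ((stableToSg A).map : (X ⟶ Y) → _) :=
    ⟨(stableToSg A).map_injective, (stableToSg A).map_surjective⟩
  have h₂ : Function.Bijective ((stableToSg B).map : (s.obj X ⟶ s.obj Y) → _) :=
    ⟨(stableToSg B).map_injective, (stableToSg B).map_surjective⟩
  rw [← Function.Bijective.of_comp_iff' h₂, ← Function.Bijective.of_comp_iff _ h₁]
  exact bijective_map_iff_of_iso α X Y

end StableRestriction

/-! ### The unit of the adjunction and the criterion for an equivalence -/

namespace CleftSplitting

variable {B : Type u₁} [Category.{v₁} B] [Abelian B] [EnoughProjectives B]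
  [HasDerivedCategory.{w₁} B] {A : Type u₂} [Category.{v₂} A] [Abelian A] [EnoughProjectives A]
  [HasDerivedCategory.{w₂} A] {l : B ⥤ A} {e : A ⥤ B} {adj : l ⊣ e} {F : B ⥤ B} [F.Additive]
  (σ : CleftSplitting adj F) (hF : IsPerfect F) [e.Faithful] [e.Additive] [PreservesFiniteLimits e]
  [PreservesFiniteColimits e] [l.Additive]

include σ

omit [EnoughProjectives B] [F.Additive] [EnoughProjectives A] [HasDerivedCategory.{w₂} A] [e.Faithful]
  [e.Additive] [PreservesFiniteLimits e] [PreservesFiniteColimits e] [l.Additive] in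
-- The unit is a section of `σ.ρ`, whose kernel is `F X`: one is invertible exactly when the other
-- is.
lemma isIso_toSg_map_unit_iff (X : B) :
    IsIso ((toSg B).map (adj.unit.app X)) ↔ IsZero ((toSg B).obj (F.obj X)) := by
  have h : (toSg B).map (adj.unit.app X) ≫ (toSg B).map (σ.ρ.app X) = 𝟙 _ :=
    ((toSg B).map_comp _ _).symm.trans ((congr_arg _ (σ.unit_ρ X)).trans ((toSg B).map_id X))
  constructor
  · intro h'
    have : IsIso ((toSg B).map (σ.ρ.app X)) := by
      rw [← IsIso.inv_eq_of_hom_inv_id h]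
      infer_instance
    exact isZero_toSg_X₁ (σ.shortExact X) this
  · intro h'
    have : IsIso ((toSg B).map (σ.ρ.app X)) := isIso_toSg_map_of_isZero (σ.shortExact X) h'
    exact IsIso.of_isIso_fac_right h

omit [F.Additive] [EnoughProjectives A] [HasDerivedCategory.{w₂} A] [e.Faithful]
  [e.Additive] [PreservesFiniteLimits e] [PreservesFiniteColimits e] [l.Additive] in
/-- The object `F X` is isomorphic in the singularity category to a Gorenstein projective object
if `e (l X)` is so. -/
lemma exists_toSg_iso {X Y : B} (hX : isGorensteinProjective B X) (hY : isGorensteinProjective B Y)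
    (i : (toSg B).obj Y ≅ (toSg B).obj (e.obj (l.obj X))) :
    ∃ Z, isGorensteinProjective B Z ∧ Nonempty ((toSg B).obj Z ≅ (toSg B).obj (F.obj X)) := by
  obtain ⟨s, hs⟩ := exists_toSg_map_eq_of_isGorensteinProjective hX
    ((toSg B).map (adj.unit.app X) ≫ i.inv)
  obtain ⟨r, hr⟩ := exists_toSg_map_eq_of_isGorensteinProjective hY
    (i.hom ≫ (toSg B).map (σ.ρ.app X))
  -- The lifted `s` and `r` satisfy `s ≫ r = 𝟙` only up to a map through a projective `P`; adding
  -- `P` to `Y` repairs this and does not change `Y` in `D_sg`.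
  obtain ⟨P, hP, a, b, hab⟩ := exists_factors_projective_of_isGorensteinProjective hX
    (𝟙 X) (s ≫ r) (by
      rw [(toSg B).map_comp, hs, hr, Category.assoc, i.inv_hom_id_assoc, ← (toSg B).map_comp,
        σ.unit_ρ])
  let p : Y ⊞ P ⟶ X := biprod.desc r b
  have hp : biprod.lift s a ≫ p = 𝟙 X := by
    rw [biprod.lift_desc, ← hab, add_sub_cancel]
  have : IsSplitEpi p := ⟨⟨⟨biprod.lift s a, hp⟩⟩⟩
  let S : ShortComplex B := ShortComplex.mk (kernel.ι p) p (by simp)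
  have hS : S.ShortExact :=
    { exact := ShortComplex.exact_of_f_is_kernel _ (kernelIsKernel _) }
  have := isIso_Qsg_map_fst Y P hP
  have hfst : IsIso ((toSg B).map (biprod.fst : Y ⊞ P ⟶ Y)) := this
  refine ⟨S.X₁, isGorensteinProjective_of_splitting _ _ _
    (ShortComplex.Splitting.ofExactOfSection S hS.exact _ hp hS.mono_f)
      (isGorensteinProjective_of_shortExact
        (ShortComplex.Splitting.ofHasBinaryBiproduct Y P).shortExact hY
          (isGorensteinProjective_of_projective P)) hX,
    nonempty_toSg_X₁_iso hS (σ.shortExact X)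
      (asIso ((toSg B).map (biprod.fst : Y ⊞ P ⟶ Y)) ≪≫ i) (Iso.refl _) ?_⟩
  have h : (toSg B).map p = (toSg B).map (biprod.fst ≫ r) := by
    refine Qsg_map_eq_of_sub_factors hP _ _ biprod.snd b ?_
    ext <;> simp [p]
  refine (Category.comp_id _).trans (h.trans ?_)
  rw [(toSg B).map_comp, hr]
  exact (Category.assoc _ _ _).symm

omit σ

variable {eSg : SingularityCategory A ⥤ SingularityCategory B} (θ : toSg A ⋙ eSg ≅ e ⋙ toSg B)

include σ hF

/-- The adjunction between `l` and `e` in the singularity categories. -/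
lemma bijective_unit_comp {X : B} (hX : isGorensteinProjective B X) (Y : A) :
    Function.Bijective (fun g : (toSg A).obj (l.obj X) ⟶ (toSg A).obj Y =>
      (toSg B).map (adj.unit.app X) ≫ θ.inv.app (l.obj X) ≫ eSg.map g ≫ θ.hom.app Y) := by
  -- On morphisms of `A` the map is the usual transposition. It therefore remains to lift morphisms,
  -- and to note that `l` of a projective is projective.
  have h (a : l.obj X ⟶ Y) : (toSg B).map (adj.unit.app X) ≫ θ.inv.app (l.obj X) ≫
      eSg.map ((toSg A).map a) ≫ θ.hom.app Y = (toSg B).map (adj.homEquiv _ _ a) := by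
    have h₁ : eSg.map ((toSg A).map a) ≫ θ.hom.app Y =
      θ.hom.app (l.obj X) ≫ (toSg B).map (e.map a) := θ.hom.naturality a
    rw [h₁, θ.inv_hom_id_app_assoc, ← (toSg B).map_comp, adj.homEquiv_unit]
  have hlX := σ.isGorensteinProjective_map hF hX
  constructor
  · intro g g' hg
    obtain ⟨a, rfl⟩ := exists_toSg_map_eq_of_isGorensteinProjective hlX g
    obtain ⟨a', rfl⟩ := exists_toSg_map_eq_of_isGorensteinProjective hlX g'
    obtain ⟨P, hP, x, y, hxy⟩ := exists_factors_projective_of_isGorensteinProjective hX _ _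
      ((h a).symm.trans (hg.trans (h a')))
    refine Qsg_map_eq_of_sub_factors (adj.map_projective P hP) a a' (l.map x)
      ((adj.homEquiv _ _).symm y) ?_
    apply (adj.homEquiv _ _).injective
    rw [adj.homEquiv_naturality_left, Equiv.apply_symm_apply, ← hxy]
    simp [adj.homEquiv_unit]
  · intro β
    obtain ⟨b, rfl⟩ := exists_toSg_map_eq_of_isGorensteinProjective hX β
    exact ⟨(toSg A).map ((adj.homEquiv _ _).symm b), (h _).trans (by rw [Equiv.apply_symm_apply])⟩

include θ

/-- A morphism `φ : l X ⟶ Y` between Gorenstein projective objects is an isomorphism in the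
singularity category if `e φ` is so. -/
lemma isIso_toSg_map_of_isIso_toSg_map_map {m : ℕ} (hm : IsZero (iter F m)) {X : B}
    (hX : isGorensteinProjective B X) {Y : A} (hY : isGorensteinProjective A Y) (φ : l.obj X ⟶ Y)
    (h : IsIso ((toSg B).map (e.map φ))) : IsIso ((toSg A).map φ) := by
  let P := Projective.over Y
  -- Adding a projective that covers `Y` turns `φ` into an epimorphism, with the same image in
  -- `D_sg` up to isomorphism. Its kernel is then shown to have finite projective dimension.
  let q : l.obj X ⊞ P ⟶ Y := biprod.desc φ (Projective.π Y)
  have : Epi q := by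
    have : Epi (biprod.inr ≫ q) := by
      simp only [q, biprod.inr_desc]
      infer_instance
    exact epi_of_epi biprod.inr q
  have hP : IsIso ((toSg A).map (biprod.fst : l.obj X ⊞ P ⟶ _)) :=
    isIso_Qsg_map_fst _ P inferInstance
  have hi : (toSg A).map (biprod.inl : _ ⟶ l.obj X ⊞ P) ≫ (toSg A).map biprod.fst = 𝟙 _ := by
    rw [← (toSg A).map_comp, biprod.inl_fst, (toSg A).map_id]
  have hi' : IsIso ((toSg A).map (biprod.inl : _ ⟶ l.obj X ⊞ P)) :=
    IsIso.of_isIso_fac_right hi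
  have hi'' : IsIso ((toSg B).map (e.map (biprod.inl : _ ⟶ l.obj X ⊞ P))) :=
    (NatIso.isIso_map_iff θ _).1 (inferInstanceAs (IsIso (eSg.map _)))
  let S : ShortComplex A := ShortComplex.mk (kernel.ι q) q (by simp)
  have hS : S.ShortExact :=
    { exact := ShortComplex.exact_of_f_is_kernel _ (kernelIsKernel _) }
  have hq : biprod.inl ≫ q = φ := by simp [q]
  have hq' : IsIso ((toSg B).map (e.map q)) := by
    rw [← hq, e.map_comp, (toSg B).map_comp] at h
    exact IsIso.of_isIso_comp_left ((toSg B).map (e.map biprod.inl)) _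
  have h₁ : FinProjDim (e.obj S.X₁) := exists_hasProjectiveDimensionLE_of_isZero_toSg
    (isZero_toSg_X₁ (hS.map_of_exact e) hq')
  have hlX : isGorensteinProjective A (l.obj X ⊞ P) := isGorensteinProjective_of_shortExact
    (ShortComplex.Splitting.ofHasBinaryBiproduct (l.obj X) P).shortExact
      (σ.isGorensteinProjective_map hF hX) (isGorensteinProjective_of_projective P)
  obtain ⟨d, hd⟩ := σ.finProjDim_of_finProjDim_map hF m S.X₁ (((iter F m).isZero_iff).1 hm _) h₁
    (fun j => .X₁ (hS.map_of_exact e) (σ.leftAcyclic_map_of_isGorensteinProjective hF j hlX)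
      (σ.leftAcyclic_map_of_isGorensteinProjective hF j hY))
  have := isIso_toSg_map_of_isZero hS (isZero_toSg_obj_of_hasProjectiveDimensionLE hd)
  have : IsIso ((toSg A).map q) := this
  rw [← hq, (toSg A).map_comp]
  infer_instance

variable {eStab : StableGProj A ⥤ StableGProj B} (hα : IsStableRestriction eSg eStab)

include hα

omit [e.Additive] [PreservesFiniteLimits e] in
-- The stable restriction of `e`, applied to the Gorenstein projective `l X`, provides the
-- representative of `e l X` required by `exists_toSg_iso`.
lemma exists_stable_iso {X : B} (hX : isGorensteinProjective B X) :
    ∃ Z, isGorensteinProjective B Z ∧ Nonempty ((toSg B).obj Z ≅ (toSg B).obj (F.obj X)) := by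
  obtain ⟨α⟩ := hα
  let Y := stableMk (σ.isGorensteinProjective_map hF hX)
  exact σ.exists_toSg_iso hX (eStab.obj Y).as.property (α.app Y ≪≫ θ.app (l.obj X))

omit [e.Additive] [PreservesFiniteLimits e] in
/-- The functor `F` induces a functor on the stable categories. -/
lemma exists_isStableRestriction {LFSg : SingularityCategory B ⥤ SingularityCategory B}
    (hL : ∀ X, isGorensteinProjective B X →
      Nonempty (LFSg.obj ((toSg B).obj X) ≅ (toSg B).obj (F.obj X))) :
    ∃ FStab : StableGProj B ⥤ StableGProj B, IsStableRestriction LFSg FStab := by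
  have h (X : StableGProj B) : (stableToSg B).essImage ((stableToSg B ⋙ LFSg).obj X) := by
    obtain ⟨Z, hZ, ⟨i⟩⟩ := σ.exists_stable_iso hF θ hα X.as.property
    obtain ⟨j⟩ := hL _ X.as.property
    exact ⟨stableMk hZ, ⟨i ≪≫ j.symm⟩⟩
  exact ⟨Functor.essImage.liftFunctor _ _ h, ⟨Functor.essImage.liftFunctorCompIso _ _ h⟩⟩

/-- If `eStab` is an equivalence, then the unit of the adjunction is invertible in the singularity
category at Gorenstein projective objects. -/
lemma isIso_toSg_map_unit_of_isEquivalence [eStab.IsEquivalence] {X : B}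
    (hX : isGorensteinProjective B X) : IsIso ((toSg B).map (adj.unit.app X)) := by
  let Y := eStab.objPreimage (stableMk hX)
  let i : (toSg B).obj X ≅ (toSg B).obj (e.obj Y.as.obj) :=
    ((stableToSg B).mapIso (eStab.objObjPreimageIso (stableMk hX))).symm ≪≫
      hα.some.app Y ≪≫ θ.app Y.as.obj
  obtain ⟨x, hx⟩ := exists_toSg_map_eq_of_isGorensteinProjective hX i.hom
  have hx' : IsIso ((toSg B).map x) := by
    rw [hx]
    infer_instance
  let φ : l.obj X ⟶ Y.as.obj := (adj.homEquiv _ _).symm x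
  have hφ : adj.unit.app X ≫ e.map φ = x :=
    (adj.homEquiv_unit _ _ φ).symm.trans (Equiv.apply_symm_apply _ x)
  -- Under the adjunction, precomposition with `φ` becomes `eSg` on morphisms, bijective as `eStab`
  -- is fully faithful, followed by composition with the isomorphism `x`.
  have hbij {Z : A} (hZ : isGorensteinProjective A Z) : Function.Bijective
      (fun g : (toSg A).obj Y.as.obj ⟶ (toSg A).obj Z => (toSg A).map φ ≫ g) := by
    have h₁ := σ.bijective_unit_comp hF θ hX Z
    rw [← Function.Bijective.of_comp_iff' h₁]
    have h₂ : Function.Bijective (eSg.map : ((toSg A).obj Y.as.obj ⟶ (toSg A).obj Z) → _) :=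
      (hα.bijective_map_iff Y (stableMk hZ)).1
        ⟨eStab.map_injective, eStab.map_surjective⟩
    have h₃ : Function.Bijective (fun g : eSg.obj ((toSg A).obj Y.as.obj) ⟶
        eSg.obj ((toSg A).obj Z) => ((toSg B).map x ≫ θ.inv.app _) ≫ g ≫ θ.hom.app Z) :=
      Iso.homCongr ((asIso ((toSg B).map x) ≪≫ (θ.app _).symm).symm) (θ.app Z) |>.bijective
    refine (congr_arg Function.Bijective (funext fun g => ?_)).mp (h₃.comp h₂)
    have h₄ : θ.inv.app (l.obj X) ≫ eSg.map ((toSg A).map φ) = (toSg B).map (e.map φ) ≫ θ.inv.app _ :=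
      (θ.inv.naturality φ).symm
    simp only [Function.comp_apply, Functor.map_comp, ← hφ, Category.assoc]
    exact congr_arg _ ((reassoc_of% h₄) _).symm
  have hlX := σ.isGorensteinProjective_map hF hX
  -- Yoneda: surjectivity at `Z = l X` gives `g` with `φ ≫ g = 𝟙`, and injectivity at `Z = Y` gives
  -- `g ≫ φ = 𝟙`.
  obtain ⟨g, hg : (toSg A).map φ ≫ g = _⟩ := (hbij hlX).2 (𝟙 _)
  have hg' : g ≫ (toSg A).map φ = 𝟙 _ := (hbij Y.as.property).1 (by
    change (toSg A).map φ ≫ g ≫ (toSg A).map φ = (toSg A).map φ ≫ 𝟙 _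
    rw [← Category.assoc, hg, Category.id_comp, Category.comp_id])
  have : IsIso ((toSg A).map φ) := ⟨g, hg, hg'⟩
  have : IsIso ((toSg B).map (e.map φ)) :=
    (NatIso.isIso_map_iff θ _).1 (inferInstanceAs (IsIso (eSg.map ((toSg A).map φ))))
  rw [← hφ, (toSg B).map_comp] at hx'
  exact IsIso.of_isIso_comp_right _ ((toSg B).map (e.map φ))

/-- If the unit of the adjunction is invertible in the singularity category at Gorenstein projective
objects, then `eStab` is an equivalence. -/
lemma isEquivalence_of_isIso_toSg_map_unit {m : ℕ} (hm : IsZero (iter F m))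
    (h : ∀ X, isGorensteinProjective B X → IsIso ((toSg B).map (adj.unit.app X))) :
    eStab.IsEquivalence := by
  have hbij (Y Z : StableGProj A) : Function.Bijective (eStab.map : (Y ⟶ Z) → _) := by
    rw [hα.bijective_map_iff]
    have hX := (eStab.obj Y).as.property
    let i : (toSg B).obj (eStab.obj Y).as.obj ≅ (toSg B).obj (e.obj Y.as.obj) :=
      hα.some.app Y ≪≫ θ.app Y.as.obj
    obtain ⟨x, hx⟩ := exists_toSg_map_eq_of_isGorensteinProjective hX i.hom
    let φ : l.obj _ ⟶ Y.as.obj := (adj.homEquiv _ _).symm x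
    have hφ : adj.unit.app _ ≫ e.map φ = x :=
      (adj.homEquiv_unit _ _ φ).symm.trans (Equiv.apply_symm_apply _ x)
    have := h _ hX
    have h₁ : IsIso ((toSg B).map (e.map φ)) := by
      have : IsIso ((toSg B).map x) := by
        rw [hx]
        infer_instance
      rw [← hφ, (toSg B).map_comp] at this
      exact IsIso.of_isIso_comp_left ((toSg B).map (adj.unit.app _)) _
    have := σ.isIso_toSg_map_of_isIso_toSg_map_map hF θ hm hX Y.as.property φ h₁
    have h₂ := σ.bijective_unit_comp hF θ hX Z.as.obj
    have h₃ : Function.Bijective (fun g : eSg.obj ((toSg A).obj (l.obj (eStab.obj Y).as.obj)) ⟶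
        eSg.obj ((toSg A).obj Z.as.obj) => ((toSg B).map (adj.unit.app (eStab.obj Y).as.obj) ≫
          θ.inv.app _) ≫ g ≫ θ.hom.app Z.as.obj) :=
      Iso.homCongr ((asIso ((toSg B).map (adj.unit.app (eStab.obj Y).as.obj)) ≪≫
        (θ.app _).symm).symm) (θ.app Z.as.obj) |>.bijective
    -- For the source `l X` the adjunction bijection differs from `eSg` only by composition with the
    -- unit, which is invertible here. The isomorphism `j` then transports this to the source `Y`.
    have h₄ : Function.Bijective (eSg.map : ((toSg A).obj (l.obj (eStab.obj Y).as.obj) ⟶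
        (toSg A).obj Z.as.obj) → _) := by
      rw [← Function.Bijective.of_comp_iff' h₃]
      exact (congr_arg Function.Bijective (funext fun g => (Category.assoc _ _ _).symm)).mp h₂
    let j := asIso ((toSg A).map φ)
    have h₅ : (eSg.map : ((toSg A).obj Y.as.obj ⟶ (toSg A).obj Z.as.obj) → _) =
        Iso.homCongr (eSg.mapIso j) (Iso.refl _) ∘ eSg.map ∘
          Iso.homCongr j.symm (Iso.refl ((toSg A).obj Z.as.obj)) := by
      ext g
      simp
    change Function.Bijective (eSg.map : ((toSg A).obj Y.as.obj ⟶ (toSg A).obj Z.as.obj) → _)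
    rw [h₅]
    exact (Equiv.bijective _).comp (h₄.comp (Equiv.bijective _))
  have : eStab.Full := ⟨fun {X Y} => (hbij X Y).2⟩
  have : eStab.Faithful := ⟨fun {X Y} => (hbij X Y).1⟩
  have : eStab.EssSurj := ⟨fun X => by
    have hX := X.as.property
    let Y := stableMk (σ.isGorensteinProjective_map hF hX)
    have := h _ hX
    exact ⟨Y, ⟨(stableToSg B).preimageIso (hα.some.app Y ≪≫ θ.app (l.obj X.as.obj) ≪≫
      (asIso ((toSg B).map (adj.unit.app X.as.obj))).symm)⟩⟩⟩
  exact { }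

/-- The functor `eStab` is an equivalence if and only if the functor induced by `F` is zero. -/
theorem isEquivalence_iff_isZero {m : ℕ} (hm : IsZero (iter F m))
    {LFSg : SingularityCategory B ⥤ SingularityCategory B}
    (hL : ∀ X, isGorensteinProjective B X →
      Nonempty (LFSg.obj ((toSg B).obj X) ≅ (toSg B).obj (F.obj X)))
    {FStab : StableGProj B ⥤ StableGProj B} (hβ : IsStableRestriction LFSg FStab) :
    eStab.IsEquivalence ↔ IsZero FStab := by
  have h : IsZero FStab ↔ ∀ X, isGorensteinProjective B X →
      IsIso ((toSg B).map (adj.unit.app X)) := by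
    have h₁ (X : StableGProj B) : IsZero (FStab.obj X) ↔
        IsIso ((toSg B).map (adj.unit.app X.as.obj)) := by
      rw [σ.isIso_toSg_map_unit_iff, ← isZero_obj_iff_of_fullyFaithful (stableToSg B),
        ← (hL _ X.as.property).some.isZero_iff]
      exact (hβ.some.app X).isZero_iff
    have : HasZeroObject (StableGProj B) := ⟨stableMk (isGorensteinProjective_of_projective 0),
      (isZero_obj_iff_of_fullyFaithful (stableToSg B) _).1
        (isZero_toSg_obj_of_hasProjectiveDimensionLE (FinProjDim.of_projective (0 : B)).choose_spec)⟩
    rw [Functor.isZero_iff]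
    exact ⟨fun h X hX => (h₁ (stableMk hX)).1 (h _), fun h X => (h₁ X).2 (h _ X.as.property)⟩
  rw [h]
  exact ⟨fun _ _ hX => σ.isIso_toSg_map_unit_of_isEquivalence hF θ hα hX,
    σ.isEquivalence_of_isIso_toSg_map_unit hF θ hα hm⟩

end CleftSplitting

end CleftGP

namespace CleftGP

/-! ### The splitting attached to a cleft extension -/

namespace CleftExtension

variable {B : Type u₁} [Category.{v₁} B] [Abelian B] {A : Type u₂} [Category.{v₂} A] [Abelian A]
  (C : CleftExtension B A)

/-- The inclusion of the kernel of the canonical epimorphism `l ⟶ i`. -/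
noncomputable def γ : C.i ⋙ C.G ⟶ C.l where
  app X := C.Gι.app (C.i.obj X) ≫ C.l.map (C.iso.hom.app X)
  naturality X Y f := by
    have h := C.iso.hom.naturality f
    have h' := C.Gι.naturality (C.i.map f)
    dsimp at h h' ⊢
    rw [reassoc_of% h', Category.assoc, ← C.l.map_comp, ← C.l.map_comp, h]

/-- The canonical epimorphism `l ⟶ i`. -/
noncomputable def π : C.l ⟶ C.i where
  app X := C.l.map (C.iso.inv.app X) ≫ C.adj.counit.app (C.i.obj X)
  naturality X Y f := by
    have h := C.iso.inv.naturality f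
    have h' := C.adj.counit.naturality (C.i.map f)
    dsimp at h h' ⊢
    rw [← C.l.map_comp_assoc, h, C.l.map_comp_assoc, h', Category.assoc]

lemma γ_π (X : B) : C.γ.app X ≫ C.π.app X = 0 := by
  dsimp [γ, π]
  rw [Category.assoc, ← C.l.map_comp_assoc, Iso.hom_inv_id_app]
  dsimp
  rw [C.l.map_id, Category.id_comp]
  exact kernel.condition _

lemma shortExact_γ_π (X : B) :
    (ShortComplex.mk (C.γ.app X) (C.π.app X) (C.γ_π X)).ShortExact := by
  let S : ShortComplex A := ShortComplex.mk (kernel.ι (C.adj.counit.app (C.i.obj X)))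
    (C.adj.counit.app (C.i.obj X)) (by simp)
  have hS : S.ShortExact :=
    { exact := ShortComplex.exact_of_f_is_kernel _ (kernelIsKernel _)
      epi_g := inferInstanceAs (Epi (C.adj.counit.app _)) }
  let j : C.l.obj (C.e.obj (C.i.obj X)) ≅ C.l.obj X := C.l.mapIso (C.iso.app X)
  let φ : S ≅ ShortComplex.mk (C.γ.app X) (C.π.app X) (C.γ_π X) :=
    ShortComplex.isoMk (Iso.refl _) j (Iso.refl _) (Category.id_comp _) ?_
  · exact ShortComplex.shortExact_of_iso φ hS
  refine Eq.trans ?_ (Category.comp_id _).symm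
  change C.l.map (C.iso.hom.app X) ≫ C.l.map (C.iso.inv.app X) ≫ _ = _
  rw [← C.l.map_comp_assoc, Iso.hom_inv_id_app]
  exact (congr_arg (· ≫ _) (C.l.map_id _)).trans (Category.id_comp _)

lemma whiskerRight_γ_π (X : B) : (Functor.whiskerRight C.γ C.e).app X ≫
    (Functor.whiskerRight C.π C.e ≫ C.iso.hom).app X = 0 := by
  refine (C.e.map_comp_assoc _ _ _).symm.trans ?_
  rw [C.γ_π, C.e.map_zero]
  exact zero_comp

/-- The splitting of `e l` given by a cleft extension. -/
noncomputable def cleftSplitting : CleftSplitting C.adj C.F where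
  κ := Functor.whiskerRight C.γ C.e
  ρ := Functor.whiskerRight C.π C.e ≫ C.iso.hom
  zero X := C.whiskerRight_γ_π X
  shortExact X := by
    let φ : (ShortComplex.mk (C.γ.app X) (C.π.app X) (C.γ_π X)).map C.e ≅
        ShortComplex.mk ((Functor.whiskerRight C.γ C.e).app X)
          ((Functor.whiskerRight C.π C.e ≫ C.iso.hom).app X) (C.whiskerRight_γ_π X) :=
      ShortComplex.isoMk (Iso.refl _) (Iso.refl _) (C.iso.app X)
        ((Category.id_comp _).trans (Category.comp_id _).symm) (Category.id_comp _)
    exact ShortComplex.shortExact_of_iso φ ((C.shortExact_γ_π X).map_of_exact C.e)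
  unit_ρ X := by
    -- Naturality moves the unit from `X` to `e i X`, where the triangle identity at `i X` applies.
    have h : C.iso.inv.app X ≫ C.adj.unit.app _ = C.adj.unit.app X ≫ C.e.map (C.l.map _) :=
      C.adj.unit.naturality (C.iso.inv.app X)
    have h' := C.adj.right_triangle_components (C.i.obj X)
    dsimp [π] at h h' ⊢
    rw [C.e.map_comp_assoc, ← reassoc_of% h, reassoc_of% h', Iso.inv_hom_id_app]
    rfl

end CleftExtension

/-! ### Finitely generated modules under a faithful exact right adjoint -/

section FinitelyGenerated

variable {R S : Type u} [Ring R] [Ring S]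

lemma isFG_of_epi {X Y : ModuleCat.{u} R} (f : X ⟶ Y) [Epi f] (h : ModuleCat.isFG R X) :
    ModuleCat.isFG R Y := by
  have : Module.Finite R X := h
  exact Module.Finite.of_surjective f.hom ((ModuleCat.epi_iff_surjective f).1 inferInstance)

lemma isFG_of_mono [IsNoetherianRing R] {X Y : ModuleCat.{u} R} (f : X ⟶ Y) [Mono f]
    (h : ModuleCat.isFG R Y) : ModuleCat.isFG R X := by
  have : Module.Finite R Y := h
  exact Module.Finite.of_injective f.hom ((ModuleCat.mono_iff_injective f).1 inferInstance)

lemma isFG_of_shortExact [IsNoetherianRing R] {T : ShortComplex (ModuleCat.{u} R)}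
    (hT : T.ShortExact) (h₁ : ModuleCat.isFG R T.X₁) (h₃ : ModuleCat.isFG R T.X₃) :
    ModuleCat.isFG R T.X₂ := by
  have : Module.Finite R T.X₁ := h₁
  have : Module.Finite R T.X₃ := h₃
  have := isNoetherian_of_range_eq_ker T.f.hom T.g.hom hT.exact.moduleCat_range_eq_ker
  exact inferInstanceAs (Module.Finite R T.X₂)

/-- A faithful exact functor reflects finitely generated modules, if its target is the category of
modules over a Noetherian ring. -/
lemma isFG_of_isFG_map [IsNoetherianRing R] (e : ModuleCat.{u} S ⥤ ModuleCat.{u} R) [e.Faithful]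
    [PreservesFiniteLimits e] (X : ModuleCat.{u} S) (h : ModuleCat.isFG R (e.obj X)) :
    ModuleCat.isFG S X := by
  have : Module.Finite R (e.obj X) := h
  let sub (N : Submodule S X) : ModuleCat.of S N ⟶ X := ModuleCat.ofHom N.subtype
  have hsub (N) : Mono (sub N) := (ModuleCat.mono_iff_injective _).2 N.injective_subtype
  let φ (N : Submodule S X) : Submodule R (e.obj X) := LinearMap.range (e.map (sub N)).hom
  have hφ : StrictMono φ := by
    intro N N' hN
    let j : ModuleCat.of S N ⟶ ModuleCat.of S N' := ModuleCat.ofHom (Submodule.inclusion hN.le)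
    have hj : j ≫ sub N' = sub N := rfl
    have h : e.map (sub N) = e.map j ≫ e.map (sub N') := by rw [← e.map_comp, hj]
    refine lt_of_le_not_ge ?_ (fun hle => ?_)
    · rintro _ ⟨x, rfl⟩
      exact ⟨(e.map j).hom x, by rw [h]; rfl⟩
    -- If the images under `e` coincide, then `e j` is onto, hence so is `j` because `e` is
    -- faithful, against `N < N'`.
    · have : Epi (e.map j) := by
        rw [ModuleCat.epi_iff_surjective]
        intro y
        obtain ⟨x, hx⟩ := hle ⟨y, rfl⟩
        refine ⟨x, (ModuleCat.mono_iff_injective (e.map (sub N'))).1 inferInstance ?_⟩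
        rw [h] at hx
        exact hx
      have := e.epi_of_epi_map this
      refine hN.not_ge (fun x hx => ?_)
      obtain ⟨y, hy⟩ := (ModuleCat.epi_iff_surjective j).1 inferInstance ⟨x, hx⟩
      have hy' : (y : X) = x := congr_arg Subtype.val hy
      exact hy' ▸ y.2
  have : IsNoetherian S X := isNoetherian_iff'.2 hφ.wellFoundedGT
  exact inferInstanceAs (Module.Finite S X)

/-- A finitely generated quotient is the image of a finitely generated submodule. -/
lemma exists_isFG_epi {X Y : ModuleCat.{u} R} (f : X ⟶ Y) [Epi f] (hY : ModuleCat.isFG R Y) :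
    ∃ (N : ModuleCat.{u} R) (i : N ⟶ X), ModuleCat.isFG R N ∧ Mono i ∧ Epi (i ≫ f) := by
  have : Module.Finite R Y := hY
  obtain ⟨s, hs⟩ := Module.finite_def.1 this
  have hf := (ModuleCat.epi_iff_surjective f).1 inferInstance
  choose g hg using hf
  classical
  let N : Submodule R X := Submodule.span R (s.image g : Finset X)
  refine ⟨ModuleCat.of R N, ModuleCat.ofHom N.subtype, Module.Finite.span_finset _ _,
    (ModuleCat.mono_iff_injective _).2 N.injective_subtype, ?_⟩
  rw [ModuleCat.epi_iff_range_eq_top, eq_top_iff, ← hs, Submodule.span_le]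
  intro y hy
  exact ⟨⟨g y, Submodule.subset_span (by simpa using ⟨y, hy, rfl⟩)⟩, hg y⟩

/-- A finitely generated module which is covered by a family of modules is covered by finitely
many of them. -/
lemma exists_finset_of_jointly_epi {X : ModuleCat.{u} R} (hX : ModuleCat.isFG R X) {ι : Type u}
    {Y : ModuleCat.{u} R} (f : ι → (Y ⟶ X))
    (hf : ∀ (Z : ModuleCat.{u} R) (g : X ⟶ Z), (∀ i, f i ≫ g = 0) → g = 0) :
    ∃ s : Finset ι, ⨆ i ∈ s, LinearMap.range (f i).hom = ⊤ := by
  have : Module.Finite R X := hX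
  have h : ⨆ i, LinearMap.range (f i).hom = ⊤ := by
    set N := ⨆ i, LinearMap.range (f i).hom
    -- Testing on the quotient by the sum of the images shows that they generate `X`; compactness of
    -- `⊤` then selects finitely many.
    have h := hf (ModuleCat.of R (X ⧸ N)) (ModuleCat.ofHom N.mkQ) (fun i => by
      ext x
      exact (Submodule.Quotient.mk_eq_zero N).2
        (Submodule.mem_iSup_of_mem i (LinearMap.mem_range_self _ x)))
    rw [← Submodule.ker_mkQ N, LinearMap.ker_eq_top]
    exact (ModuleCat.hom_ext_iff).1 h
  have hc := (Submodule.fg_iff_compact (⊤ : Submodule R X)).1 (Module.finite_def.1 this)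
  obtain ⟨s, hs⟩ := CompleteLattice.IsCompactElement.exists_finset_of_le_iSup _ hc (fun i => LinearMap.range (f i).hom) h.ge
  exact ⟨s, top_le_iff.1 hs⟩

section Functors

variable {l : ModuleCat.{u} R ⥤ ModuleCat.{u} S} {e : ModuleCat.{u} S ⥤ ModuleCat.{u} R}
  (adj : l ⊣ e) [e.Faithful]

include adj in
/-- Every finitely generated module is a quotient of some `l B` with `B` finitely generated. -/
lemma exists_isFG_epi_map {X : ModuleCat.{u} S} (hX : ModuleCat.isFG S X) :
    ∃ (B : ModuleCat.{u} R) (q : l.obj B ⟶ X), ModuleCat.isFG R B ∧ Epi q := by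
  -- Elements of `e X` correspond to morphisms `l R ⟶ X`, which are jointly epimorphic because `e`
  -- is faithful.
  let a (x : e.obj X) : ModuleCat.of R R ⟶ e.obj X := ModuleCat.ofHom (LinearMap.toSpanSingleton R _ x)
  obtain ⟨s, hs⟩ := exists_finset_of_jointly_epi hX (fun x => (adj.homEquiv _ _).symm (a x))
    (fun Z g hg => by
      apply e.map_injective
      ext x
      have h : a x ≫ e.map g = a x ≫ e.map 0 := by
        apply (adj.homEquiv _ _).symm.injective
        rw [adj.homEquiv_naturality_right_symm, adj.homEquiv_naturality_right_symm, hg, comp_zero]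
      simpa [a] using congr_arg (fun f => f.hom (1 : R)) h)
  classical
  let B : ModuleCat.{u} R := ModuleCat.of R (s → R)
  let b : B ⟶ e.obj X := ModuleCat.ofHom
    (LinearMap.lsum R (fun _ : s => R) ℕ (fun x => LinearMap.toSpanSingleton R _ (x : e.obj X)))
  refine ⟨B, (adj.homEquiv _ _).symm b, inferInstanceAs (Module.Finite R (s → R)), ?_⟩
  rw [ModuleCat.epi_iff_range_eq_top, eq_top_iff, ← hs]
  refine iSup₂_le fun x hx => ?_
  let c : ModuleCat.of R R ⟶ B := ModuleCat.ofHom (LinearMap.single R (fun _ : s => R) ⟨x, hx⟩)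
  have hc : c ≫ b = a x := by
    exact ModuleCat.hom_ext (LinearMap.ext_ring (by
      change LinearMap.lsum R (fun _ : s => R) ℕ (fun x => LinearMap.toSpanSingleton R _ (x : e.obj X))
        (Pi.single ⟨x, hx⟩ 1) = (1 : R) • x
      rw [LinearMap.lsum_piSingle]
      rfl))
  have h : (adj.homEquiv _ _).symm (a x) = l.map c ≫ (adj.homEquiv _ _).symm b := by
    rw [← adj.homEquiv_naturality_left_symm, hc]
  rw [h]
  exact LinearMap.range_comp_le_range _ _

end Functors

end FinitelyGenerated

lemma exists_epi_iter {B : Type u} [Category.{v} B] [Abelian B] (F : B ⥤ B)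
    [PreservesFiniteColimits F] {Y : B} (f : F.obj Y ⟶ Y) [Epi f] (n : ℕ) :
    ∃ g : (iter F n).obj Y ⟶ Y, Epi g := by
  induction n with
  | zero => exact ⟨(𝟙 Y : Y ⟶ Y), inferInstanceAs (Epi (𝟙 Y))⟩
  | succ n ih =>
    obtain ⟨g, hg⟩ := ih
    exact ⟨F.map g ≫ f, inferInstanceAs (Epi (F.map g ≫ f))⟩

/-! ### The radical, Nakayama's lemma and preservation of finite generation -/

namespace CleftExtension

section Nilpotent

variable {B : Type u₁} [Category.{v₁} B] [Abelian B] {A : Type u₂} [Category.{v₂} A] [Abelian A]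
  (C : CleftExtension B A)

/-- The radical of `X` is the image of this morphism. -/
noncomputable def rad (X : A) : C.G.obj (C.i.obj (C.e.obj X)) ⟶ X :=
  C.γ.app (C.e.obj X) ≫ C.adj.counit.app X

/-- By naturality of `γ`, every morphism `l Y ⟶ X` sends `G i Y` into the radical of `X`. -/
lemma γ_comp_eq {Y : B} {X : A} (q : C.l.obj Y ⟶ X) :
    C.γ.app Y ≫ q = C.G.map (C.i.map (C.adj.homEquiv _ _ q)) ≫ C.rad X := by
  have h : C.G.map (C.i.map (C.adj.homEquiv _ _ q)) ≫ C.γ.app (C.e.obj X) =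
      C.γ.app Y ≫ C.l.map (C.adj.homEquiv _ _ q) := C.γ.naturality (C.adj.homEquiv _ _ q)
  rw [rad, reassoc_of% h, ← C.adj.homEquiv_counit, Equiv.symm_apply_apply]

/-- Nakayama's lemma. -/
lemma isZero_of_epi_rad [PreservesFiniteColimits C.F] {m : ℕ} (hm : IsZero (iter C.F m)) (X : A)
    [Epi (C.rad X)] : IsZero X := by
  have : Epi (C.e.map (C.rad X)) := inferInstance
  -- The source of `e (rad X)` is `F (e X)`; iterating the epimorphism `F (e X) ⟶ e X` covers `e X`
  -- by `F^m (e X) = 0`.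
  obtain ⟨g, hg⟩ := @exists_epi_iter _ _ _ C.F _ _ (C.e.map (C.rad X)) this m
  have h : IsZero (C.e.obj X) := IsZero.of_epi g ((iter C.F m).isZero_iff.1 hm _)
  exact (IsZero.iff_id_eq_zero _).2 (C.e.map_injective (h.eq_of_src _ _))

end Nilpotent

variable {R S : Type u} [Ring R] [Ring S] [IsNoetherianRing R] [IsNoetherianRing S]
  (C : CleftExtension (ModuleCat.{u} R) (ModuleCat.{u} S)) [PreservesFiniteColimits C.F]
  {m : ℕ} (hm : IsZero (iter C.F m))

include hm

omit [IsNoetherianRing S] in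
-- The quotient `i X` of `l X` is finitely generated, since `e i X ≅ X`. A finitely generated `N` in
-- `l X` mapping onto it leaves a quotient `l X / N` covered by `G i X`, hence equal to its radical,
-- hence zero.
lemma preservesFG_l : PreservesFG C.l := fun X hX => by
  have := (C.shortExact_γ_π X).epi_g
  have hi : ModuleCat.isFG S (C.i.obj X) :=
    isFG_of_isFG_map C.e _ (isFG_of_epi (C.iso.inv.app X) hX)
  have : Epi (C.π.app X) := this
  obtain ⟨N, j, hN, hj, hj'⟩ := exists_isFG_epi (C.π.app X) hi
  have : Epi (C.γ.app X ≫ cokernel.π j) := by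
    rw [Preadditive.epi_iff_cancel_zero]
    intro Z h hh
    rw [Category.assoc] at hh
    obtain ⟨t, ht : C.π.app X ≫ t = _⟩ :=
      CokernelCofork.IsColimit.desc' (C.shortExact_γ_π X).exact.gIsCokernel _ hh
    have ht' : t = 0 := by
      rw [← cancel_epi (j ≫ C.π.app X), Category.assoc, ht, cokernel.condition_assoc, zero_comp,
        comp_zero]
    rw [← cancel_epi (cokernel.π j), ← ht, ht', comp_zero, comp_zero]
  rw [γ_comp_eq] at this
  have := @epi_of_epi _ _ _ _ _ _ (C.rad (cokernel j)) this
  have h := C.isZero_of_epi_rad hm (cokernel j)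
  have : Epi j := Preadditive.epi_of_isZero_cokernel j h
  exact isFG_of_epi j hN

/-- Induction along the radical filtration. If `e X` is a quotient of `F^k Y`, then `e (rad X)` is
one of `F^(k+1) Y`, and this is zero once `k` reaches `m`. For the top, choose a cover `l Y₀ ⟶ X`
with `Y₀` finitely generated: modulo the radical it kills `G i Y₀`, so already `Y₀` maps onto `e (X
/ rad X)`. -/
lemma preservesFG_e : PreservesFG C.e := by
  suffices ∀ j k, k + j = m → ∀ X, ModuleCat.isFG S X →
      (∃ (Y : ModuleCat.{u} R) (f : (iter C.F k).obj Y ⟶ C.e.obj X), Epi f) →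
      ModuleCat.isFG R (C.e.obj X) from
    fun X hX => this m 0 (by lia) X hX ⟨C.e.obj X, (𝟙 _ : C.e.obj X ⟶ _), inferInstanceAs (Epi (𝟙 (C.e.obj X)))⟩
  intro j
  induction j with
  | zero =>
    rintro k hk X - ⟨Y, f, hf⟩
    obtain rfl : k = m := by lia
    have h : IsZero (C.e.obj X) := IsZero.of_epi f ((iter C.F k).isZero_iff.1 hm _)
    have := ModuleCat.subsingleton_of_isZero h
    exact inferInstanceAs (Module.Finite R (C.e.obj X))
  | succ j ih =>
    rintro k hk X hX ⟨Y, f, hf⟩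
    have h₁ : ModuleCat.isFG R (C.e.obj (image (C.rad X))) := by
      refine ih (k + 1) (by lia) _ (isFG_of_mono (image.ι (C.rad X)) hX)
        ⟨Y, C.F.map f ≫ C.e.map (factorThruImage (C.rad X)), ?_⟩
      have : Epi (C.F.map f) := inferInstance
      exact epi_comp' this (inferInstanceAs (Epi (C.e.map (factorThruImage (C.rad X)))))
    let T : ShortComplex (ModuleCat.{u} S) := ShortComplex.mk (image.ι (C.rad X))
      (cokernel.π (image.ι (C.rad X))) (by simp)
    have hT : T.ShortExact :=
      { exact := ShortComplex.exact_of_g_is_cokernel _ (cokernelIsCokernel _) }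
    obtain ⟨Y₀, q, hY₀, hq⟩ := exists_isFG_epi_map C.adj hX
    have hT' : C.γ.app Y₀ ≫ q ≫ T.g = 0 := by
      rw [← Category.assoc, γ_comp_eq, Category.assoc, ← image.fac (C.rad X), Category.assoc,
        show image.ι (C.rad X) ≫ T.g = 0 from T.zero, comp_zero, comp_zero]
    have hT'' : Epi (C.adj.unit.app Y₀ ≫ C.e.map (q ≫ T.g)) := by
      rw [Preadditive.epi_iff_cancel_zero]
      intro Z h hh
      have : Epi (C.e.map (q ≫ T.g)) := inferInstance
      rw [← cancel_epi (C.e.map (q ≫ T.g)), comp_zero]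
      have h₁ : C.e.map (C.γ.app Y₀) ≫ C.e.map (q ≫ T.g) ≫ h = 0 := by
        rw [← C.e.map_comp_assoc, hT', C.e.map_zero, zero_comp]
      -- Here `e l Y₀` is the sum of `F Y₀`, which maps to zero, and of `Y₀`, embedded by the unit.
      have h₂ := (C.cleftSplitting.splitting Y₀).id
      rw [← Category.id_comp (C.e.map (q ≫ T.g)), Category.assoc]
      refine (congr_arg (· ≫ C.e.map (q ≫ T.g) ≫ h) h₂.symm).trans ?_
      rw [Preadditive.add_comp, Category.assoc, Category.assoc]
      rw [Category.assoc] at hh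
      refine (congr_arg₂ (· + ·) (congr_arg (_ ≫ ·) h₁) (congr_arg (_ ≫ ·) hh)).trans ?_
      rw [comp_zero, add_zero]
      exact comp_zero
    exact isFG_of_shortExact (hT.map_of_exact C.e) h₁ (@isFG_of_epi _ _ _ _ _ hT'' hY₀)

lemma preservesFG_F : PreservesFG C.F := fun X hX =>
  have := (C.cleftSplitting.shortExact X).mono_f
  isFG_of_mono (C.cleftSplitting.κ.app X) (C.preservesFG_e hm _ (C.preservesFG_l hm _ hX))

end CleftExtension

end CleftGP

/-! ### Transfer of the hypotheses to finitely generated modules -/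

namespace CleftGP
open HomologicalComplex

lemma shortExact_of_shortExact_map {A : Type u₁} [Category.{v₁} A] [Abelian A] {B : Type u₂}
    [Category.{v₂} B] [Abelian B] (T : A ⥤ B) [T.Additive] [PreservesFiniteLimits T]
    [PreservesFiniteColimits T] [T.Faithful] {S : ShortComplex A} (hS : (S.map T).ShortExact) :
    S.ShortExact where
  exact := (S.exact_map_iff_of_faithful T).1 hS.exact
  mono_f := T.mono_of_mono_map hS.mono_f
  epi_g := T.epi_of_epi_map hS.epi_g

section Transfer

attribute [local instance] HasDerivedCategory.standard

variable {A : Type u₁} [Category.{v₁} A] [Abelian A] [EnoughProjectives A]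
  {B : Type u₂} [Category.{v₂} B] [Abelian B] [EnoughProjectives B]
  (ι : A ⥤ B) [ι.Additive] [PreservesFiniteLimits ι] [PreservesFiniteColimits ι] [ι.Faithful]
  (hι : ∀ P : A, Projective P → Projective (ι.obj P)) {T : A ⥤ A} {T' : B ⥤ B} [T.Additive]
  [T'.Additive] (α : T ⋙ ι ≅ ι ⋙ T')

include hι α in
/-- The left derived functors of a functor vanish if those of an extension of this functor to a
larger category with the same projective resolutions do. -/
lemma isZero_leftDerived_of_comp_iso {X : A} {i : ℕ}
    (h : IsZero ((T'.leftDerived (i + 1)).obj (ι.obj X))) :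
    IsZero ((T.leftDerived (i + 1)).obj X) := by
  let R := projectiveResolution X
  -- As `ι` is exact and preserves projectives, it sends a projective resolution of `X` to one of `ι
  -- X`; being faithful, it reflects exactness.
  let K := (mapC ι).obj R.cochainComplex
  have := isStrictlyLE_mapC ι R.cochainComplex 0
  have (n : ℤ) : Projective (K.X n) := hι _ (inferInstanceAs (Projective (R.cochainComplex.X n)))
  have := CochainComplex.isKProjective_of_projective K 0
  rw [isZero_leftDerived_iff_exactAt_cochainComplex T R]
  rw [isZero_leftDerived_iff T' K ((ι.mapDerivedCategoryFactors.app _).symm ≪≫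
    ι.mapDerivedCategory.mapIso (isoQCochainComplex R) ≪≫
      (ι.mapDerivedCategorySingleFunctor 0).app X)] at h
  let e : (mapC T').obj K ≅ (mapC ι).obj ((mapC T).obj R.cochainComplex) :=
    Hom.isoOfComponents (fun n => (α.app _).symm) (fun i j _ => (α.inv.naturality (R.cochainComplex.d i j)).symm)
  rw [exactAt_iff, ← ShortComplex.exact_map_iff_of_faithful _ ι]
  exact (exactAt_iff_of_quasiIso e.hom _).1 h

end Transfer

section FGModuleCat

variable (R : Type u) [Ring R] [IsNoetherianRing R]

instance : PreservesFiniteLimits (ModuleCat.isFG.{u} R).ι :=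
  inferInstanceAs (PreservesFiniteLimits (forget₂ (FGModuleCat.{u} R) (ModuleCat.{u} R)))

instance : PreservesFiniteColimits (ModuleCat.isFG.{u} R).ι :=
  inferInstanceAs (PreservesFiniteColimits (forget₂ (FGModuleCat.{u} R) (ModuleCat.{u} R)))

variable {R}

lemma projective_of_projective_ι {P : FGModuleCat.{u} R} (hP : Projective P.obj) :
    Projective P where
  factors {E X} f e _ := by
    have : Epi e.hom := inferInstanceAs (Epi ((ModuleCat.isFG.{u} R).ι.map e))
    exact ⟨ObjectProperty.homMk (Projective.factorThru f.hom e.hom),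
      ObjectProperty.hom_ext _ (Projective.factorThru_comp _ _)⟩

omit [IsNoetherianRing R] in
lemma exists_projective_epi (X : FGModuleCat.{u} R) :
    ∃ (P : FGModuleCat.{u} R) (f : P ⟶ X), Projective P.obj ∧ Epi f := by
  obtain ⟨n, f, hf⟩ := Module.Finite.exists_fin' R X.obj
  let P : FGModuleCat.{u} R := ⟨ModuleCat.of R (Fin n → R), inferInstanceAs (Module.Finite R _)⟩
  let g : P ⟶ X := ObjectProperty.homMk (ModuleCat.ofHom f)
  have : Epi ((ModuleCat.isFG.{u} R).ι.map g) := (ModuleCat.epi_iff_surjective _).2 hf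
  exact ⟨P, g, ModuleCat.projective_of_free (Pi.basisFun R (Fin n)),
    (ModuleCat.isFG.{u} R).ι.epi_of_epi_map this⟩

instance : EnoughProjectives (FGModuleCat.{u} R) where
  presentation X := by
    obtain ⟨P, f, hP, hf⟩ := exists_projective_epi X
    exact ⟨{ p := P, projective := projective_of_projective_ι hP, f := f, epi := hf }⟩

omit [IsNoetherianRing R] in
-- A projective finitely generated module is a retract of a finite free module.
lemma projective_ι {P : FGModuleCat.{u} R} (hP : Projective P) : Projective P.obj := by
  obtain ⟨Q, f, hQ, hf⟩ := exists_projective_epi P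
  let r : Retract P Q := ⟨Projective.factorThru (𝟙 P) f, f, Projective.factorThru_comp _ _⟩
  have hQ' : Projective ((ModuleCat.isFG.{u} R).ι.obj Q) := hQ
  exact (r.map (ModuleCat.isFG.{u} R).ι).projective

lemma hasProjectiveDimensionLE_of_ι {X : FGModuleCat.{u} R} {d : ℕ}
    (h : HasProjectiveDimensionLE X.obj d) : HasProjectiveDimensionLE X d := by
  induction d generalizing X with
  | zero =>
    rw [← projective_iff_hasProjectiveDimensionLE_zero] at h ⊢
    exact projective_of_projective_ι h
  | succ d ih =>
    let S : ShortComplex (FGModuleCat.{u} R) :=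
      ShortComplex.mk (kernel.ι (Projective.π X)) (Projective.π X) (by simp)
    have hS : S.ShortExact :=
      { exact := ShortComplex.exact_of_f_is_kernel _ (kernelIsKernel _) }
    have hS' := hS.map_of_exact (ModuleCat.isFG.{u} R).ι
    exact (hS.hasProjectiveDimensionLT_X₃_iff d inferInstance).2
      (ih ((hS'.hasProjectiveDimensionLT_X₃_iff d (projective_ι inferInstance)).1 h))

end FGModuleCat

section RestrictFG

variable {R S : Type u} [Ring R] [Ring S]

/-- The iterates of the restriction of a functor. -/
def iterRestrictFGIso (T : ModuleCat.{u} R ⥤ ModuleCat.{u} R) (h : PreservesFG T) :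
    ∀ n, iter (restrictFG T h) n ⋙ (ModuleCat.isFG R).ι ≅ (ModuleCat.isFG R).ι ⋙ iter T n
  | 0 => Iso.refl _
  | n + 1 => Functor.isoWhiskerRight (iterRestrictFGIso T h n) T

lemma isZero_iter_restrictFG [IsNoetherianRing R] (T : ModuleCat.{u} R ⥤ ModuleCat.{u} R) (h : PreservesFG T) {m : ℕ}
    (hm : IsZero (iter T m)) : IsZero (iter (restrictFG T h) m) := by
  rw [Functor.isZero_iff]
  intro X
  rw [← isZero_obj_iff_of_fullyFaithful (ModuleCat.isFG R).ι]
  exact (hm.obj _).of_iso ((iterRestrictFGIso T h m).app X)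

lemma isPerfect_restrictFG [IsNoetherianRing R] (T : ModuleCat.{u} R ⥤ ModuleCat.{u} R) [T.Additive]
    (h : PreservesFG T) (hT : IsPerfect T) : IsPerfect (restrictFG T h) := by
  have := hT.rightExact
  obtain ⟨n, hn⟩ := hT.vanishing
  refine ⟨inferInstance, fun i j hi hj P hP => ?_, ⟨n, fun p q hp hq hpq X => ?_⟩, fun P hP => ?_⟩
  · obtain ⟨i, rfl⟩ := Nat.exists_eq_add_of_le' hi
    exact isZero_leftDerived_of_comp_iso (ModuleCat.isFG R).ι (fun _ => projective_ι)
      (iterRestrictFGIso T h j) (hT.condR _ _ hi hj P.obj (projective_ι hP))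
  · obtain ⟨p, rfl⟩ := Nat.exists_eq_add_of_le' hp
    exact isZero_leftDerived_of_comp_iso (ModuleCat.isFG R).ι (fun _ => projective_ι)
      (iterRestrictFGIso T h q) (hn _ _ hp hq hpq X.obj)
  · obtain ⟨d, hd⟩ := hT.finiteProjDim P.obj (projective_ι hP)
    exact ⟨d, hasProjectiveDimensionLE_of_ι hd⟩

instance {T : ModuleCat.{u} R ⥤ ModuleCat.{u} S} (h : PreservesFG T) [T.Faithful] :
    (restrictFG T h).Faithful where
  map_injective hfg :=
    ObjectProperty.hom_ext _ (T.map_injective (congr_arg (fun k => k.hom) hfg))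

variable {l : ModuleCat.{u} R ⥤ ModuleCat.{u} S} {e : ModuleCat.{u} S ⥤ ModuleCat.{u} R}

/-- The restriction of an adjunction to finitely generated modules. -/
def restrictFGAdjunction (adj : l ⊣ e) (hl : PreservesFG l) (he : PreservesFG e) :
    restrictFG l hl ⊣ restrictFG e he where
  unit :=
    { app := fun X => ObjectProperty.homMk (adj.unit.app X.obj)
      naturality := fun _ _ f => ObjectProperty.hom_ext _ (adj.unit.naturality f.hom) }
  counit :=
    { app := fun X => ObjectProperty.homMk (adj.counit.app X.obj)
      naturality := fun _ _ f => ObjectProperty.hom_ext _ (adj.counit.naturality f.hom) }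
  left_triangle_components X :=
    ObjectProperty.hom_ext _ (adj.left_triangle_components X.obj)
  right_triangle_components X :=
    ObjectProperty.hom_ext _ (adj.right_triangle_components X.obj)

/-- The restriction of a splitting to finitely generated modules. -/
def CleftSplitting.restrictFG [IsNoetherianRing R] [IsNoetherianRing S] {adj : l ⊣ e}
    {F : ModuleCat.{u} R ⥤ ModuleCat.{u} R} (σ : CleftSplitting adj F) (hl : PreservesFG l)
    (he : PreservesFG e) (hF : PreservesFG F) :
    CleftSplitting (restrictFGAdjunction adj hl he) (CleftGP.restrictFG F hF) where
  κ :=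
    { app := fun X => ObjectProperty.homMk (σ.κ.app X.obj)
      naturality := fun _ _ f => ObjectProperty.hom_ext _ (σ.κ.naturality f.hom) }
  ρ :=
    { app := fun X => ObjectProperty.homMk (σ.ρ.app X.obj)
      naturality := fun _ _ f => ObjectProperty.hom_ext _ (σ.ρ.naturality f.hom) }
  zero X := ObjectProperty.hom_ext _ (σ.zero X.obj)
  shortExact X := shortExact_of_shortExact_map (ModuleCat.isFG R).ι (σ.shortExact X.obj)
  unit_ρ X := ObjectProperty.hom_ext _ (σ.unit_ρ X.obj)

end RestrictFG

end CleftGP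

theorem mainTheorem9 (Γ Λ : Type u) [Ring Γ] [Ring Λ]
    [IsNoetherianRing Γᵐᵒᵖ] [IsNoetherianRing Λᵐᵒᵖ]
    [HasDerivedCategory.{w₁} (FGModuleCat.{u} Γᵐᵒᵖ)]
    [HasDerivedCategory.{w₂} (FGModuleCat.{u} Λᵐᵒᵖ)]
    (C : CleftExtension (ModuleCat.{u} Γᵐᵒᵖ) (ModuleCat.{u} Λᵐᵒᵖ))
    (hperf : IsPerfect C.F) (hnil : IsNilpotentFunctor C.F) :
    ∃ (he : PreservesFG C.e) (hF : PreservesFG C.F)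
      (eSg : SingularityCategory (FGModuleCat.{u} Λᵐᵒᵖ) ⥤
        SingularityCategory (FGModuleCat.{u} Γᵐᵒᵖ))
      (LFSg : SingularityCategory (FGModuleCat.{u} Γᵐᵒᵖ) ⥤
        SingularityCategory (FGModuleCat.{u} Γᵐᵒᵖ)),
      IsSgInduced (restrictFG C.e he) eSg ∧ IsSgLeftDerived (restrictFG C.F hF) LFSg ∧
      ∀ eStab : StableGProj (FGModuleCat.{u} Λᵐᵒᵖ) ⥤ StableGProj (FGModuleCat.{u} Γᵐᵒᵖ),
        IsStableRestriction eSg eStab →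
          (∃ FStab : StableGProj (FGModuleCat.{u} Γᵐᵒᵖ) ⥤ StableGProj (FGModuleCat.{u} Γᵐᵒᵖ),
            IsStableRestriction LFSg FStab) ∧
          ∀ FStab : StableGProj (FGModuleCat.{u} Γᵐᵒᵖ) ⥤ StableGProj (FGModuleCat.{u} Γᵐᵒᵖ),
            IsStableRestriction LFSg FStab → (eStab.IsEquivalence ↔ IsZero FStab) := by
  obtain ⟨m, hm⟩ := hnil
  have := hperf.rightExact
  have hl := C.preservesFG_l hm
  have he := C.preservesFG_e hm
  have hF := C.preservesFG_F hm
  let σ := C.cleftSplitting.restrictFG hl he hF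
  have hP : IsPerfect (restrictFG C.F hF) := isPerfect_restrictFG C.F hF hperf
  have hm' := isZero_iter_restrictFG C.F hF hm
  obtain ⟨eSg, hSg⟩ := exists_isSgInduced (restrictFG C.e he)
    (fun P hP' => σ.finProjDim_of_projective hP P)
  -- The index `0` stands for the first power, since `iter F 1` unfolds to `F`.
  obtain ⟨N, hN⟩ := hP.exists_vanishing 0
  obtain ⟨LFSg, hLF⟩ := exists_isSgLeftDerived (T := restrictFG C.F hF) N hN hP.finiteProjDim
  refine ⟨he, hF, eSg, LFSg, hSg, hLF, fun eStab hα => ?_⟩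
  obtain ⟨θ⟩ := nonempty_toSg_comp_iso _ hSg
  -- Gorenstein projectives are acyclic for `F`, so no derived functor is left in the comparison.
  have hL (X : FGModuleCat.{u} Γᵐᵒᵖ) (hX : isGorensteinProjective _ X) :
      Nonempty (LFSg.obj ((toSg _).obj X) ≅ (toSg _).obj ((restrictFG C.F hF).obj X)) :=
    nonempty_sgLeftDerived_toSg_iso hLF (hP.leftAcyclic 0 hX)
  exact ⟨σ.exists_isStableRestriction hP θ hα hL,
    fun FStab hβ => σ.isEquivalence_iff_isZero hP θ hα hm' hL hβ⟩
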